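/- **Theorem.** Let $n\ge 1$ and let $G(\mathbb H)=\mathbb H^n\times\operatorname{Im}\mathbb H$ be the quaternionic Heisenberg group, with group law $(q_0,\omega_0)\circ(q,\omega)=(q_0+q,\ \omega_0+\omega+2\operatorname{Im} q_0\bar q)$, where $q_0\bar q=\sum_{\alpha} q_0^\alpha\overline{q^\alpha}$, and with its standard quaternionic contact (qc) form $\tilde\Theta=\tfrac12(d\omega-q\cdot d\bar q+dq\cdot\bar q)$. Let $\Omega\subseteq G(\mathbb H)$ be a connected open set (for instance $\Omega=G(\mathbb H)$), let $h$ be a positive smooth function on $\Omega$, and consider the qc structure on $\Omega$ defined by the conformal deformation $\Theta=\frac1{2h}\tilde\Theta$. Let $R$ be the curvature of its Biquard connection, let $g$ be its horizontal metric on $H=\operatorname{Ker}\Theta$ (normalized by $2g(I_sX,Y)=d\Theta_s(X,Y)$), and, for a $g$-orthonormal basis $(e_a)$ of $H$, let $\mathrm{Ric}(X,Y)=\sum_b g(R(e_b,X)Y,e_b)$ and $S_\Theta=\sum_a\mathrm{Ric}(e_a,e_a)$. Suppose that $\Theta$ is qc-Einstein, that is, $\mathrm{Ric}(X,Y)=\frac{S_\Theta}{4n}g(X,Y)$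 for all $X,Y\in H$; if $n=1$, suppose in addition that $S_\Theta$ is constant. Then one of the following holds. 1. There are constants $c_0>0$, $\sigma\in\mathbb R$ and a point $(q_0,\omega_0)\in G(\mathbb H)$ such that $$h(q,\omega)=c_0\Big[\big(\sigma+|q+q_0|^2\big)^2+\big|\omega+\omega_0+2\operatorname{Im}q_0\bar q\big|^2\Big]\quad\text{on }\Omega,$$ that is, up to a left translation $h=c_0[(\sigma+|q|^2)^2+|\omega|^2]$; and $S_\Theta=128\,n(n+2)\,c_0\,\sigma$. 2. There are $a\in\mathbb H$ and $c=(c^1,\dots,c^n)\in\mathbb H^n$ such that $h(q,\omega)=\big|a+\sum_\alpha c^\alpha\overline{q^\alpha}\big|^2$ on $\Omega$; and $S_\Theta=-32\,n(n+2)\,|c|^2$. If $\Omega=G(\mathbb H)$, then $c=0$, so that $h$ is constant and $S_\Theta=0$. -/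

import Mathlib

open scoped Quaternion ContDiff

noncomputable section

namespace QC

section General

/-! Quaternionic contact geometry on an open subset `Ω` of a real vector space `E`, in the
linear chart `E`. Tensor fields and connections are functions on `E` of which only the values on
`Ω` matter. -/

variable {E : Type*} [NormedAddCommGroup E] [NormedSpace ℝ E]

/-- The exterior derivative `dα(X, Y)` of a 1-form `α` at `p`
(normalised by `dα(X, Y) = X α(Y) - Y α(X) - α([X, Y])`). -/
def dForm (α : E → E →L[ℝ] ℝ) (p X Y : E) : ℝ :=
  fderiv ℝ α p X Y - fderiv ℝ α p Y X

/-- The horizontal space `H_p = ⋂ₛ Ker ηₛ(p)`. -/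
def horizontal (η : Fin 3 → E → E →L[ℝ] ℝ) (p : E) : Submodule ℝ E :=
  ⨅ s, LinearMap.ker (η s p : E →ₗ[ℝ] ℝ)

/-- `∇_v Y` at `p` for the linear connection `∇ = D + Γ`. -/
def covDeriv (Γ : E → E →L[ℝ] E →L[ℝ] E) (Y : E → E) (p v : E) : E :=
  fderiv ℝ Y p v + Γ p v (Y p)

/-- The torsion `T(A, B) = ∇_A B - ∇_B A - [A, B]` of `∇ = D + Γ`
(computed on constant vector fields). -/
def torsion (Γ : E → E →L[ℝ] E →L[ℝ] E) (p A B : E) : E :=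
  Γ p A B - Γ p B A

/-- The curvature `R(A, B)C = [∇_A, ∇_B]C - ∇_{[A, B]}C` of `∇ = D + Γ`
(computed on constant vector fields, for which `∇_B C = Γ(B, C)` and `[A, B] = 0`). -/
def curvature (Γ : E → E →L[ℝ] E →L[ℝ] E) (p A B C : E) : E :=
  covDeriv Γ (fun x => Γ x B C) p A - covDeriv Γ (fun x => Γ x A C) p B

/-- A quaternionic contact structure on `Ω ⊆ E`, `dim E = 4n + 3`, with contact form
`η = (η₁, η₂, η₃)`: a metric `g` and endomorphisms `I₁, I₂, I₃` of the horizontal bundle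
`H = ⋂ₛ Ker ηₛ` satisfying the quaternion relations and `2 g(Iₛ X, Y) = dηₛ(X, Y)`, together with
the Reeb vector fields `ξ₁, ξ₂, ξ₃`. As usual `g` stands also for its extension
`g + ∑ₛ ηₛ ⊗ ηₛ` to a Riemannian metric, and `Iₛ` is extended by zero on the vertical space
`V = span (ξ₁, ξ₂, ξ₃)`. All these data are determined by `η` on `Ω`. -/
structure QCStructure (n : ℕ) (Ω : Set E) (η : Fin 3 → E → E →L[ℝ] ℝ) where
  finrank_eq : Module.finrank ℝ E = 4 * n + 3
  isOpen : IsOpen Ω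
  g : E → E →L[ℝ] E →L[ℝ] ℝ
  I : Fin 3 → E → E →L[ℝ] E
  ξ : Fin 3 → E → E
  contDiffOn_η : ∀ s, ContDiffOn ℝ ∞ (η s) Ω
  contDiffOn_g : ContDiffOn ℝ ∞ g Ω
  contDiffOn_I : ∀ s, ContDiffOn ℝ ∞ (I s) Ω
  contDiffOn_ξ : ∀ s, ContDiffOn ℝ ∞ (ξ s) Ω
  -- the Reeb vector fields
  reeb_dual : ∀ p ∈ Ω, ∀ s t, η s p (ξ t p) = if s = t then 1 else 0
  reeb_skew : ∀ p ∈ Ω, ∀ s t, ∀ X ∈ horizontal η p,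
    dForm (η t) p (ξ s p) X = - dForm (η s) p (ξ t p) X
  -- the metric
  g_symm : ∀ p ∈ Ω, ∀ X Y, g p X Y = g p Y X
  g_pos : ∀ p ∈ Ω, ∀ X ∈ horizontal η p, X ≠ 0 → 0 < g p X X
  g_reeb : ∀ p ∈ Ω, ∀ s v, g p (ξ s p) v = η s p v
  -- the almost complex structures
  I_mem : ∀ p ∈ Ω, ∀ s, ∀ X ∈ horizontal η p, I s p X ∈ horizontal η p
  I_reeb : ∀ p ∈ Ω, ∀ s t, I s p (ξ t p) = 0
  I_sq : ∀ p ∈ Ω, ∀ s, ∀ X ∈ horizontal η p, I s p (I s p X) = - X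
  I_mul : ∀ p ∈ Ω, ∀ X ∈ horizontal η p, I 0 p (I 1 p X) = I 2 p X
  I_anticomm : ∀ p ∈ Ω, ∀ X ∈ horizontal η p, I 1 p (I 0 p X) = - I 2 p X
  -- compatibility
  g_I : ∀ p ∈ Ω, ∀ s, ∀ X ∈ horizontal η p, ∀ Y ∈ horizontal η p,
    g p (I s p X) (I s p Y) = g p X Y
  two_g_I : ∀ p ∈ Ω, ∀ s, ∀ X ∈ horizontal η p, ∀ Y ∈ horizontal η p,
    2 * g p (I s p X) Y = dForm (η s) p X Y

variable {n : ℕ} {Ω : Set E} {η : Fin 3 → E → E →L[ℝ] ℝ}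

namespace QCStructure

/-- `e` is an orthonormal basis of the horizontal space `H_p` (which has dimension `4n`). -/
def IsFrame (Q : QCStructure n Ω η) (p : E) (e : Fin (4 * n) → E) : Prop :=
  (∀ a, e a ∈ horizontal η p) ∧ ∀ a b, Q.g p (e a) (e b) = if a = b then 1 else 0

/-- `A` restricts to an element of `sp(n) ⊂ End(H_p)`: a skew-symmetric endomorphism of `H_p`
that commutes with `I₁, I₂, I₃`. -/
def IsSp (Q : QCStructure n Ω η) (p : E) (A : E →L[ℝ] E) : Prop :=
  (∀ X ∈ horizontal η p, A X ∈ horizontal η p) ∧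
  (∀ X ∈ horizontal η p, ∀ Y ∈ horizontal η p, Q.g p (A X) Y = - Q.g p X (A Y)) ∧
  ∀ s, ∀ X ∈ horizontal η p, A (Q.I s p X) = Q.I s p (A X)

/-- `∇ = D + Γ` is the Biquard connection of the qc structure. -/
structure IsBiquardConnection (Q : QCStructure n Ω η) (Γ : E → E →L[ℝ] E →L[ℝ] E) : Prop where
  contDiffOn : ContDiffOn ℝ ∞ Γ Ω
  /-- `H` is parallel: `(∇_v ηₛ)(X) = 0` for horizontal `X`, i.e. `∇_v` maps sections of `H` to
  sections of `H`. -/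
  horizontal_parallel : ∀ p ∈ Ω, ∀ v, ∀ X ∈ horizontal η p, ∀ s,
    fderiv ℝ (η s) p v X - η s p (Γ p v X) = 0
  /-- `V` is parallel. -/
  vertical_parallel : ∀ p ∈ Ω, ∀ v s,
    covDeriv Γ (Q.ξ s) p v ∈ Submodule.span ℝ (Set.range fun t => Q.ξ t p)
  /-- The horizontal metric is parallel: `(∇_v g)(X, Y) = 0`. -/
  metric_parallel : ∀ p ∈ Ω, ∀ v, ∀ X ∈ horizontal η p, ∀ Y ∈ horizontal η p,
    fderiv ℝ Q.g p v X Y - Q.g p (Γ p v X) Y - Q.g p X (Γ p v Y) = 0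
  /-- The bundle spanned by `I₁, I₂, I₃` is parallel: `∇_v Iₛ = ∑ₜ aₛₜ Iₜ` on `H`. -/
  quaternionic_parallel : ∀ p ∈ Ω, ∀ v, ∃ a : Fin 3 → Fin 3 → ℝ, ∀ s, ∀ X ∈ horizontal η p,
    fderiv ℝ (Q.I s) p v X + Γ p v (Q.I s p X) - Q.I s p (Γ p v X) = ∑ t, a s t • Q.I t p X
  /-- `T(X, Y) = -[X, Y]_V = ∑ₛ dηₛ(X, Y) ξₛ` for horizontal `X`, `Y`. -/
  torsion_horizontal : ∀ p ∈ Ω, ∀ X ∈ horizontal η p, ∀ Y ∈ horizontal η p,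
    torsion Γ p X Y = ∑ s, dForm (η s) p X Y • Q.ξ s p
  /-- `T(ξ, X)` is horizontal for vertical `ξ` and horizontal `X`. -/
  torsion_vertical : ∀ p ∈ Ω, ∀ s, ∀ X ∈ horizontal η p,
    torsion Γ p (Q.ξ s p) X ∈ horizontal η p
  /-- `T_ξ` is orthogonal to `sp(n)` in `End(H)`. -/
  torsion_perp_sp : ∀ p ∈ Ω, ∀ s, ∀ e, Q.IsFrame p e → ∀ A, Q.IsSp p A →
    ∑ a, Q.g p (torsion Γ p (Q.ξ s p) (e a)) (A (e a)) = 0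
  /-- `T_ξ` is orthogonal to `sp(1) = span (I₁, I₂, I₃)` in `End(H)`. -/
  torsion_perp_sp_one : ∀ p ∈ Ω, ∀ s, ∀ e, Q.IsFrame p e → ∀ t,
    ∑ a, Q.g p (torsion Γ p (Q.ξ s p) (e a)) (Q.I t p (e a)) = 0

/-- The qc-Ricci tensor `Ric(A, B) = ∑_b R(e_b, A, B, e_b)`, where
`R(A, B, C, D) = g(R(A, B)C, D)`; `e` is an orthonormal basis of `H_p`. -/
def ricci (Q : QCStructure n Ω η) (Γ : E → E →L[ℝ] E →L[ℝ] E) (p : E) (e : Fin (4 * n) → E)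
    (A B : E) : ℝ :=
  ∑ b, Q.g p (curvature Γ p (e b) A B) (e b)

/-- The qc-scalar curvature `S = ∑_{a, b} R(e_b, e_a, e_a, e_b)` at `p`. -/
def scal (Q : QCStructure n Ω η) (Γ : E → E →L[ℝ] E →L[ℝ] E) (p : E) (e : Fin (4 * n) → E) : ℝ :=
  ∑ a, Q.ricci Γ p e (e a) (e a)

/-- The qc structure with Biquard connection `∇ = D + Γ` is qc-Einstein:
`Ric(X, Y) = (S / 4n) g(X, Y)` for horizontal `X`, `Y`. -/
def IsQCEinstein (Q : QCStructure n Ω η) (Γ : E → E →L[ℝ] E →L[ℝ] E) : Prop :=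
  ∀ p ∈ Ω, ∀ e, Q.IsFrame p e → ∀ X ∈ horizontal η p, ∀ Y ∈ horizontal η p,
    Q.ricci Γ p e X Y = Q.scal Γ p e / (4 * n) * Q.g p X Y

/-- The qc-scalar curvature is equal to the constant `k` on `Ω`. -/
def HasConstantScal (Q : QCStructure n Ω η) (Γ : E → E →L[ℝ] E →L[ℝ] E) (k : ℝ) : Prop :=
  ∀ p ∈ Ω, ∀ e, Q.IsFrame p e → Q.scal Γ p e = k

end QCStructure

end General

/-- The space `ℍⁿ × Im ℍ` underlying the quaternionic Heisenberg group, in real coordinates: a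
point `(q, ω)` consists of the real components `(tᵅ, xᵅ, yᵅ, zᵅ)` of the quaternions
`qᵅ = tᵅ + xᵅ i + yᵅ j + zᵅ k` and the components `(x, y, z)` of `ω = x i + y j + z k`. -/
abbrev QHeis (n : ℕ) : Type := (Fin n → Fin 4 → ℝ) × (Fin 3 → ℝ)

/-- The quaternionic coordinates `q = (q¹, …, qⁿ)` of the point `(q, ω)`. -/
def qcoord {n : ℕ} (p : QHeis n) (i : Fin n) : ℍ[ℝ] :=
  ⟨p.1 i 0, p.1 i 1, p.1 i 2, p.1 i 3⟩

/-- The three components of the imaginary part of a quaternion. -/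
def im (s : Fin 3) (a : ℍ[ℝ]) : ℝ := ![a.imI, a.imJ, a.imK] s

theorem qcoord_add {n : ℕ} (p v : QHeis n) (i : Fin n) :
    qcoord (p + v) i = qcoord p i + qcoord v i := by
  ext <;> rfl

theorem qcoord_smul {n : ℕ} (c : ℝ) (p : QHeis n) (i : Fin n) :
    qcoord (c • p) i = c • qcoord p i := by
  ext <;> rfl

theorem im_add (s : Fin 3) (a b : ℍ[ℝ]) : im s (a + b) = im s a + im s b := by
  fin_cases s <;> simp [im]

theorem im_smul (s : Fin 3) (c : ℝ) (a : ℍ[ℝ]) : im s (c • a) = c * im s a := by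
  fin_cases s <;> simp [im]

/-- The components of the standard contact form
`Θ̃ = ½ (dω - q · dq̄ + dq · q̄) = ½ dω + Im (dq · q̄)` on `ℍⁿ × Im ℍ`. -/
def stdForm (n : ℕ) (s : Fin 3) (p : QHeis n) : QHeis n →L[ℝ] ℝ :=
  LinearMap.toContinuousLinearMap
    { toFun := fun v => 1 / 2 * v.2 s + im s (∑ i, qcoord v i * star (qcoord p i))
      map_add' := by
        intro v w
        simp only [qcoord_add, add_mul, Finset.sum_add_distrib, im_add, Prod.snd_add, Pi.add_apply]
        ring
      map_smul' := by
        intro c v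
        simp only [qcoord_smul, smul_mul_assoc, ← Finset.smul_sum, im_smul, Prod.smul_snd,
          Pi.smul_apply, smul_eq_mul, RingHom.id_apply]
        ring }

/-- The conformal deformation `Θ = (1 / 2h) Θ̃`. -/
def confForm {n : ℕ} (h : QHeis n → ℝ) (s : Fin 3) (p : QHeis n) : QHeis n →L[ℝ] ℝ :=
  (1 / (2 * h p)) • stdForm n s p

end QC

end

noncomputable section

namespace QC

variable {n : ℕ}

/-! ### The left `ℍ`-module `ℍⁿ` -/

/-! The contact form determines all other data. Write u for the horizontal gradient of h in the
left-invariant frame `hor · A`, and e_s for the imaginary units. The compatibility conditions force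
g = ⟨·,·⟩/2h, I_s = left multiplication by e_s, and ξ_s = e_s u + 2h `vert s` (`g_hor`, `I_hor`,
`reeb_eq`). The Biquard connection is then computed from its axioms. Along H it is given by the
Koszul formula (`conn_hor`). In the vertical directions the diagonal of Ric only sees the pairings
of ∇A with e_s A, and these follow from the orthogonality of the torsion to sp(n) and sp(1)
(`four_rip_of_normalizer`). The outcome, `ricci_hor`, expresses Ric(A, A) through u and the
horizontal Hessian of h on A and on the e_s A.

Under the qc-Einstein condition the symmetric part of the Hessian is therefore known up to its trace
(`quadratic_invariant`, `hess_quadratic`). The skew part comes from brackets of horizontal fields,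
that is, from the vertical derivatives of h. Together (`hess_eq`) D_A u = M A + (A, u) u / 2h, where
the quaternion M collects the trace part and the vertical derivatives. The commutation relations for
second derivatives of u then give D_A M = (A, u) M / 2h (`defect_eq_zero`). For n ≥ 2 this is
automatic. For n = 1 it uses that the scalar curvature, a multiple of 4λ - |u|²/h with λ = Re M, is
constant.

The closed first order system for (h, u, M) is integrated explicitly. The quantity |M|²/2h is a
constant c. If c ≠ 0, then M* u / 2h = c (q + q₀), hence M is an explicit quadratic function of (q,
ω), and h = |M|²/2c (`solve_of_ne_zero`). If c = 0, then M = 0, the products u_i* u_j / 2h are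
constant, and h is the squared norm of an affine function a + (c, q), now with c a vector of ℍⁿ
(`solve_of_eq_zero`). On the whole group such a function has a zero unless that vector vanishes. -/

/-- The quaternionic Hermitian form `∑ᵢ Xᵢ star Yᵢ` on `ℍⁿ`. -/
def hip (X Y : Fin n → ℍ[ℝ]) : ℍ[ℝ] := ∑ i, X i * star (Y i)

/-- The Euclidean inner product of `ℍⁿ`. -/
def rip (X Y : Fin n → ℍ[ℝ]) : ℝ := (hip X Y).re

/-- The imaginary units `i`, `j`, `k`. -/
def unit (s : Fin 3) : ℍ[ℝ] := ![⟨0, 1, 0, 0⟩, ⟨0, 0, 1, 0⟩, ⟨0, 0, 0, 1⟩] s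

/-- The real basis `1`, `i`, `j`, `k` of `ℍ`. -/
def qbasis (t : Fin 4) : ℍ[ℝ] := ![1, ⟨0, 1, 0, 0⟩, ⟨0, 0, 1, 0⟩, ⟨0, 0, 0, 1⟩] t

/-- The standard real basis of `ℍⁿ`. -/
def stdBasis (k : Fin n × Fin 4) : Fin n → ℍ[ℝ] := Pi.single k.1 (qbasis k.2)

@[simp] theorem re_unit_zero : (unit 0).re = 0 := rfl
@[simp] theorem imI_unit_zero : (unit 0).imI = 1 := rfl
@[simp] theorem imJ_unit_zero : (unit 0).imJ = 0 := rfl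
@[simp] theorem imK_unit_zero : (unit 0).imK = 0 := rfl
@[simp] theorem re_unit_one : (unit 1).re = 0 := rfl
@[simp] theorem imI_unit_one : (unit 1).imI = 0 := rfl
@[simp] theorem imJ_unit_one : (unit 1).imJ = 1 := rfl
@[simp] theorem imK_unit_one : (unit 1).imK = 0 := rfl
@[simp] theorem re_unit_two : (unit 2).re = 0 := rfl
@[simp] theorem imI_unit_two : (unit 2).imI = 0 := rfl
@[simp] theorem imJ_unit_two : (unit 2).imJ = 0 := rfl
@[simp] theorem imK_unit_two : (unit 2).imK = 1 := rfl
@[simp] theorem qbasis_zero : qbasis 0 = 1 := rfl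
@[simp] theorem qbasis_one : qbasis 1 = unit 0 := rfl
@[simp] theorem qbasis_two : qbasis 2 = unit 1 := rfl
@[simp] theorem qbasis_three : qbasis 3 = unit 2 := rfl
@[simp] theorem im_zero (a : ℍ[ℝ]) : im 0 a = a.imI := rfl
@[simp] theorem im_one (a : ℍ[ℝ]) : im 1 a = a.imJ := rfl
@[simp] theorem im_two (a : ℍ[ℝ]) : im 2 a = a.imK := rfl

theorem qbasis_succ (s : Fin 3) : qbasis s.succ = unit s := by fin_cases s <;> rfl

theorem re_sum {ι : Type*} (s : Finset ι) (f : ι → ℍ[ℝ]) :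
    (∑ i ∈ s, f i).re = ∑ i ∈ s, (f i).re := by
  classical
  induction s using Finset.induction_on with
  | empty => simp
  | insert a s ha ih => simp [Finset.sum_insert ha, ih]

theorem coe_sum {ι : Type*} (s : Finset ι) (f : ι → ℝ) :
    ((∑ i ∈ s, f i : ℝ) : ℍ[ℝ]) = ∑ i ∈ s, (f i : ℍ[ℝ]) :=
  map_sum (algebraMap ℝ ℍ[ℝ]) f s

theorem re_mul_comm (a b : ℍ[ℝ]) : (a * b).re = (b * a).re := by
  simp only [Quaternion.re_mul]; ring

section hip

variable (X Y Z : Fin n → ℍ[ℝ]) (a : ℍ[ℝ]) (r : ℝ)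

theorem hip_add_left : hip (X + Y) Z = hip X Z + hip Y Z := by
  simp [hip, add_mul, Finset.sum_add_distrib]

theorem hip_add_right : hip X (Y + Z) = hip X Y + hip X Z := by
  simp [hip, mul_add, Finset.sum_add_distrib]

theorem hip_neg_left : hip (-X) Y = -hip X Y := by simp [hip]

theorem hip_neg_right : hip X (-Y) = -hip X Y := by simp [hip]

theorem hip_sub_left : hip (X - Y) Z = hip X Z - hip Y Z := by
  simp [hip, sub_mul, Finset.sum_sub_distrib]

theorem hip_smul_left : hip (a • X) Y = a * hip X Y := by
  simp [hip, Finset.mul_sum, mul_assoc]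

theorem hip_smul_right : hip X (a • Y) = hip X Y * star a := by
  simp [hip, Finset.sum_mul, mul_assoc]

theorem hip_rsmul_left : hip (r • X) Y = r • hip X Y := by
  simp [hip, Finset.smul_sum]

theorem hip_rsmul_right : hip X (r • Y) = r • hip X Y := by
  simp [hip, Finset.smul_sum]

@[simp] theorem hip_zero_left : hip 0 Y = 0 := by simp [hip]

@[simp] theorem hip_zero_right : hip X 0 = 0 := by simp [hip]

theorem star_hip : star (hip X Y) = hip Y X := by simp [hip]

theorem rip_comm : rip X Y = rip Y X := by
  rw [rip, rip, ← star_hip X Y, Quaternion.re_star]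

theorem hip_self : hip X X = ((rip X X : ℝ) : ℍ[ℝ]) := by
  have h := star_hip X X
  have h1 := congrArg QuaternionAlgebra.imI h
  have h2 := congrArg QuaternionAlgebra.imJ h
  have h3 := congrArg QuaternionAlgebra.imK h
  simp only [Quaternion.imI_star, Quaternion.imJ_star, Quaternion.imK_star] at h1 h2 h3
  ext
  · simp [rip]
  · simp; linarith
  · simp; linarith
  · simp; linarith

theorem rip_self_eq_sum : rip X X = ∑ i, ‖X i‖ ^ 2 := by
  simp only [rip, hip, re_sum, Quaternion.self_mul_star, Quaternion.re_coe,
    Quaternion.normSq_eq_norm_mul_self, sq]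

theorem rip_self_nonneg : 0 ≤ rip X X := by
  rw [rip_self_eq_sum]; positivity

theorem rip_self_eq_zero {X : Fin n → ℍ[ℝ]} : rip X X = 0 ↔ X = 0 := by
  rw [rip_self_eq_sum, Finset.sum_eq_zero_iff_of_nonneg (fun i _ => by positivity)]
  constructor
  · intro h
    ext1 i
    simpa using h i (Finset.mem_univ i)
  · rintro rfl
    simp

theorem rip_self_pos {X : Fin n → ℍ[ℝ]} (h : X ≠ 0) : 0 < rip X X :=
  (rip_self_nonneg X).lt_of_ne fun h' => h (rip_self_eq_zero.1 h'.symm)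

theorem rip_add_left : rip (X + Y) Z = rip X Z + rip Y Z := by simp [rip, hip_add_left]
theorem rip_add_right : rip X (Y + Z) = rip X Y + rip X Z := by simp [rip, hip_add_right]
theorem rip_neg_left : rip (-X) Y = -rip X Y := by simp [rip, hip_neg_left]
theorem rip_neg_right : rip X (-Y) = -rip X Y := by simp [rip, hip_neg_right]
theorem rip_sub_left : rip (X - Y) Z = rip X Z - rip Y Z := by simp [rip, hip_sub_left]
theorem rip_rsmul_left : rip (r • X) Y = r * rip X Y := by simp [rip, hip_rsmul_left]
theorem rip_rsmul_right : rip X (r • Y) = r * rip X Y := by simp [rip, hip_rsmul_right]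
theorem rip_smul_left : rip (a • X) Y = (a * hip X Y).re := by simp [rip, hip_smul_left]
theorem rip_smul_right : rip X (a • Y) = rip (star a • X) Y := by
  rw [rip, hip_smul_right, re_mul_comm, rip_smul_left]
@[simp] theorem rip_zero_left : rip 0 Y = 0 := by simp [rip]
@[simp] theorem rip_zero_right : rip X 0 = 0 := by simp [rip]

theorem rip_sum_left {ι : Type*} (s : Finset ι) (f : ι → Fin n → ℍ[ℝ]) :
    rip (∑ i ∈ s, f i) Y = ∑ i ∈ s, rip (f i) Y := by
  classical
  induction s using Finset.induction_on with
  | empty => simp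
  | insert a s ha ih => simp [Finset.sum_insert ha, ih, rip_add_left]

theorem rip_ext {X Y : Fin n → ℍ[ℝ]} (h : ∀ Z, rip X Z = rip Y Z) : X = Y := by
  rw [← sub_eq_zero, ← rip_self_eq_zero, rip_sub_left, h, sub_self]

theorem rip_unit_left (s : Fin 3) : rip (unit s • X) Y = -im s (hip X Y) := by
  rw [rip_smul_left]
  fin_cases s <;> simp [Quaternion.re_mul]

theorem rip_unit_right (s : Fin 3) : rip X (unit s • Y) = im s (hip X Y) := by
  rw [rip, hip_smul_right]
  fin_cases s <;> simp [Quaternion.re_mul]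

theorem eq_re_add_im (a : ℍ[ℝ]) : a = (a.re : ℍ[ℝ]) + ∑ s, (im s a : ℍ[ℝ]) * unit s := by
  ext <;> simp [Fin.sum_univ_three]

end hip

/-! ### Orthonormal bases and traces -/

section basis

theorem hip_single_left (i : Fin n) (a : ℍ[ℝ]) (Y : Fin n → ℍ[ℝ]) :
    hip (Pi.single i a) Y = a * star (Y i) := by
  rw [hip, Finset.sum_eq_single i]
  · simp
  · intro j _ hj; simp [hj]
  · simp

theorem hip_single_right (i : Fin n) (a : ℍ[ℝ]) (Y : Fin n → ℍ[ℝ]) :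
    hip Y (Pi.single i a) = Y i * star a := by
  rw [← star_hip, hip_single_left]; simp

theorem sum_stdBasis (X : Fin n → ℍ[ℝ]) : ∑ k, rip X (stdBasis k) • stdBasis k = X := by
  rw [Fintype.sum_prod_type]
  ext1 j
  simp only [stdBasis, rip, hip_single_right, Finset.sum_apply, Pi.smul_apply]
  rw [Finset.sum_eq_single j]
  · ext <;> simp [Fin.sum_univ_four, Quaternion.re_mul]
  · intro i _ hi
    simp [hi.symm]
  · simp

theorem sum_rip_stdBasis_smul {F : Type*} [AddCommGroup F] [Module ℝ F]
    (K : (Fin n → ℍ[ℝ]) →ₗ[ℝ] F) (X : Fin n → ℍ[ℝ]) :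
    ∑ k, rip X (stdBasis k) • K (stdBasis k) = K X := by
  conv_rhs => rw [← sum_stdBasis X]
  simp

theorem sum_rip_mul_rip (X Y : Fin n → ℍ[ℝ]) :
    ∑ k, rip X (stdBasis k) * rip Y (stdBasis k) = rip X Y := by
  conv_rhs => rw [← sum_stdBasis X]
  rw [rip_sum_left]
  exact Finset.sum_congr rfl fun k _ => by rw [rip_rsmul_left, rip_comm Y]

theorem rip_stdBasis (k l : Fin n × Fin 4) :
    rip (stdBasis k) (stdBasis l) = if k = l then 1 else 0 := by
  obtain ⟨i, s⟩ := k
  obtain ⟨j, t⟩ := l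
  rw [rip, stdBasis, stdBasis, hip_single_left]
  by_cases h : i = j
  · subst h
    rw [Pi.single_eq_same]
    fin_cases s <;> fin_cases t <;> simp [Quaternion.re_mul]
  · simp [h]

/-- `∑ (Y, b) r (Z, b) = -2 (Y, Z) star r`. -/
theorem sum_hip_mul_hip_right (Y Z : Fin n → ℍ[ℝ]) (r : ℍ[ℝ]) :
    ∑ k, hip Y (stdBasis k) * r * hip Z (stdBasis k) = (-2 : ℝ) • (hip Y Z * star r) := by
  rw [Fintype.sum_prod_type]
  simp only [stdBasis, hip_single_right]
  rw [hip, Finset.sum_mul, Finset.smul_sum]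
  refine Finset.sum_congr rfl fun i _ => ?_
  ext <;> simp [Fin.sum_univ_four, Quaternion.re_mul, Quaternion.imI_mul, Quaternion.imJ_mul,
    Quaternion.imK_mul] <;> ring

/-- `∑ (b, Y) r (Z, b) = 4 Re (r (Z, Y))`. -/
theorem sum_hip_mul_hip_left (Y Z : Fin n → ℍ[ℝ]) (r : ℍ[ℝ]) :
    ∑ k, hip (stdBasis k) Y * r * hip Z (stdBasis k) = ((4 * (r * hip Z Y).re : ℝ) : ℍ[ℝ]) := by
  rw [Fintype.sum_prod_type]
  simp only [stdBasis, hip_single_right, hip_single_left]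
  rw [hip, Finset.mul_sum, re_sum, Finset.mul_sum]
  rw [coe_sum]
  refine Finset.sum_congr rfl fun i _ => ?_
  ext <;> simp [Fin.sum_univ_four, Quaternion.re_mul, Quaternion.imI_mul, Quaternion.imJ_mul,
    Quaternion.imK_mul] <;> ring

theorem sum_rip_stdBasis_self : ∑ k : Fin n × Fin 4, rip (stdBasis k) (stdBasis k) = 4 * n := by
  simp [rip_stdBasis, mul_comm]

/-- `(X, Y) Z = ∑ₜ ⟨eₜ* X, Y⟩ eₜ Z` over the basis `1, i, j, k`. -/
theorem hip_eq_sum (X Y : Fin n → ℍ[ℝ]) :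
    hip X Y = ∑ t, (rip X (qbasis t • Y) : ℍ[ℝ]) * qbasis t := by
  rw [Fin.sum_univ_succ]
  simp only [qbasis_succ, rip_unit_right, qbasis_zero, one_smul, mul_one]
  exact eq_re_add_im (hip X Y)

/-- Traces of bilinear forms are independent of the orthonormal basis. -/
theorem sum_orthogonal {ι : Type*} [Fintype ι] [DecidableEq ι] (hι : Fintype.card ι = 4 * n)
    {κ : ℝ} (hκ : 0 < κ) (ε : ι → Fin n → ℍ[ℝ]) (hε : ∀ a b, rip (ε a) (ε b) = if a = b then κ else 0)
    (β : (Fin n → ℍ[ℝ]) →ₗ[ℝ] (Fin n → ℍ[ℝ]) →ₗ[ℝ] ℝ) :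
    ∑ a, β (ε a) (ε a) = κ * ∑ k, β (stdBasis k) (stdBasis k) := by
  have hcard : Fintype.card ι = Fintype.card (Fin n × Fin 4) := by simp [hι, mul_comm]
  let eq : ι ≃ Fin n × Fin 4 := Fintype.equivOfCardEq hcard
  let P : Matrix ι ι ℝ := Matrix.of fun a b => rip (ε a) (stdBasis (eq b))
  have hsum : ∀ f : Fin n × Fin 4 → ℝ, ∑ b, f (eq b) = ∑ k, f k := fun f => Equiv.sum_comp eq f
  have h1 : (κ⁻¹ • P) * P.transpose = 1 := by
    ext a b
    simp only [Matrix.mul_apply, Matrix.smul_apply, Matrix.transpose_apply, smul_eq_mul, P, Matrix.of_apply,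
      mul_assoc, ← Finset.mul_sum]
    rw [hsum (fun k => rip (ε a) (stdBasis k) * rip (ε b) (stdBasis k)), sum_rip_mul_rip, hε,
      Matrix.one_apply]
    split_ifs <;> simp [hκ.ne']
  -- For a square matrix a one-sided inverse is two-sided, so orthogonality of the rows becomes
  -- orthogonality of the columns.
  have h2 := mul_eq_one_comm.1 h1
  have h3 : ∀ k l, ∑ a, rip (ε a) (stdBasis k) * rip (ε a) (stdBasis l) =
      if k = l then κ else 0 := by
    intro k l
    have := congrFun (congrFun h2 (eq.symm k)) (eq.symm l)
    simp only [Matrix.mul_apply, Matrix.smul_apply, Matrix.transpose_apply, smul_eq_mul, P, Matrix.of_apply,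
      Equiv.apply_symm_apply, Matrix.one_apply, EmbeddingLike.apply_eq_iff_eq] at this
    have h4 : ∑ a, rip (ε a) (stdBasis k) * rip (ε a) (stdBasis l) =
        κ * ∑ a, rip (ε a) (stdBasis k) * (κ⁻¹ * rip (ε a) (stdBasis l)) := by
      rw [Finset.mul_sum]
      refine Finset.sum_congr rfl fun a _ => ?_
      field_simp
    rw [h4, this]
    split_ifs <;> simp
  have h5 : ∀ X, β X X = ∑ k, ∑ l, rip X (stdBasis k) * rip X (stdBasis l) *
      β (stdBasis k) (stdBasis l) := by
    intro X
    conv_lhs => rw [← sum_stdBasis X]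
    simp only [map_sum, LinearMap.sum_apply, map_smul, LinearMap.smul_apply, smul_eq_mul]
    simp only [Finset.mul_sum]
    rw [Finset.sum_comm]
    exact Finset.sum_congr rfl fun k _ => Finset.sum_congr rfl fun l _ => by ring
  simp only [h5 (ε _)]
  rw [Finset.sum_comm, Finset.mul_sum]
  refine Finset.sum_congr rfl fun k _ => ?_
  rw [Finset.sum_comm]
  simp only [← Finset.sum_mul, h3]
  simp

end basis

/-! ### Directional derivatives -/

section HasDir

variable {E F G : Type*} [NormedAddCommGroup E] [NormedSpace ℝ E] [NormedAddCommGroup F]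
  [NormedSpace ℝ F] [NormedAddCommGroup G] [NormedSpace ℝ G]

/-- `f` is differentiable at `p`, and its derivative in the direction `v` is `f'`. -/
structure HasDir (f : E → F) (f' : F) (p v : E) : Prop where
  diff : DifferentiableAt ℝ f p
  eq : fderiv ℝ f p v = f'

variable {p v : E}

theorem HasDir.of_hasFDerivAt {f : E → F} {L : E →L[ℝ] F} (h : HasFDerivAt f L p) (v : E) :
    HasDir f (L v) p v := ⟨h.differentiableAt, by rw [h.fderiv]⟩

theorem HasDir.of_differentiableAt {f : E → F} (h : DifferentiableAt ℝ f p) (v : E) :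
    HasDir f (fderiv ℝ f p v) p v := ⟨h, rfl⟩

theorem HasDir.congr_deriv {f : E → F} {a b : F} (h : HasDir f a p v) (hab : a = b) :
    HasDir f b p v := hab ▸ h

theorem HasDir.congr {f g : E → F} {a : F} {Ω : Set E} (h : HasDir f a p v) (hΩ : IsOpen Ω)
    (hp : p ∈ Ω) (hfg : ∀ x ∈ Ω, g x = f x) : HasDir g a p v := by
  have he : g =ᶠ[nhds p] f := by
    filter_upwards [hΩ.mem_nhds hp] with x hx using hfg x hx
  exact ⟨h.diff.congr_of_eventuallyEq he, by rw [he.fderiv_eq, h.eq]⟩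

theorem HasDir.unique {f g : E → F} {a b : F} {Ω : Set E} (h : HasDir f a p v)
    (h' : HasDir g b p v) (hΩ : IsOpen Ω) (hp : p ∈ Ω) (hfg : ∀ x ∈ Ω, g x = f x) : a = b :=
  (h.congr hΩ hp hfg).eq.symm.trans h'.eq

theorem hasDir_const (c : F) (p v : E) : HasDir (fun _ => c) 0 p v :=
  HasDir.of_hasFDerivAt (hasFDerivAt_const c p) v

theorem HasDir.add {f g : E → F} {a b : F} (hf : HasDir f a p v) (hg : HasDir g b p v) :
    HasDir (fun x => f x + g x) (a + b) p v := by
  obtain ⟨hf, rfl⟩ := hf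
  obtain ⟨hg, rfl⟩ := hg
  exact HasDir.of_hasFDerivAt (hf.hasFDerivAt.add hg.hasFDerivAt) v

theorem HasDir.sub {f g : E → F} {a b : F} (hf : HasDir f a p v) (hg : HasDir g b p v) :
    HasDir (fun x => f x - g x) (a - b) p v := by
  obtain ⟨hf, rfl⟩ := hf
  obtain ⟨hg, rfl⟩ := hg
  exact HasDir.of_hasFDerivAt (hf.hasFDerivAt.sub hg.hasFDerivAt) v

theorem HasDir.sum {ι : Type*} (s : Finset ι) {f : ι → E → F} {a : ι → F}
    (h : ∀ i, HasDir (f i) (a i) p v) :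
    HasDir (fun x => ∑ i ∈ s, f i x) (∑ i ∈ s, a i) p v := by
  classical
  induction s using Finset.induction_on with
  | empty => simpa using hasDir_const (0 : F) p v
  | insert i s hi ih => simpa [Finset.sum_insert hi] using (h i).add ih

theorem HasDir.clm (L : F →L[ℝ] G) {f : E → F} {a : F} (hf : HasDir f a p v) :
    HasDir (fun x => L (f x)) (L a) p v := by
  obtain ⟨hf, rfl⟩ := hf
  exact HasDir.of_hasFDerivAt (L.hasFDerivAt.comp p hf.hasFDerivAt) v

theorem HasDir.linear [FiniteDimensional ℝ F] (L : F →ₗ[ℝ] G) {f : E → F} {a : F}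
    (hf : HasDir f a p v) : HasDir (fun x => L (f x)) (L a) p v :=
  hf.clm L.toContinuousLinearMap

theorem HasDir.clm_apply {f : E → F →L[ℝ] G} {g : E → F} {a : F →L[ℝ] G} {b : F}
    (hf : HasDir f a p v) (hg : HasDir g b p v) :
    HasDir (fun x => f x (g x)) (a (g p) + f p b) p v := by
  obtain ⟨hf, rfl⟩ := hf
  obtain ⟨hg, rfl⟩ := hg
  exact (HasDir.of_hasFDerivAt (hf.hasFDerivAt.clm_apply hg.hasFDerivAt) v).congr_deriv (by simp [add_comm])

theorem HasDir.smul {f : E → ℝ} {g : E → F} {a : ℝ} {b : F}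
    (hf : HasDir f a p v) (hg : HasDir g b p v) :
    HasDir (fun x => f x • g x) (a • g p + f p • b) p v := by
  obtain ⟨hf, rfl⟩ := hf
  obtain ⟨hg, rfl⟩ := hg
  exact (HasDir.of_hasFDerivAt (hf.hasFDerivAt.smul hg.hasFDerivAt) v).congr_deriv (by simp [add_comm])

theorem HasDir.const_smul {g : E → F} {b : F} (r : ℝ) (hg : HasDir g b p v) :
    HasDir (fun x => r • g x) (r • b) p v := by
  simpa using (hasDir_const r p v).smul hg

theorem HasDir.mul {A : Type*} [NormedRing A] [NormedAlgebra ℝ A] {f g : E → A} {a b : A}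
    (hf : HasDir f a p v) (hg : HasDir g b p v) :
    HasDir (fun x => f x * g x) (a * g p + f p * b) p v := by
  obtain ⟨hf, rfl⟩ := hf
  obtain ⟨hg, rfl⟩ := hg
  exact (HasDir.of_hasFDerivAt (hf.hasFDerivAt.mul' hg.hasFDerivAt) v).congr_deriv (by simp [add_comm])

theorem HasDir.inv {f : E → ℝ} {a : ℝ} (hf : HasDir f a p v) (h0 : f p ≠ 0) :
    HasDir (fun x => (f x)⁻¹) (-a / f p ^ 2) p v := by
  obtain ⟨hf, rfl⟩ := hf
  refine (HasDir.of_hasFDerivAt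
    ((hasDerivAt_inv h0).comp_hasFDerivAt p hf.hasFDerivAt) v).congr_deriv ?_
  simp; ring

theorem HasDir.pi {ι : Type*} [Fintype ι] {f : E → ι → F} {a : ι → F}
    (h : ∀ i, HasDir (fun x => f x i) (a i) p v) : HasDir f a p v := by
  have := HasDir.of_hasFDerivAt (hasFDerivAt_pi.2 fun i => (h i).diff.hasFDerivAt) v
  refine this.congr_deriv ?_
  ext1 i
  exact (h i).eq

theorem HasDir.apply {ι : Type*} [Fintype ι] {f : E → ι → F} {a : ι → F}
    (h : HasDir f a p v) (i : ι) : HasDir (fun x => f x i) (a i) p v :=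
  h.clm (ContinuousLinearMap.proj (R := ℝ) (φ := fun _ : ι => F) i)

end HasDir

/-! ### Derivatives of quaternionic expressions -/

section quaternionic

variable {E : Type*} [NormedAddCommGroup E] [NormedSpace ℝ E] {p v : E}

/-- Quaternionic conjugation as a real linear map. -/
def starLin : ℍ[ℝ] →ₗ[ℝ] ℍ[ℝ] where
  toFun := star
  map_add' := star_add
  map_smul' r a := by ext <;> simp

/-- The real part as a real linear map. -/
def reLin : ℍ[ℝ] →ₗ[ℝ] ℝ where
  toFun a := a.re
  map_add' _ _ := rfl
  map_smul' _ _ := rfl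

theorem HasDir.star {f : E → ℍ[ℝ]} {a : ℍ[ℝ]} (hf : HasDir f a p v) :
    HasDir (fun x => star (f x)) (star a) p v := hf.linear starLin

theorem HasDir.re {f : E → ℍ[ℝ]} {a : ℍ[ℝ]} (hf : HasDir f a p v) :
    HasDir (fun x => (f x).re) a.re p v := hf.linear reLin

theorem HasDir.coe {f : E → ℝ} {a : ℝ} (hf : HasDir f a p v) :
    HasDir (fun x => (f x : ℍ[ℝ])) (a : ℍ[ℝ]) p v :=
  hf.linear (Algebra.linearMap ℝ ℍ[ℝ])

theorem HasDir.hip {f g : E → Fin n → ℍ[ℝ]} {a b : Fin n → ℍ[ℝ]} (hf : HasDir f a p v)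
    (hg : HasDir g b p v) :
    HasDir (fun x => hip (f x) (g x)) (hip a (g p) + hip (f p) b) p v := by
  refine (HasDir.sum Finset.univ fun i => (hf.apply i).mul (hg.apply i).star).congr_deriv ?_
  simp [QC.hip, Finset.sum_add_distrib]

theorem HasDir.rip {f g : E → Fin n → ℍ[ℝ]} {a b : Fin n → ℍ[ℝ]} (hf : HasDir f a p v)
    (hg : HasDir g b p v) :
    HasDir (fun x => rip (f x) (g x)) (rip a (g p) + rip (f p) b) p v :=
  (hf.hip hg).re

theorem HasDir.qsmul {f : E → ℍ[ℝ]} {g : E → Fin n → ℍ[ℝ]} {a : ℍ[ℝ]} {b : Fin n → ℍ[ℝ]}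
    (hf : HasDir f a p v) (hg : HasDir g b p v) :
    HasDir (fun x => f x • g x) (a • g p + f p • b) p v :=
  HasDir.pi fun i => hf.mul (hg.apply i)

end quaternionic

/-! ### Left-invariant vector fields on the quaternionic Heisenberg group -/

/-- The element of the real space `ℍⁿ ≅ ℝ⁴ⁿ` with the quaternionic coordinates `A`. -/
def lift (A : Fin n → ℍ[ℝ]) : Fin n → Fin 4 → ℝ :=
  fun i => ![(A i).re, (A i).imI, (A i).imJ, (A i).imK]

/-- The left-invariant horizontal vector field of direction `A`. -/
def hor (p : QHeis n) (A : Fin n → ℍ[ℝ]) : QHeis n :=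
  (lift A, fun s => -2 * im s (hip A (qcoord p)))

/-- The derivative of the vector field `hor · A` in the direction `v`. -/
def horDeriv (A : Fin n → ℍ[ℝ]) (v : QHeis n) : QHeis n :=
  (0, fun s => -2 * im s (hip A (qcoord v)))

/-- The left-invariant vertical vector fields, dual to the standard contact form. -/
def vert (s : Fin 3) : QHeis n := (0, Pi.single s 2)

@[simp] theorem qcoord_hor (p : QHeis n) (A : Fin n → ℍ[ℝ]) : qcoord (hor p A) = A := by
  ext i <;> simp [qcoord, hor, lift]

@[simp] theorem qcoord_horDeriv (A : Fin n → ℍ[ℝ]) (v : QHeis n) :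
    qcoord (horDeriv A v) = 0 := by
  ext i <;> simp [qcoord, horDeriv]

@[simp] theorem qcoord_vert (s : Fin 3) : qcoord (vert s : QHeis n) = 0 := by
  ext i <;> simp [qcoord, vert]

/-- The quaternionic coordinates as a real linear map. -/
def qcoordLin : QHeis n →ₗ[ℝ] (Fin n → ℍ[ℝ]) where
  toFun := qcoord
  map_add' p v := by ext1 i; exact qcoord_add p v i
  map_smul' c p := by ext1 i; exact qcoord_smul c p i

theorem qcoord_map_add (p v : QHeis n) : qcoord (p + v) = qcoord p + qcoord v :=
  qcoordLin.map_add p v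

theorem qcoord_map_sub (p v : QHeis n) : qcoord (p - v) = qcoord p - qcoord v :=
  qcoordLin.map_sub p v

theorem qcoord_map_smul (c : ℝ) (p : QHeis n) : qcoord (c • p) = c • qcoord p :=
  qcoordLin.map_smul c p

theorem qcoord_map_sum {ι : Type*} (s : Finset ι) (f : ι → QHeis n) :
    qcoord (∑ i ∈ s, f i) = ∑ i ∈ s, qcoord (f i) :=
  map_sum qcoordLin f s

theorem im_sub (s : Fin 3) (a b : ℍ[ℝ]) : im s (a - b) = im s a - im s b := by
  fin_cases s <;> simp

theorem im_star (s : Fin 3) (a : ℍ[ℝ]) : im s (star a) = -im s a := by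
  fin_cases s <;> simp

theorem im_hip_comm (s : Fin 3) (X Y : Fin n → ℍ[ℝ]) : im s (hip X Y) = -im s (hip Y X) := by
  rw [← star_hip, im_star]

/-- The derivative of `hor · A` as a linear map. -/
def horDerivLin (A : Fin n → ℍ[ℝ]) : QHeis n →ₗ[ℝ] QHeis n where
  toFun := horDeriv A
  map_add' v w := by
    ext
    · simp [horDeriv]
    · simp [horDeriv, qcoord_map_add, hip_add_right, im_add]; ring
  map_smul' c v := by
    ext
    · simp [horDeriv]
    · simp [horDeriv, qcoord_map_smul, hip_rsmul_right, im_smul]; ring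

theorem hor_eq (p : QHeis n) (A : Fin n → ℍ[ℝ]) :
    hor p A = (lift A, 0) + horDeriv A p := by
  simp [hor, horDeriv]

/-- `A ↦ hor p A` as a linear map. -/
def horLin (p : QHeis n) : (Fin n → ℍ[ℝ]) →ₗ[ℝ] QHeis n where
  toFun := hor p
  map_add' A B := by
    ext i t
    · fin_cases t <;> simp [hor, lift]
    · simp [hor, hip_add_left, im_add]; ring
  map_smul' c A := by
    ext i t
    · fin_cases t <;> simp [hor, lift]
    · simp [hor, hip_rsmul_left, im_smul]; ring

theorem hor_add (p : QHeis n) (A B : Fin n → ℍ[ℝ]) : hor p (A + B) = hor p A + hor p B :=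
  (horLin p).map_add A B

theorem hor_sub (p : QHeis n) (A B : Fin n → ℍ[ℝ]) : hor p (A - B) = hor p A - hor p B :=
  (horLin p).map_sub A B

theorem hor_smul (p : QHeis n) (c : ℝ) (A : Fin n → ℍ[ℝ]) : hor p (c • A) = c • hor p A :=
  (horLin p).map_smul c A

theorem hor_sum {ι : Type*} (s : Finset ι) (p : QHeis n) (f : ι → Fin n → ℍ[ℝ]) :
    hor p (∑ i ∈ s, f i) = ∑ i ∈ s, hor p (f i) :=
  map_sum (horLin p) f s

theorem hor_injective (p : QHeis n) : Function.Injective (hor p) := fun A B h => by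
  rw [← qcoord_hor p A, h, qcoord_hor]

theorem horDeriv_eq_sum (A : Fin n → ℍ[ℝ]) (v : QHeis n) :
    horDeriv A v = -∑ s, im s (hip A (qcoord v)) • vert s := by
  ext s
  · simp [horDeriv, vert, Prod.fst_sum]
  · fin_cases s <;> simp [horDeriv, vert, Fin.sum_univ_three] <;> ring

theorem stdForm_apply (s : Fin 3) (p v : QHeis n) :
    stdForm n s p v = 1 / 2 * v.2 s + im s (hip (qcoord v) (qcoord p)) := rfl

@[simp] theorem stdForm_hor (s : Fin 3) (p : QHeis n) (A : Fin n → ℍ[ℝ]) :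
    stdForm n s p (hor p A) = 0 := by
  rw [stdForm_apply, qcoord_hor]; simp [hor]

theorem stdForm_vert (s t : Fin 3) (p : QHeis n) :
    stdForm n s p (vert t) = if s = t then 1 else 0 := by
  rw [stdForm_apply, qcoord_vert]
  simp only [hip_zero_left, vert, Pi.single_apply]
  have : im s 0 = 0 := by fin_cases s <;> rfl
  rw [this]
  split_ifs <;> simp

theorem eq_hor_add_vert (p v : QHeis n) :
    v = hor p (qcoord v) + ∑ s, stdForm n s p v • vert s := by
  ext i t
  · have : (∑ s, stdForm n s p v • (vert s : QHeis n)).1 = 0 := by simp [vert, Prod.fst_sum]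
    rw [Prod.fst_add, this]
    fin_cases t <;> simp [hor, lift, qcoord]
  · fin_cases i <;> simp [hor, vert, stdForm_apply, Fin.sum_univ_three] <;> ring

theorem hasDir_hor (A : Fin n → ℍ[ℝ]) (p v : QHeis n) :
    HasDir (fun x => hor x A) (horDeriv A v) p v := by
  have h := (horDerivLin A).toContinuousLinearMap.hasFDerivAt (x := p)
  have := (hasDir_const ((lift A, 0) : QHeis n) p v).add (HasDir.of_hasFDerivAt h v)
  refine HasDir.congr (this.congr_deriv (zero_add _)) isOpen_univ (Set.mem_univ p) fun x _ => ?_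
  exact hor_eq x A

theorem HasDir.hor {f : QHeis n → Fin n → ℍ[ℝ]} {a : Fin n → ℍ[ℝ]} {p v : QHeis n}
    (hf : HasDir f a p v) : HasDir (fun x => hor x (f x)) (hor p a + horDeriv (f p) v) p v := by
  have h1 : HasDir (fun x => QC.hor (0 : QHeis n) (f x)) (QC.hor (0 : QHeis n) a) p v :=
    hf.linear (horLin 0)
  have hq : HasDir (fun x : QHeis n => qcoord x) (qcoord v) p v :=
    HasDir.of_hasFDerivAt (qcoordLin.toContinuousLinearMap.hasFDerivAt (x := p)) v
  have h2 : HasDir (fun x => ((0, fun s => -2 * im s (QC.hip (f x) (qcoord x))) : QHeis n))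
      (0, fun s => -2 * im s (QC.hip a (qcoord p) + QC.hip (f p) (qcoord v))) p v := by
    let L : ℍ[ℝ] →ₗ[ℝ] QHeis n :=
      { toFun := fun a => (0, fun s => -2 * im s a)
        map_add' := fun a b => by ext <;> simp [im_add]; ring
        map_smul' := fun a b => by ext <;> simp [im_smul]; ring }
    exact (hf.hip hq).linear L
  refine ((h1.add h2).congr isOpen_univ (Set.mem_univ p) fun x _ => ?_).congr_deriv ?_
  · ext s
    · simp [QC.hor]
    · have : im s 0 = 0 := by fin_cases s <;> rfl
      have h0 : qcoord (0 : QHeis n) = 0 := qcoordLin.map_zero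
      simp [QC.hor, h0, this]
  · ext s
    · simp [QC.hor, horDeriv]
    · have : im s 0 = 0 := by fin_cases s <;> rfl
      have h0 : qcoord (0 : QHeis n) = 0 := qcoordLin.map_zero
      simp [QC.hor, horDeriv, h0, this, im_add]; ring

theorem hasDir_qcoord (p v : QHeis n) : HasDir (fun x : QHeis n => qcoord x) (qcoord v) p v :=
  HasDir.of_hasFDerivAt (qcoordLin.toContinuousLinearMap.hasFDerivAt (x := p)) v

theorem hasDir_snd (p v : QHeis n) (s : Fin 3) : HasDir (fun x : QHeis n => x.2 s) (v.2 s) p v :=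
  HasDir.of_hasFDerivAt (((ContinuousLinearMap.proj (R := ℝ) (φ := fun _ : Fin 3 => ℝ) s).comp
    (ContinuousLinearMap.snd ℝ (Fin n → Fin 4 → ℝ) (Fin 3 → ℝ))).hasFDerivAt (x := p)) v

/-! ### Brackets of horizontal derivatives -/

section commutator

variable {F : Type*} [NormedAddCommGroup F] [NormedSpace ℝ F] {f : QHeis n → F} {p : QHeis n}

theorem hasDir_fderiv_apply (hf : ContDiffAt ℝ ∞ f p) {Y : QHeis n → QHeis n} {y v : QHeis n}
    (hY : HasDir Y y p v) :
    HasDir (fun x => fderiv ℝ f x (Y x)) (fderiv ℝ (fderiv ℝ f) p v (Y p) + fderiv ℝ f p y) p v :=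
  HasDir.clm_apply (HasDir.of_differentiableAt
    ((hf.fderiv_right (m := ∞) (by simp)).differentiableAt (by simp)) v) hY

theorem fderiv_fderiv_symm (hf : ContDiffAt ℝ ∞ f p) (v w : QHeis n) :
    fderiv ℝ (fderiv ℝ f) p v w = fderiv ℝ (fderiv ℝ f) p w v :=
  (hf.isSymmSndFDerivAt (by
    rw [minSmoothness_of_isRCLikeNormedField]; exact WithTop.coe_le_coe.2 le_top)).eq v w

/-- `[X_A, X_B] = -2 ∑ₛ ⟨Iₛ A, B⟩ ξₛ` for left-invariant horizontal fields. -/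
theorem fderiv_hor_comm (hf : ContDiffAt ℝ ∞ f p) (A B : Fin n → ℍ[ℝ]) :
    fderiv ℝ (fun x => fderiv ℝ f x (hor x B)) p (hor p A) -
      fderiv ℝ (fun x => fderiv ℝ f x (hor x A)) p (hor p B) =
      (-2 : ℝ) • ∑ s, rip (unit s • A) B • fderiv ℝ f p (vert s) := by
  rw [(hasDir_fderiv_apply hf (hasDir_hor B p (hor p A))).eq,
    (hasDir_fderiv_apply hf (hasDir_hor A p (hor p B))).eq, fderiv_fderiv_symm hf]
  simp only [horDeriv_eq_sum, qcoord_hor, map_neg, map_sum, map_smul, rip_unit_left]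
  simp only [im_hip_comm _ B A, neg_smul, Finset.sum_neg_distrib]
  have : ∀ a b : F, a + - -b - (a + -b) = (2 : ℝ) • b := fun a b => by module
  rw [this]
  simp

/-- A function whose horizontal derivatives vanish has vanishing derivative. -/
theorem fderiv_eq_zero_of_hor [NeZero n] {Ω : Set (QHeis n)} (hΩ : IsOpen Ω)
    (hf : ContDiffOn ℝ ∞ f Ω) (h : ∀ p ∈ Ω, ∀ A, fderiv ℝ f p (hor p A) = 0) (hp : p ∈ Ω) :
    fderiv ℝ f p = 0 := by
  have hv : ∀ s, fderiv ℝ f p (vert s) = 0 := by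
    intro s
    -- With 1 and e_s in the same slot, ⟨e_t A, B⟩ vanishes except for t = s, so the bracket
    -- isolates `vert s`.
    let B : Fin n → ℍ[ℝ] := Pi.single 0 (unit s)
    let A : Fin n → ℍ[ℝ] := Pi.single 0 1
    -- The direction A + B - C serves both mixed derivatives: it is B for C = A and A for C = B.
    have h0 : ∀ C : Fin n → ℍ[ℝ],
        HasDir (fun x => fderiv ℝ f x (hor x C)) (0 : F) p (hor p (A + B - C)) := fun C =>
      (hasDir_const (0 : F) p _).congr hΩ hp fun x hx => h x hx C
    have key := fderiv_hor_comm (hf.contDiffAt (hΩ.mem_nhds hp)) A B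
    have hA := (h0 A).eq
    have hB := (h0 B).eq
    rw [add_sub_cancel_left] at hA
    rw [add_sub_cancel_right] at hB
    rw [hA, hB, sub_zero] at key
    have hr : ∀ t, rip (unit t • A) B = if t = s then 1 else 0 := by
      intro t
      rw [rip_unit_left, hip_single_right]
      fin_cases t <;> fin_cases s <;> simp [A]
    simp only [hr, ite_smul, one_smul, zero_smul, Finset.sum_ite_eq', Finset.mem_univ, if_true]
      at key
    simpa using key.symm
  refine ContinuousLinearMap.ext fun v => ?_
  rw [eq_hor_add_vert p v]
  simp [h p hp, hv]

theorem exists_eq_const_of_hor [NeZero n] {Ω : Set (QHeis n)} (hΩ : IsOpen Ω)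
    (hc : IsPreconnected Ω) (hf : ContDiffOn ℝ ∞ f Ω)
    (h : ∀ p ∈ Ω, ∀ A, fderiv ℝ f p (hor p A) = 0) : ∃ a, ∀ x ∈ Ω, f x = a :=
  hΩ.exists_is_const_of_fderiv_eq_zero hc (hf.differentiableOn (by simp))
    fun _ hp => fderiv_eq_zero_of_hor hΩ hf h hp

end commutator

/-! ### Smoothness of quaternionic expressions -/

section smooth

variable {E : Type*} [NormedAddCommGroup E] [NormedSpace ℝ E] {Ω : Set E}

theorem contDiffOn_linear {F G : Type*} [NormedAddCommGroup F] [NormedSpace ℝ F]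
    [NormedAddCommGroup G] [NormedSpace ℝ G] [FiniteDimensional ℝ F] (L : F →ₗ[ℝ] G)
    {f : E → F} (hf : ContDiffOn ℝ ∞ f Ω) : ContDiffOn ℝ ∞ (fun x => L (f x)) Ω :=
  L.toContinuousLinearMap.contDiff.comp_contDiffOn hf

theorem contDiffOn_star {f : E → ℍ[ℝ]} (hf : ContDiffOn ℝ ∞ f Ω) :
    ContDiffOn ℝ ∞ (fun x => star (f x)) Ω := contDiffOn_linear starLin hf

theorem contDiffOn_re {f : E → ℍ[ℝ]} (hf : ContDiffOn ℝ ∞ f Ω) :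
    ContDiffOn ℝ ∞ (fun x => (f x).re) Ω := contDiffOn_linear reLin hf

theorem contDiffOn_coe {f : E → ℝ} (hf : ContDiffOn ℝ ∞ f Ω) :
    ContDiffOn ℝ ∞ (fun x => (f x : ℍ[ℝ])) Ω := contDiffOn_linear (Algebra.linearMap ℝ ℍ[ℝ]) hf

theorem contDiffOn_hip {f g : E → Fin n → ℍ[ℝ]} (hf : ContDiffOn ℝ ∞ f Ω)
    (hg : ContDiffOn ℝ ∞ g Ω) : ContDiffOn ℝ ∞ (fun x => hip (f x) (g x)) Ω :=
  ContDiffOn.sum fun i _ => (contDiffOn_pi.1 hf i).mul (contDiffOn_star (contDiffOn_pi.1 hg i))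

theorem contDiffOn_rip {f g : E → Fin n → ℍ[ℝ]} (hf : ContDiffOn ℝ ∞ f Ω)
    (hg : ContDiffOn ℝ ∞ g Ω) : ContDiffOn ℝ ∞ (fun x => rip (f x) (g x)) Ω :=
  contDiffOn_re (contDiffOn_hip hf hg)

theorem contDiffOn_qsmul {f : E → ℍ[ℝ]} {g : E → Fin n → ℍ[ℝ]} (hf : ContDiffOn ℝ ∞ f Ω)
    (hg : ContDiffOn ℝ ∞ g Ω) : ContDiffOn ℝ ∞ (fun x => f x • g x) Ω :=
  contDiffOn_pi.2 fun i => hf.mul (contDiffOn_pi.1 hg i)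

theorem contDiffOn_qcoord {Ω : Set (QHeis n)} : ContDiffOn ℝ ∞ (fun x : QHeis n => qcoord x) Ω :=
  contDiffOn_linear qcoordLin contDiffOn_id

theorem contDiffOn_snd_apply {Ω : Set (QHeis n)} (s : Fin 3) :
    ContDiffOn ℝ ∞ (fun x : QHeis n => x.2 s) Ω :=
  (contDiff_apply ℝ ℝ s |>.comp contDiff_snd).contDiffOn

end smooth

theorem hor_snd (s : Fin 3) (p : QHeis n) (A : Fin n → ℍ[ℝ]) :
    (hor p A).2 s = -2 * im s (hip A (qcoord p)) := rfl

/-! ### Integration of the overdetermined system -/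

/-- The first order system satisfied by a conformal factor `h`, its horizontal gradient `u` and the
quaternion `M` that consists of the trace and the vertical derivatives of `h`. -/
structure ConfSystem (Ω : Set (QHeis n)) (h : QHeis n → ℝ) (u : QHeis n → Fin n → ℍ[ℝ])
    (M : QHeis n → ℍ[ℝ]) : Prop where
  isOpen : IsOpen Ω
  isPreconnected : IsPreconnected Ω
  smooth_h : ContDiffOn ℝ ∞ h Ω
  smooth_u : ContDiffOn ℝ ∞ u Ω
  smooth_M : ContDiffOn ℝ ∞ M Ω
  pos : ∀ p ∈ Ω, 0 < h p
  deriv_h : ∀ p ∈ Ω, ∀ A, HasDir h (rip (u p) A) p (hor p A)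
  deriv_u : ∀ p ∈ Ω, ∀ A,
    HasDir u (M p • A + (2 * h p)⁻¹ • (hip A (u p) • u p)) p (hor p A)
  deriv_M : ∀ p ∈ Ω, ∀ A, HasDir M ((2 * h p)⁻¹ • (hip A (u p) * M p)) p (hor p A)

theorem rip_eq_re (u A : Fin n → ℍ[ℝ]) : rip u A = (hip A u).re := rip_comm u A

theorem hip_swap (u A : Fin n → ℍ[ℝ]) : hip u A = star (hip A u) := (star_hip A u).symm

theorem normSq_eq_re (a : ℍ[ℝ]) : Quaternion.normSq a = (a * star a).re := by
  simp [Quaternion.self_mul_star]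

theorem hasDir_inv_two_mul {h : QHeis n → ℝ} {a : ℝ} {p v : QHeis n} (hp : h p ≠ 0)
    (hd : HasDir h a p v) :
    HasDir (fun x => (2 * h x)⁻¹) (-2 * (2 * h p)⁻¹ ^ 2 * a) p v := by
  refine ((((hasDir_const 2 p v).mul hd)).inv (by positivity)).congr_deriv ?_
  simp only [zero_mul, zero_add]
  field_simp

namespace ConfSystem

variable {Ω : Set (QHeis n)} {h : QHeis n → ℝ} {u : QHeis n → Fin n → ℍ[ℝ]}
  {M : QHeis n → ℍ[ℝ]}

theorem deriv_inv (C : ConfSystem Ω h u M) {p : QHeis n} (hp : p ∈ Ω) (A : Fin n → ℍ[ℝ]) :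
    HasDir (fun x => (2 * h x)⁻¹) (-2 * (2 * h p)⁻¹ ^ 2 * rip (u p) A) p (hor p A) :=
  hasDir_inv_two_mul (C.pos p hp).ne' (C.deriv_h p hp A)

theorem smooth_inv (C : ConfSystem Ω h u M) : ContDiffOn ℝ ∞ (fun x => (2 * h x)⁻¹) Ω :=
  (contDiffOn_const.mul C.smooth_h).inv fun x hx => by have := C.pos x hx; positivity

/-- Horizontal fields and their brackets span all directions, so a first integral need only be
tested along `hor`. -/
theorem const_of_hasDir [NeZero n] (C : ConfSystem Ω h u M) {F : Type*} [NormedAddCommGroup F]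
    [NormedSpace ℝ F] {f : QHeis n → F} (hf : ContDiffOn ℝ ∞ f Ω)
    (hd : ∀ p ∈ Ω, ∀ A, HasDir f 0 p (hor p A)) : ∃ a, ∀ x ∈ Ω, f x = a :=
  exists_eq_const_of_hor C.isOpen C.isPreconnected hf fun p hp A => (hd p hp A).eq

/-- `|M|² / (2 h)` is constant. -/
theorem normSq_const [NeZero n] (C : ConfSystem Ω h u M) :
    ∃ c, ∀ p ∈ Ω, (2 * h p)⁻¹ * (M p * star (M p)).re = c := by
  refine C.const_of_hasDir (C.smooth_inv.mul
    (contDiffOn_re (C.smooth_M.mul (contDiffOn_star C.smooth_M)))) fun p hp A => ?_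
  -- Left multiplication of M by (A, u)/2h changes |M|² at the rate 2 Re (A, u)/2h, which the
  -- derivative of 1/2h cancels.
  refine ((C.deriv_inv hp A).mul
    ((C.deriv_M p hp A).mul (C.deriv_M p hp A).star).re).congr_deriv ?_
  rw [rip_eq_re]
  generalize hip A (u p) = x
  generalize (2 * h p)⁻¹ = k
  simp [Quaternion.re_mul, Quaternion.imI_mul, Quaternion.imJ_mul, Quaternion.imK_mul]
  ring

/-- This is the combination of u and M whose derivative no longer involves u except through the
first integral |M|²/2h; once that is a constant c, the field differs from c q by a constant. -/
theorem deriv_z (C : ConfSystem Ω h u M) {p : QHeis n} (hp : p ∈ Ω) (A : Fin n → ℍ[ℝ]) :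
    HasDir (fun x => (2 * h x)⁻¹ • (star (M x) • u x))
      (((2 * h p)⁻¹ * (M p * star (M p)).re) • A) p (hor p A) := by
  refine ((C.deriv_inv hp A).smul ((C.deriv_M p hp A).star.qsmul
    (C.deriv_u p hp A))).congr_deriv ?_
  rw [rip_eq_re]
  ext1 i
  generalize hip A (u p) = x
  generalize (2 * h p)⁻¹ = k
  simp only [Pi.add_apply, Pi.smul_apply, smul_eq_mul]
  generalize u p i = y
  generalize A i = a
  generalize M p = m
  ext <;> simp [Quaternion.re_mul, Quaternion.imI_mul, Quaternion.imJ_mul, Quaternion.imK_mul] <;>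
    ring

theorem smooth_z (C : ConfSystem Ω h u M) :
    ContDiffOn ℝ ∞ (fun x => (2 * h x)⁻¹ • (star (M x) • u x)) Ω :=
  C.smooth_inv.smul (contDiffOn_qsmul (contDiffOn_star C.smooth_M) C.smooth_u)

/-- The derivative of `|q + q₀|² - (ω + 2 Im (q₀ q*))`. -/
theorem hasDir_model (q₀ : Fin n → ℍ[ℝ]) (p : QHeis n) (A : Fin n → ℍ[ℝ]) :
    HasDir (fun x : QHeis n => ((rip (qcoord x + q₀) (qcoord x + q₀) : ℝ) : ℍ[ℝ]) -
      ∑ s, ((x.2 s + 2 * im s (hip q₀ (qcoord x)) : ℝ) : ℍ[ℝ]) * unit s)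
      ((2 : ℝ) • hip A (qcoord p + q₀)) p (hor p A) := by
  have hq : HasDir (fun x : QHeis n => qcoord x + q₀) (A + 0) p (hor p A) :=
    ((hasDir_qcoord p (hor p A)).congr_deriv (qcoord_hor p A)).add (hasDir_const q₀ p _)
  have hi : ∀ s, HasDir (fun x : QHeis n => im s (hip q₀ (qcoord x))) (im s (hip q₀ A)) p
      (hor p A) := fun s => by
    let L : ℍ[ℝ] →ₗ[ℝ] ℝ := ⟨⟨im s, im_add s⟩, fun c a => im_smul s c a⟩
    refine (((hasDir_const q₀ p _).hip (hasDir_qcoord p (hor p A))).linear L).congr_deriv ?_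
    rw [qcoord_hor, hip_zero_left, zero_add]
    rfl
  refine ((hq.rip hq).coe.sub (HasDir.sum Finset.univ fun s =>
    (((hasDir_snd p (hor p A) s).add
      ((hasDir_const (2 : ℝ) p _).mul (hi s))).coe.mul (hasDir_const (unit s) p _)))).congr_deriv ?_
  simp only [hor_snd, im_hip_comm _ q₀ A, add_zero, zero_mul, mul_zero, zero_add,
    rip_comm _ A, hip_add_right]
  conv_rhs => rw [eq_re_add_im (hip A (qcoord p)), eq_re_add_im (hip A q₀)]
  simp only [rip, hip_add_right]
  ext <;> simp [Fin.sum_univ_three, Quaternion.re_mul, Quaternion.imI_mul, Quaternion.imJ_mul,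
    Quaternion.imK_mul] <;> ring

/-- Integrating `deriv_z` gives M* u / 2h = c (q + q₀). Then D_A M = c (A, q + q₀), whose primitive
is c/2 times the function of `hasDir_model`, and h is recovered from |M|² = 2 c h. -/
theorem solve_of_ne_zero [NeZero n] (C : ConfSystem Ω h u M) {c : ℝ} (hc : c ≠ 0)
    (hcM : ∀ p ∈ Ω, (2 * h p)⁻¹ * (M p * star (M p)).re = c) (hne : Ω.Nonempty) :
    ∃ (c₀ σ : ℝ) (q₀ : Fin n → ℍ[ℝ]) (ω₀ : Fin 3 → ℝ), 0 < c₀ ∧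
      (∀ p ∈ Ω, h p = c₀ * ((σ + ∑ i, ‖qcoord p i + q₀ i‖ ^ 2) ^ 2 +
        ∑ s, (p.2 s + ω₀ s + 2 * im s (∑ i, q₀ i * star (qcoord p i))) ^ 2)) ∧
      ∀ p ∈ Ω, 4 * (M p).re - rip (u p) (u p) / h p = 16 * c₀ * σ := by
  have hcpos : 0 < c := by
    obtain ⟨p, hp⟩ := hne
    refine lt_of_le_of_ne ?_ hc.symm
    rw [← hcM p hp, ← normSq_eq_re]
    have := C.pos p hp
    have := Quaternion.normSq_nonneg (a := M p)
    positivity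
  obtain ⟨z₀, hz₀⟩ := C.const_of_hasDir
    (f := fun x => (2 * h x)⁻¹ • (star (M x) • u x) - c • qcoord x)
    (C.smooth_z.sub (contDiffOn_qcoord.const_smul c)) fun p hp A => by
      refine ((C.deriv_z hp A).sub ((hasDir_qcoord p (hor p A)).const_smul c)).congr_deriv ?_
      rw [hcM p hp, qcoord_hor, sub_self]
  set q₀ : Fin n → ℍ[ℝ] := c⁻¹ • z₀ with hq₀
  have hz : ∀ p ∈ Ω, (2 * h p)⁻¹ • (star (M p) • u p) = c • (qcoord p + q₀) := fun p hp => by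
    rw [hq₀, smul_add, smul_inv_smul₀ hc, ← hz₀ p hp]
    abel
  let model : QHeis n → ℍ[ℝ] := fun x => ((rip (qcoord x + q₀) (qcoord x + q₀) : ℝ) : ℍ[ℝ]) -
      ∑ s, ((x.2 s + 2 * im s (hip q₀ (qcoord x)) : ℝ) : ℍ[ℝ]) * unit s
  have hmodel : ContDiffOn ℝ ∞ model Ω := by
    have hq : ContDiffOn ℝ ∞ (fun x : QHeis n => qcoord x + q₀) Ω :=
      contDiffOn_qcoord.add contDiffOn_const
    refine (contDiffOn_coe (contDiffOn_rip hq hq)).sub (ContDiffOn.sum fun s _ =>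
      (contDiffOn_coe ((contDiffOn_snd_apply s).add (contDiffOn_const.mul ?_))).mul
        contDiffOn_const)
    let L : ℍ[ℝ] →ₗ[ℝ] ℝ := ⟨⟨im s, im_add s⟩, fun c a => im_smul s c a⟩
    exact contDiffOn_linear L (contDiffOn_hip contDiffOn_const contDiffOn_qcoord)
  obtain ⟨m₀, hm₀⟩ := C.const_of_hasDir (f := fun x => M x - (c / 2) • model x)
    (C.smooth_M.sub (hmodel.const_smul _)) fun p hp A => by
      refine ((C.deriv_M p hp A).sub ((hasDir_model q₀ p A).const_smul (c / 2))).congr_deriv ?_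
      -- Since (A, u) M = (A, M* u), the identity `hz` makes the right-hand side of the equation for
      -- M explicit.
      have h1 := congrArg (hip A) (hz p hp)
      rw [hip_rsmul_right, hip_smul_right, star_star, hip_rsmul_right] at h1
      rw [h1, smul_smul, div_mul_cancel₀ _ two_ne_zero, sub_self]
  have hM : ∀ p ∈ Ω, M p = (c / 2) • model p + m₀ := fun p hp => by
    rw [← hm₀ p hp]; abel
  have hh : ∀ p ∈ Ω, h p = (2 * c)⁻¹ * (M p * star (M p)).re := fun p hp => by
    have := C.pos p hp
    rw [← hcM p hp]
    have h2 : (M p * star (M p)).re ≠ 0 := fun h0 => hc (by rw [← hcM p hp, h0, mul_zero])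
    field_simp
  -- Factoring c/2 out of M leaves c²/4 · 1/(2c) = c/8 in front and turns m₀ into 2 m₀/c. Its
  -- imaginary part changes sign because ω enters `model` with a minus sign.
  refine ⟨c / 8, 2 / c * m₀.re, q₀, fun s => -(2 / c * im s m₀), by positivity,
    fun p hp => ?_, fun p hp => ?_⟩
  · rw [hh p hp, hM p hp]
    have e1 : ∑ i, ‖qcoord p i + q₀ i‖ ^ 2 = rip (qcoord p + q₀) (qcoord p + q₀) :=
      (rip_self_eq_sum _).symm
    have e2 : (∑ i, q₀ i * star (qcoord p i)) = hip q₀ (qcoord p) := rfl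
    rw [e1, e2]
    simp only [model]
    generalize rip (qcoord p + q₀) (qcoord p + q₀) = r
    generalize hip q₀ (qcoord p) = y
    rw [← normSq_eq_re, Quaternion.normSq_def']
    simp [Fin.sum_univ_three, Quaternion.re_mul, Quaternion.imI_mul, Quaternion.imJ_mul,
      Quaternion.imK_mul]
    field_simp
    ring
  -- Taking norms in `hz` gives |u|²/2h = c |q + q₀|², which cancels the nonconstant part of 4 Re M.
  · have h1 : rip ((2 * h p)⁻¹ • (star (M p) • u p)) ((2 * h p)⁻¹ • (star (M p) • u p)) =
        rip (c • (qcoord p + q₀)) (c • (qcoord p + q₀)) := by rw [hz p hp]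
    rw [rip_rsmul_left, rip_rsmul_right, rip_rsmul_left, rip_rsmul_right, rip_smul_left,
      hip_smul_right, hip_self, star_star] at h1
    have h2 : (star (M p) * ((rip (u p) (u p) : ℝ) * M p)).re =
        (M p * star (M p)).re * rip (u p) (u p) := by
      simp [Quaternion.re_mul, Quaternion.imI_mul, Quaternion.imJ_mul, Quaternion.imK_mul]; ring
    rw [h2] at h1
    have h3 : (M p).re = c / 2 * rip (qcoord p + q₀) (qcoord p + q₀) + m₀.re := by
      rw [hM p hp]
      simp [model, Fin.sum_univ_three, Quaternion.re_mul]
    have h4 := hcM p hp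
    have hpos := C.pos p hp
    have h5 : (2 * h p)⁻¹ * rip (u p) (u p) = c * rip (qcoord p + q₀) (qcoord p + q₀) := by
      refine mul_left_cancel₀ hc ?_
      linear_combination h1 - (2 * h p)⁻¹ * rip (u p) (u p) * h4
    have h6 : rip (u p) (u p) / h p = 2 * ((2 * h p)⁻¹ * rip (u p) (u p)) := by field_simp
    rw [h3, h6, h5]
    field_simp
    ring

end ConfSystem

/-! ### The degenerate case M = 0 -/

namespace ConfSystem

variable {Ω : Set (QHeis n)} {h : QHeis n → ℝ} {u : QHeis n → Fin n → ℍ[ℝ]}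
  {M : QHeis n → ℍ[ℝ]}

/-- When M = 0, moving along A multiplies every u_i on the left by the same quaternion (A, u)/2h. In
u_i* u_j only its real part survives, and the factor 1/2h compensates for that. -/
theorem gram_const [NeZero n] (C : ConfSystem Ω h u M) (hM : ∀ p ∈ Ω, M p = 0) (i j : Fin n) :
    ∃ c, ∀ p ∈ Ω, (2 * h p)⁻¹ • (star (u p i) * u p j) = c := by
  refine C.const_of_hasDir (C.smooth_inv.smul ((contDiffOn_star (contDiffOn_pi.1 C.smooth_u i)).mul
    (contDiffOn_pi.1 C.smooth_u j))) fun p hp A => ?_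
  have hu := (C.deriv_u p hp A)
  rw [hM p hp, zero_smul, zero_add] at hu
  refine ((C.deriv_inv hp A).smul ((hu.apply i).star.mul (hu.apply j))).congr_deriv ?_
  rw [rip_eq_re]
  generalize hip A (u p) = x
  generalize (2 * h p)⁻¹ = k
  simp only [Pi.smul_apply, smul_eq_mul]
  generalize u p i = y
  generalize u p j = w
  ext <;> simp [Quaternion.re_mul, Quaternion.imI_mul, Quaternion.imJ_mul, Quaternion.imK_mul] <;>
    ring

/-- The constant products u_i* u_j / 2h fix u up to a left quaternionic factor. For c proportional
to u(p₀) they give (c, u)(u, X) = 4h |c|² (c, X), so (c, u) is affine in q; taking X = c recovers h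
from |(c, u)|². -/
theorem solve_of_eq_zero [NeZero n] (C : ConfSystem Ω h u M) (hM : ∀ p ∈ Ω, M p = 0)
    (hne : Ω.Nonempty) :
    ∃ (a : ℍ[ℝ]) (c : Fin n → ℍ[ℝ]),
      (∀ p ∈ Ω, h p = ‖a + ∑ i, c i * star (qcoord p i)‖ ^ 2) ∧
      ∀ p ∈ Ω, 4 * (M p).re - rip (u p) (u p) / h p = -(4 * ∑ i, ‖c i‖ ^ 2) := by
  obtain ⟨p₀, hp₀⟩ := hne
  have h0 := C.pos p₀ hp₀
  have hgram : ∀ p ∈ Ω, ∀ i j, (2 * h p)⁻¹ • (star (u p i) * u p j) =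
      (2 * h p₀)⁻¹ • (star (u p₀ i) * u p₀ j) := fun p hp i j => by
    obtain ⟨g, hg⟩ := C.gram_const hM i j
    rw [hg p hp, hg p₀ hp₀]
  -- This scale makes u_i* u_j = 4h c_i* c_j, and thus |u|² = 4h |c|².
  set r : ℝ := (2 * Real.sqrt (h p₀))⁻¹ with hr
  have hr2 : r * r = 4⁻¹ * (h p₀)⁻¹ := by
    rw [hr, ← mul_inv, ← mul_inv]
    congr 1
    nlinarith [Real.mul_self_sqrt h0.le]
  set c : Fin n → ℍ[ℝ] := r • u p₀ with hc
  -- `star (u i) u j = 4 h star (c i) (c j)`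
  have hcc : ∀ p ∈ Ω, ∀ i j, star (u p i) * u p j = (4 * h p) • (star (c i) * c j) := by
    intro p hp i j
    have hpos := C.pos p hp
    have h1 : star (u p i) * u p j = (2 * h p) • ((2 * h p)⁻¹ • (star (u p i) * u p j)) := by
      rw [smul_inv_smul₀ (by positivity)]
    have h2 : star (c i) * c j = (r * r) • (star (u p₀ i) * u p₀ j) := by
      rw [hc]
      simp only [Pi.smul_apply]
      ext <;> simp [Quaternion.re_mul, Quaternion.imI_mul, Quaternion.imJ_mul,
        Quaternion.imK_mul] <;> ring
    rw [h1, hgram p hp, h2, hr2, smul_smul, smul_smul]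
    congr 1
    field_simp
  have hnorm : ∀ p ∈ Ω, rip (u p) (u p) = 4 * h p * rip c c := by
    intro p hp
    have h1 : ∀ X : Fin n → ℍ[ℝ], rip X X = ∑ i, (star (X i) * X i).re := fun X => by
      rw [rip, hip, re_sum]
      exact Finset.sum_congr rfl fun i _ => re_mul_comm _ _
    rw [h1, h1, Finset.mul_sum]
    refine Finset.sum_congr rfl fun i _ => ?_
    rw [hcc p hp]; simp
  have hS : ∀ p ∈ Ω, 4 * (M p).re - rip (u p) (u p) / h p = -(4 * ∑ i, ‖c i‖ ^ 2) := by
    intro p hp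
    have hpos := C.pos p hp
    rw [hM p hp, hnorm p hp, ← rip_self_eq_sum]
    simp
    field_simp
  -- If c = 0 one cannot divide by |c|²; then u = 0 and h is constant, and its square root serves as
  -- a.
  by_cases hc0 : c = 0
  · obtain ⟨b, hb⟩ := C.const_of_hasDir C.smooth_h fun p hp A => by
      refine (C.deriv_h p hp A).congr_deriv ?_
      have : u p = 0 := by rw [← rip_self_eq_zero, hnorm p hp, hc0]; simp
      rw [this, rip_zero_left]
    refine ⟨(Real.sqrt b : ℝ), c, fun p hp => ?_, hS⟩
    have hb0 : 0 < b := hb p hp ▸ C.pos p hp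
    rw [hc0, hb p hp]
    simp [hb0.le]
  have hcpos := rip_self_pos hc0
  have key : ∀ p ∈ Ω, ∀ X, hip c (u p) * hip (u p) X = (4 * h p * rip c c) • hip c X := by
    intro p hp X
    have h1 : hip c (u p) * hip (u p) X = ∑ j, ∑ i, c i * (star (u p i) * u p j) * star (X j) := by
      rw [hip, hip, Finset.mul_sum]
      simp only [Finset.sum_mul, mul_assoc]
    have h2 : ∀ j, ∑ i, c i * (star (u p i) * u p j) * star (X j) =
        (4 * h p) • ((∑ i, c i * star (c i)) * (c j * star (X j))) := fun j => by
      rw [Finset.sum_mul, Finset.smul_sum]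
      refine Finset.sum_congr rfl fun i _ => ?_
      rw [hcc p hp]
      simp only [smul_mul_assoc, mul_smul_comm, mul_assoc]
    rw [h1]
    simp only [h2]
    rw [← Finset.smul_sum, ← Finset.mul_sum]
    change (4 * h p) • (hip c c * hip c X) = _
    rw [hip_self, Quaternion.coe_mul_eq_smul, smul_smul]
  obtain ⟨a, ha⟩ := C.const_of_hasDir (f := fun x => (2 * rip c c)⁻¹ • hip c (u x) - hip c (qcoord x))
    (((contDiffOn_hip contDiffOn_const C.smooth_u).const_smul _).sub
      (contDiffOn_hip contDiffOn_const contDiffOn_qcoord)) fun p hp A => by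
      have hpos := C.pos p hp
      refine ((((hasDir_const c p _).hip (C.deriv_u p hp A)).const_smul _).sub
        ((hasDir_const c p _).hip (hasDir_qcoord p (hor p A)))).congr_deriv ?_
      rw [hM p hp, zero_smul, zero_add, hip_zero_left, hip_zero_left, zero_add, zero_add,
        qcoord_hor, hip_rsmul_right, hip_smul_right, star_hip, key p hp, smul_smul, smul_smul,
        sub_eq_zero]
      convert one_smul ℝ _
      field_simp
      norm_num
  refine ⟨a, c, fun p hp => ?_, hS⟩
  have hpos := C.pos p hp
  have h1 : a + ∑ i, c i * star (qcoord p i) = (2 * rip c c)⁻¹ • hip c (u p) := by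
    rw [← ha p hp]
    change _ - _ + hip c (qcoord p) = _
    abel
  have h2 : Quaternion.normSq (hip c (u p)) = 4 * h p * rip c c * rip c c := by
    rw [normSq_eq_re, star_hip, key p hp, hip_self]
    simp
  rw [h1, sq, ← Quaternion.normSq_eq_norm_mul_self, Quaternion.normSq_smul, h2]
  field_simp
  norm_num

end ConfSystem

/-! ### Integrability: the equation for M -/

/-- The quaternion `λ - ∑ₛ (ξₛ h) eₛ`. -/
def confM (h l : QHeis n → ℝ) (p : QHeis n) : ℍ[ℝ] :=
  (l p : ℍ[ℝ]) - ∑ s, ((fderiv ℝ h p (vert s) : ℝ) : ℍ[ℝ]) * unit s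

theorem im_confM (h l : QHeis n → ℝ) (p : QHeis n) (s : Fin 3) :
    im s (confM h l p) = -fderiv ℝ h p (vert s) := by
  fin_cases s <;> simp [confM, Fin.sum_univ_three, Quaternion.imI_mul, Quaternion.imJ_mul,
    Quaternion.imK_mul]

theorem re_confM (h l : QHeis n → ℝ) (p : QHeis n) : (confM h l p).re = l p := by
  simp [confM, Fin.sum_univ_three, Quaternion.re_mul]

/-- A smooth conformal factor whose horizontal Hessian has the shape forced by the qc-Einstein
condition, before any integrability condition is used. -/
structure HessSystem (Ω : Set (QHeis n)) (h : QHeis n → ℝ) (u : QHeis n → Fin n → ℍ[ℝ])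
    (l : QHeis n → ℝ) : Prop where
  isOpen : IsOpen Ω
  smooth_h : ContDiffOn ℝ ∞ h Ω
  smooth_u : ContDiffOn ℝ ∞ u Ω
  smooth_l : ContDiffOn ℝ ∞ l Ω
  pos : ∀ p ∈ Ω, 0 < h p
  deriv_h : ∀ p ∈ Ω, ∀ A, HasDir h (rip (u p) A) p (hor p A)
  deriv_u : ∀ p ∈ Ω, ∀ A,
    HasDir u (confM h l p • A + (2 * h p)⁻¹ • (hip A (u p) • u p)) p (hor p A)

theorem horDeriv_vert (A : Fin n → ℍ[ℝ]) (s : Fin 3) : horDeriv A (vert s) = 0 := by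
  rw [horDeriv_eq_sum, qcoord_vert]
  have : ∀ t, im t (0 : ℍ[ℝ]) = 0 := fun t => by fin_cases t <;> rfl
  simp [this]

theorem hip_sub_hip (A B : Fin n → ℍ[ℝ]) :
    hip B A - hip A B = (2 : ℝ) • ∑ s, rip (unit s • A) B • unit s := by
  rw [hip_swap B A]
  simp only [rip_unit_left]
  ext <;> simp [Fin.sum_univ_three] <;> ring

namespace HessSystem

variable {Ω : Set (QHeis n)} {h : QHeis n → ℝ} {u : QHeis n → Fin n → ℍ[ℝ]}
  {l : QHeis n → ℝ}

theorem smooth_confM (C : HessSystem Ω h u l) : ContDiffOn ℝ ∞ (confM h l) Ω :=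
  (contDiffOn_coe C.smooth_l).sub (ContDiffOn.sum fun _ _ => (contDiffOn_coe
    ((C.smooth_h.fderiv_of_isOpen C.isOpen (by simp)).clm_apply contDiffOn_const)).mul
      contDiffOn_const)

theorem hasDir_confM (C : HessSystem Ω h u l) {p : QHeis n} (hp : p ∈ Ω) (v : QHeis n) :
    HasDir (confM h l) (fderiv ℝ (confM h l) p v) p v :=
  HasDir.of_differentiableAt ((C.smooth_confM.contDiffAt (C.isOpen.mem_nhds hp)).differentiableAt
    (by simp)) v

/-- The defect `N_A = D_A M - (A, u) M / (2 h)`. -/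
def defect (h : QHeis n → ℝ) (u : QHeis n → Fin n → ℍ[ℝ]) (l : QHeis n → ℝ) (p : QHeis n)
    (A : Fin n → ℍ[ℝ]) : ℍ[ℝ] :=
  fderiv ℝ (confM h l) p (hor p A) - (2 * h p)⁻¹ • (hip A (u p) * confM h l p)

/-- The vector `v_s = ξₛ u + eₛ star M u / (2 h)`. -/
def vdefect (h : QHeis n → ℝ) (u : QHeis n → Fin n → ℍ[ℝ]) (l : QHeis n → ℝ) (p : QHeis n)
    (s : Fin 3) : Fin n → ℍ[ℝ] :=
  fderiv ℝ u p (vert s) + (2 * h p)⁻¹ • (unit s • star (confM h l p) • u p)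

/-- The terms with h⁻² cancel because (A, u) + (u, A) = 2 Re (A, u). -/
theorem hasDir_deriv_u (C : HessSystem Ω h u l) {p : QHeis n} (hp : p ∈ Ω)
    (A B : Fin n → ℍ[ℝ]) :
    HasDir (fun x => fderiv ℝ u x (hor x B)) (fderiv ℝ (confM h l) p (hor p A) • B +
      (2 * h p)⁻¹ • ((hip B A * star (confM h l p)) • u p + (hip B (u p) * confM h l p) • A))
      p (hor p A) := by
  have hu := C.deriv_u p hp A
  have hB := hasDir_const B p (hor p A)
  have := ((C.hasDir_confM hp (hor p A)).qsmul hB).add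
    ((hasDir_inv_two_mul (C.pos p hp).ne' (C.deriv_h p hp A)).smul ((hB.hip hu).qsmul hu))
  refine (this.congr C.isOpen hp fun x hx => (C.deriv_u x hx B).eq).congr_deriv ?_
  rw [rip_eq_re, smul_zero, add_zero, hip_zero_left, zero_add, hip_add_right, hip_rsmul_right,
    hip_smul_right, hip_smul_right]
  ext1 i
  simp only [Pi.add_apply, Pi.smul_apply, smul_eq_mul]
  generalize hip A (u p) = x
  generalize hip B (u p) = y
  generalize hip B A = z
  generalize (2 * h p)⁻¹ = k
  generalize confM h l p = m
  generalize u p i = w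
  generalize A i = a
  congr 1
  ext <;> simp [Quaternion.re_mul, Quaternion.imI_mul, Quaternion.imJ_mul, Quaternion.imK_mul] <;>
    ring

/-- This is the bracket relation of `fderiv_hor_comm` applied to u. Antisymmetrizing
`hasDir_deriv_u` leaves the defects, and (B, A) - (A, B) = 2 ∑ ⟨e_s A, B⟩ e_s merges the remaining
M* u terms with the vertical derivatives of u. -/
theorem defect_comm (C : HessSystem Ω h u l) {p : QHeis n} (hp : p ∈ Ω)
    (A B : Fin n → ℍ[ℝ]) :
    defect h u l p A • B - defect h u l p B • A +
      (2 : ℝ) • ∑ s, rip (unit s • A) B • vdefect h u l p s = 0 := by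
  have key := fderiv_hor_comm (C.smooth_u.contDiffAt (C.isOpen.mem_nhds hp)) A B
  rw [(C.hasDir_deriv_u hp A B).eq, (C.hasDir_deriv_u hp B A).eq] at key
  have h1 := congrArg (fun z => (2 * h p)⁻¹ • (z * star (confM h l p)) • u p) (hip_sub_hip A B)
  simp only [sub_mul, sub_smul, smul_sub, Finset.sum_mul, Finset.sum_smul, smul_mul_assoc,
    Finset.smul_sum] at h1
  simp only [defect, vdefect, smul_add, Finset.smul_sum, Finset.sum_add_distrib, sub_smul]
  simp only [neg_smul, Finset.smul_sum, smul_assoc] at key h1 ⊢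
  have h2 : ∀ s : Fin 3, (2 : ℝ) • rip (unit s • A) B • (2 * h p)⁻¹ •
      unit s • star (confM h l p) • u p = (2 * h p)⁻¹ • (2 : ℝ) • rip (unit s • A) B •
        (unit s * star (confM h l p)) • u p := fun s => by
    rw [mul_smul, smul_comm (rip _ _) ((2 * h p)⁻¹), smul_comm (2 : ℝ) ((2 * h p)⁻¹)]
  simp only [h2, ← h1]
  simp only [Finset.sum_neg_distrib] at key
  rw [eq_neg_iff_add_eq_zero] at key
  rw [← key]
  simp only [smul_add]
  abel

/-- Left-invariant horizontal fields commute with `vert s`, so differentiating ξ_s h along A is the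
same as pairing ξ_s u with A. -/
theorem im_defect (C : HessSystem Ω h u l) {p : QHeis n} (hp : p ∈ Ω)
    (A : Fin n → ℍ[ℝ]) (s : Fin 3) :
    im s (defect h u l p A) = -rip (vdefect h u l p s) A := by
  have hcd := C.smooth_h.contDiffAt (C.isOpen.mem_nhds hp)
  let L : ℍ[ℝ] →ₗ[ℝ] ℝ := ⟨⟨im s, im_add s⟩, fun c a => im_smul s c a⟩
  have h1 : im s (fderiv ℝ (confM h l) p (hor p A)) =
      -fderiv ℝ (fderiv ℝ h) p (hor p A) (vert s) := by
    have e1 := (C.hasDir_confM hp (hor p A)).linear L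
    have e2 := (hasDir_fderiv_apply hcd (hasDir_const (vert s : QHeis n) p (hor p A))).const_smul
      (-1)
    have := e2.unique e1 C.isOpen hp fun x _ => by
      change im s (confM h l x) = _
      simpa using im_confM h l x s
    rw [← show L (fderiv ℝ (confM h l) p (hor p A)) = im s (fderiv ℝ (confM h l) p (hor p A)) from
      rfl, ← this]
    simp
  have h2 : rip (fderiv ℝ u p (vert s)) A = fderiv ℝ (fderiv ℝ h) p (hor p A) (vert s) := by
    have e1 := (HasDir.of_differentiableAt ((C.smooth_u.contDiffAt
      (C.isOpen.mem_nhds hp)).differentiableAt (by simp)) (vert s)).rip (hasDir_const A p (vert s))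
    have e2 := hasDir_fderiv_apply hcd (hasDir_hor A p (vert s))
    have := e1.unique e2 C.isOpen hp fun x hx => (C.deriv_h x hx A).eq
    rw [rip_zero_right, add_zero, horDeriv_vert, map_zero, add_zero] at this
    rw [this, fderiv_fderiv_symm hcd]
  rw [defect, vdefect, im_sub, h1, rip_add_left, h2, im_smul, rip_rsmul_left, rip_unit_left,
    hip_smul_left, hip_swap (u p) A, ← star_mul, im_star]
  ring

/-- Differentiate 4λ - |u|²/h along A: by the equation for u, the derivative of |u|²/h is 4 Re ((A,
u) M)/2h. -/
theorem re_defect (C : HessSystem Ω h u l) {p : QHeis n} (hp : p ∈ Ω) (A : Fin n → ℍ[ℝ])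
    {k : ℝ} (hk : ∀ p ∈ Ω, 4 * l p - rip (u p) (u p) / h p = k) :
    (defect h u l p A).re = 0 := by
  have e1 := ((C.hasDir_confM hp (hor p A)).re.const_smul 4).sub
    (((hasDir_inv_two_mul (C.pos p hp).ne' (C.deriv_h p hp A)).mul
      ((C.deriv_u p hp A).rip (C.deriv_u p hp A))).const_smul 2)
  have := e1.unique (hasDir_const k p (hor p A)) C.isOpen hp fun x hx => by
    have := C.pos x hx
    rw [← hk x hx, re_confM, smul_eq_mul, smul_eq_mul]
    field_simp
  rw [defect, Quaternion.re_sub]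
  rw [rip_comm (u p) (_ + _), rip_add_left, rip_rsmul_left, rip_smul_left, rip_smul_left, hip_self,
    rip_eq_re (u p) A] at this
  simp only [smul_eq_mul, Quaternion.re_smul, Quaternion.re_mul, Quaternion.re_coe,
    Quaternion.imI_coe, Quaternion.imJ_coe, Quaternion.imK_coe, mul_zero, sub_zero] at this ⊢
  linear_combination this / 4

/-- With A and B in different slots all pairings ⟨e_s A, B⟩ vanish, and the slot of B in
`defect_comm` contains only the defect of A. -/
theorem defect_eq_zero_of_ne (C : HessSystem Ω h u l) {p : QHeis n} (hp : p ∈ Ω) {i j : Fin n}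
    (hij : i ≠ j) (a : ℍ[ℝ]) : defect h u l p (Pi.single i a) = 0 := by
  have key := congrFun (C.defect_comm hp (Pi.single i a) (Pi.single j 1)) j
  have hr : ∀ s, rip (unit s • Pi.single i a) (Pi.single j (1 : ℍ[ℝ])) = 0 := fun s => by
    rw [rip_unit_left, hip_single_left]
    have : im s (0 : ℍ[ℝ]) = 0 := by fin_cases s <;> rfl
    simp [hij, this]
  simpa [hr, hij.symm] using key

/-- A single slot suffices once real parts vanish: by `im_defect` the defects are then functions of
the three quaternions v_s, and `defect_comm` for the pairs (1, e_r) becomes a linear system for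
them. -/
theorem defect_eq_zero_of_re [NeZero n] (C : HessSystem Ω h u l) {p : QHeis n} (hp : p ∈ Ω)
    (hre : ∀ A, (defect h u l p A).re = 0) (a : ℍ[ℝ]) :
    defect h u l p (Pi.single 0 a) = 0 := by
  set v : Fin 3 → ℍ[ℝ] := fun s => vdefect h u l p s 0 with hv
  have hN : ∀ b : ℍ[ℝ], defect h u l p (Pi.single 0 b) = -∑ s, (v s * star b).re • unit s := by
    intro b
    have h1 := fun s => C.im_defect hp (Pi.single 0 b) s
    simp only [rip, hip_single_right] at h1
    have h10 := h1 0
    have h11 := h1 1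
    have h12 := h1 2
    rw [im_zero] at h10
    rw [im_one] at h11
    rw [im_two] at h12
    ext
    · simp [hre, Fin.sum_univ_three]
    · rw [h10]; simp [Fin.sum_univ_three, v]
    · rw [h11]; simp [Fin.sum_univ_three, v]
    · rw [h12]; simp [Fin.sum_univ_three, v]
  have key : ∀ r : Fin 3, (-∑ s, (v s).re • unit s) * unit r + ∑ s, im r (v s) • unit s +
      (2 : ℝ) • v r = 0 := by
    intro r
    have := congrFun (C.defect_comm hp (Pi.single 0 1) (Pi.single 0 (unit r))) 0
    rw [hN, hN] at this
    have hr : ∀ s, rip (unit s • Pi.single (0 : Fin n) (1 : ℍ[ℝ])) (Pi.single 0 (unit r)) =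
        if s = r then 1 else 0 := fun s => by
      rw [rip_unit_left, hip_single_left]
      fin_cases s <;> fin_cases r <;> simp
    have hi : ∀ s, (v s * star (unit r)).re = im r (v s) := fun s => by
      fin_cases r <;> simp [Quaternion.re_mul]
    simp only [hr, hi, star_one, mul_one, ite_smul, one_smul, zero_smul, Finset.sum_ite_eq',
      Finset.mem_univ, if_true, Pi.add_apply, Pi.sub_apply, Pi.smul_apply, Pi.single_eq_same,
      smul_eq_mul, Pi.zero_apply, sub_neg_eq_add] at this
    exact this
  -- `key` amounts to twelve real linear equations in twelve unknowns, with only the zero solution.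
  have hv0 : ∀ r, v r = 0 := by
    have k0 := key 0
    have k1 := key 1
    have k2 := key 2
    simp only [Quaternion.ext_iff, Fin.sum_univ_three] at k0 k1 k2
    simp [Quaternion.re_mul, Quaternion.imI_mul, Quaternion.imJ_mul, Quaternion.imK_mul]
      at k0 k1 k2
    obtain ⟨a0, a1, a2, a3⟩ := k0
    obtain ⟨b0, b1, b2, b3⟩ := k1
    obtain ⟨c0, c1, c2, c3⟩ := k2
    intro r
    fin_cases r <;> ext <;> simp <;> linarith
  rw [hN]
  simp [hv0]

theorem defect_eq_zero [NeZero n] (C : HessSystem Ω h u l)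
    (hS : n = 1 → ∃ k : ℝ, ∀ p ∈ Ω, 4 * l p - rip (u p) (u p) / h p = k)
    {p : QHeis n} (hp : p ∈ Ω) (A : Fin n → ℍ[ℝ]) : defect h u l p A = 0 := by
  have hsingle : ∀ i (a : ℍ[ℝ]), defect h u l p (Pi.single i a) = 0 := by
    intro i a
    by_cases hn : n = 1
    · obtain ⟨k, hk⟩ := hS hn
      subst hn
      rw [Subsingleton.elim i 0]
      exact C.defect_eq_zero_of_re hp (fun A => C.re_defect hp A hk) a
    · have : Nontrivial (Fin n) := Fin.nontrivial_iff_two_le.2 (by have := NeZero.ne n; omega)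
      obtain ⟨j, hj⟩ := exists_ne i
      exact C.defect_eq_zero_of_ne hp hj.symm a
  let D : (Fin n → ℍ[ℝ]) →ₗ[ℝ] ℍ[ℝ] :=
    { toFun := defect h u l p
      map_add' := fun A B => by
        simp only [defect, hor_add, map_add, hip_add_left, add_mul, smul_add]; abel
      map_smul' := fun c A => by
        simp only [defect, hor_smul, map_smul, hip_rsmul_left, smul_mul_assoc, smul_sub,
          RingHom.id_apply]
        rw [smul_comm c ((2 * h p)⁻¹)] }
  change D A = 0
  rw [← Finset.univ_sum_single A, map_sum]
  exact Finset.sum_eq_zero fun i _ => hsingle i _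

theorem confSystem [NeZero n] (C : HessSystem Ω h u l) (hc : IsPreconnected Ω)
    (hS : n = 1 → ∃ k : ℝ, ∀ p ∈ Ω, 4 * l p - rip (u p) (u p) / h p = k) :
    ConfSystem Ω h u (confM h l) where
  isOpen := C.isOpen
  isPreconnected := hc
  smooth_h := C.smooth_h
  smooth_u := C.smooth_u
  smooth_M := C.smooth_confM
  pos := C.pos
  deriv_h := C.deriv_h
  deriv_u := C.deriv_u
  deriv_M p hp A := (C.hasDir_confM hp (hor p A)).congr_deriv
    (sub_eq_zero.1 (C.defect_eq_zero hS hp A))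

end HessSystem

/-! ### The conformally deformed structure in the left-invariant frame -/

/-- The horizontal gradient of `h` in the left-invariant frame. -/
def grad (h : QHeis n → ℝ) (p : QHeis n) : Fin n → ℍ[ℝ] :=
  ∑ k, fderiv ℝ h p (hor p (stdBasis k)) • stdBasis k

theorem rip_grad (h : QHeis n → ℝ) (p : QHeis n) (A : Fin n → ℍ[ℝ]) :
    rip (grad h p) A = fderiv ℝ h p (hor p A) := by
  rw [grad, rip_sum_left]
  simp only [rip_rsmul_left]
  have := sum_rip_stdBasis_smul ((fderiv ℝ h p : QHeis n →ₗ[ℝ] ℝ) ∘ₗ horLin p) A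
  rw [show fderiv ℝ h p (hor p A) = ((fderiv ℝ h p : QHeis n →ₗ[ℝ] ℝ) ∘ₗ horLin p) A from rfl,
    ← this]
  refine Finset.sum_congr rfl fun k _ => ?_
  rw [smul_eq_mul, mul_comm, rip_comm]
  rfl

theorem contDiffOn_hor {Ω : Set (QHeis n)} (A : Fin n → ℍ[ℝ]) :
    ContDiffOn ℝ ∞ (fun x => hor x A) Ω :=
  (contDiffOn_const (c := ((lift A, 0) : QHeis n)).add
    (contDiffOn_linear (horDerivLin A) contDiffOn_id)).congr fun x _ => hor_eq x A

theorem contDiffOn_grad {Ω : Set (QHeis n)} {h : QHeis n → ℝ} (hΩ : IsOpen Ω)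
    (hs : ContDiffOn ℝ ∞ h Ω) : ContDiffOn ℝ ∞ (grad h) Ω :=
  ContDiffOn.sum fun k _ => ((hs.fderiv_of_isOpen hΩ (by simp)).clm_apply
    (contDiffOn_hor (stdBasis k))).smul contDiffOn_const

theorem confForm_apply (h : QHeis n → ℝ) (s : Fin 3) (p v : QHeis n) :
    confForm h s p v = (2 * h p)⁻¹ * stdForm n s p v := by
  simp [confForm]

/-- The connection form `Λ(v, B)` of `∇ = D + Γ` in the left-invariant horizontal frame. -/
def conn (Γ : QHeis n → QHeis n →L[ℝ] QHeis n →L[ℝ] QHeis n) (p v : QHeis n)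
    (B : Fin n → ℍ[ℝ]) : Fin n → ℍ[ℝ] :=
  qcoord (Γ p v (hor p B))

namespace QCStructure

variable {Ω : Set (QHeis n)} {h : QHeis n → ℝ}

theorem mem_nhds (Q : QCStructure n Ω (confForm h)) {p : QHeis n} (hp : p ∈ Ω)
    : Ω ∈ nhds p := Q.isOpen.mem_nhds hp

theorem hasDir_h (Q : QCStructure n Ω (confForm h)) (hs : ContDiffOn ℝ ∞ h Ω)
    {p : QHeis n} (hp : p ∈ Ω)
    (v : QHeis n) : HasDir h (fderiv ℝ h p v) p v :=
  HasDir.of_differentiableAt ((hs.contDiffAt (Q.mem_nhds hp)).differentiableAt (by simp)) v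

theorem fderiv_confForm (Q : QCStructure n Ω (confForm h)) (hs : ContDiffOn ℝ ∞ h Ω)
    (hpos : ∀ p ∈ Ω, 0 < h p) {p : QHeis n} (hp : p ∈ Ω)
    (s : Fin 3) (v w : QHeis n) :
    fderiv ℝ (confForm h s) p v w = -2 * (2 * h p)⁻¹ ^ 2 * fderiv ℝ h p v * stdForm n s p w +
      (2 * h p)⁻¹ * im s (hip (qcoord w) (qcoord v)) := by
  have h1 := (HasDir.of_differentiableAt (((Q.contDiffOn_η s).contDiffAt
    (Q.mem_nhds hp)).differentiableAt (by simp)) v).clm_apply (hasDir_const w p v)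
  let L : ℍ[ℝ] →ₗ[ℝ] ℝ := ⟨⟨im s, im_add s⟩, fun c a => im_smul s c a⟩
  have h2 := (hasDir_inv_two_mul (hpos p hp).ne' (Q.hasDir_h hs hp v)).mul
    ((hasDir_const (1 / 2 * w.2 s) p v).add
      (((hasDir_const (qcoord w) p v).hip (hasDir_qcoord p v)).linear L))
  have := h1.unique h2 Q.isOpen hp fun x _ => (confForm_apply h s x w).symm
  rw [map_zero, add_zero] at this
  rw [this, hip_zero_left, zero_add, zero_add]
  rfl

theorem dForm_hor (Q : QCStructure n Ω (confForm h)) (hs : ContDiffOn ℝ ∞ h Ω)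
    (hpos : ∀ p ∈ Ω, 0 < h p) {p : QHeis n} (hp : p ∈ Ω)
    (s : Fin 3) (A B : Fin n → ℍ[ℝ]) :
    dForm (confForm h s) p (hor p A) (hor p B) = 2 * (2 * h p)⁻¹ * rip (unit s • A) B := by
  rw [dForm, Q.fderiv_confForm hs hpos hp, Q.fderiv_confForm hs hpos hp, stdForm_hor, stdForm_hor,
    qcoord_hor, qcoord_hor, rip_unit_left, im_hip_comm s B A]
  ring

theorem hor_mem (p : QHeis n) (A : Fin n → ℍ[ℝ]) : hor p A ∈ horizontal (confForm h) p := by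
  simp [horizontal, confForm_apply]

theorem eq_hor_of_mem (hpos : ∀ p ∈ Ω, 0 < h p) {p : QHeis n} (hp : p ∈ Ω)
    {v : QHeis n} (hv : v ∈ horizontal (confForm h) p) :
    v = hor p (qcoord v) := by
  have h1 : ∀ s, stdForm n s p v = 0 := by
    intro s
    have : confForm h s p v = 0 := by
      simp only [horizontal, Submodule.mem_iInf] at hv
      exact hv s
    rw [confForm_apply] at this
    have h0 := hpos p hp
    exact (mul_eq_zero.1 this).resolve_left (by positivity)
  conv_lhs => rw [eq_hor_add_vert p v]
  simp [h1]

/-- The metric is not yet known, only the forms 2 g(I_s ·, ·) = dη_s. Comparing dη₀(I₁ X, ·) with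
dη₂ through I₀ I₁ = I₂ eliminates g and determines I₁; g and the other I_s follow. -/
theorem I_one_hor (Q : QCStructure n Ω (confForm h)) (hs : ContDiffOn ℝ ∞ h Ω)
    (hpos : ∀ p ∈ Ω, 0 < h p) {p : QHeis n} (hp : p ∈ Ω)
    (A : Fin n → ℍ[ℝ]) : Q.I 1 p (hor p A) = hor p (unit 1 • A) := by
  have h0 := hpos p hp
  have hm : Q.I 1 p (hor p A) = hor p (qcoord (Q.I 1 p (hor p A))) :=
    eq_hor_of_mem hpos hp (Q.I_mem p hp 1 _ (hor_mem p A))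
  rw [hm]
  congr 1
  set J := qcoord (Q.I 1 p (hor p A)) with hJ
  have key : unit 0 • J = unit 2 • A := by
    refine rip_ext fun B => ?_
    have h1 := Q.two_g_I p hp 0 _ (Q.I_mem p hp 1 _ (hor_mem p A)) _ (hor_mem p B)
    have h2 := Q.two_g_I p hp 2 _ (hor_mem p A) _ (hor_mem p B)
    rw [Q.I_mul p hp _ (hor_mem p A), h2, Q.dForm_hor hs hpos hp, hm,
      Q.dForm_hor hs hpos hp] at h1
    exact (mul_left_cancel₀ (by positivity) h1).symm
  have h3 : J = -(unit 0 • unit 0 • J) := by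
    rw [smul_smul]
    have : unit 0 * unit 0 = -1 := by
      ext <;> simp [Quaternion.re_mul, Quaternion.imI_mul, Quaternion.imJ_mul, Quaternion.imK_mul]
    simp [this]
  rw [h3, key, smul_smul, ← neg_smul]
  congr 1
  ext <;> simp [Quaternion.re_mul, Quaternion.imI_mul, Quaternion.imJ_mul, Quaternion.imK_mul]

theorem unit_mul_self (s : Fin 3) : unit s * unit s = -1 := by
  fin_cases s <;> ext <;>
    simp [Quaternion.re_mul, Quaternion.imI_mul, Quaternion.imJ_mul, Quaternion.imK_mul]

theorem unit_smul_unit_smul (s : Fin 3) (A : Fin n → ℍ[ℝ]) : unit s • unit s • A = -A := by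
  rw [smul_smul, unit_mul_self]; simp

theorem g_hor (Q : QCStructure n Ω (confForm h)) (hs : ContDiffOn ℝ ∞ h Ω)
    (hpos : ∀ p ∈ Ω, 0 < h p) {p : QHeis n} (hp : p ∈ Ω)
    (A B : Fin n → ℍ[ℝ]) :
    Q.g p (hor p A) (hor p B) = (2 * h p)⁻¹ * rip A B := by
  have h1 := Q.two_g_I p hp 1 _ (hor_mem p (-(unit 1 • A))) _ (hor_mem p B)
  rw [Q.I_one_hor hs hpos hp, Q.dForm_hor hs hpos hp, smul_neg, unit_smul_unit_smul, neg_neg] at h1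
  linarith

theorem I_hor (Q : QCStructure n Ω (confForm h)) (hs : ContDiffOn ℝ ∞ h Ω)
    (hpos : ∀ p ∈ Ω, 0 < h p) {p : QHeis n} (hp : p ∈ Ω)
    (s : Fin 3) (A : Fin n → ℍ[ℝ]) : Q.I s p (hor p A) = hor p (unit s • A) := by
  have h0 := hpos p hp
  have hm : Q.I s p (hor p A) = hor p (qcoord (Q.I s p (hor p A))) :=
    eq_hor_of_mem hpos hp (Q.I_mem p hp s _ (hor_mem p A))
  rw [hm]
  congr 1
  refine rip_ext fun B => ?_
  have h1 := Q.two_g_I p hp s _ (hor_mem p A) _ (hor_mem p B)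
  rw [hm, Q.g_hor hs hpos hp, Q.dForm_hor hs hpos hp, ← mul_assoc] at h1
  exact mul_left_cancel₀ (by positivity) h1

/-- Duality gives the vertical components. The horizontal one comes from dη_s(ξ_s, X) = 0, the case
t = s of `reeb_skew`, where the derivative of 1/2h brings in the gradient. -/
theorem reeb_eq (Q : QCStructure n Ω (confForm h)) (hs : ContDiffOn ℝ ∞ h Ω)
    (hpos : ∀ p ∈ Ω, 0 < h p) {p : QHeis n} (hp : p ∈ Ω)
    (s : Fin 3) :
    Q.ξ s p = hor p (unit s • grad h p) + (2 * h p) • vert s := by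
  have h0 := hpos p hp
  have hst : ∀ t, stdForm n t p (Q.ξ s p) = if t = s then 2 * h p else 0 := by
    intro t
    have h1 := Q.reeb_dual p hp t s
    rw [confForm_apply] at h1
    rw [← mul_inv_cancel_left₀ (show 2 * h p ≠ 0 by positivity) (stdForm n t p (Q.ξ s p)), h1]
    split_ifs <;> simp
  have hq : unit s • qcoord (Q.ξ s p) = -grad h p := by
    refine rip_ext fun A => ?_
    have h2 := Q.reeb_skew p hp s s _ (hor_mem p A)
    rw [dForm, Q.fderiv_confForm hs hpos hp, Q.fderiv_confForm hs hpos hp, stdForm_hor, hst,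
      qcoord_hor, ← rip_grad, im_hip_comm s A] at h2
    rw [rip_unit_left, rip_neg_left]
    simp only [if_true] at h2
    have h3 : (2 * h p)⁻¹ * (im s (hip (qcoord (Q.ξ s p)) A) - rip (grad h p) A) = 0 := by
      have h4 : (2 * h p)⁻¹ ^ 2 * (2 * h p) = (2 * h p)⁻¹ := by field_simp
      linear_combination -h2 / 4 + rip (grad h p) A * h4
    have h5 := (mul_eq_zero.1 h3).resolve_left (by positivity)
    linarith
  have hq' : qcoord (Q.ξ s p) = unit s • grad h p := by
    have h3 := congrArg (fun X => -(unit s • X)) hq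
    simpa [unit_smul_unit_smul] using h3
  conv_lhs => rw [eq_hor_add_vert p (Q.ξ s p), hq']
  simp [hst]

variable {Γ : QHeis n → QHeis n →L[ℝ] QHeis n →L[ℝ] QHeis n}

/-- The covariant derivative of the field `hor · B` is horizontal because H is parallel. As
`horDeriv` has no horizontal coordinates, those of Γ alone describe it. -/
theorem hor_conn (Q : QCStructure n Ω (confForm h)) (hs : ContDiffOn ℝ ∞ h Ω)
    (hpos : ∀ p ∈ Ω, 0 < h p) {p : QHeis n} (hp : p ∈ Ω) (hΓ : Q.IsBiquardConnection Γ)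
    (v : QHeis n) (B : Fin n → ℍ[ℝ]) :
    hor p (conn Γ p v B) = horDeriv B v + Γ p v (hor p B) := by
  have h0 := hpos p hp
  have hst : ∀ s, stdForm n s p (horDeriv B v + Γ p v (hor p B)) = 0 := by
    intro s
    have h1 := hΓ.horizontal_parallel p hp v _ (hor_mem p B) s
    rw [Q.fderiv_confForm hs hpos hp, stdForm_hor, confForm_apply, qcoord_hor] at h1
    have h2 : stdForm n s p (horDeriv B v) = -im s (hip B (qcoord v)) := by
      rw [stdForm_apply, qcoord_horDeriv, hip_zero_left]
      have : im s (0 : ℍ[ℝ]) = 0 := by fin_cases s <;> rfl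
      simp [horDeriv, this]
    rw [map_add, h2]
    have h3 : (2 * h p)⁻¹ * (-im s (hip B (qcoord v)) + stdForm n s p (Γ p v (hor p B))) = 0 := by
      linear_combination -h1
    exact (mul_eq_zero.1 h3).resolve_left (by positivity)
  conv_rhs => rw [eq_hor_add_vert p (horDeriv B v + Γ p v (hor p B))]
  simp [hst, qcoord_map_add, conn]

theorem Γ_hor (Q : QCStructure n Ω (confForm h)) (hs : ContDiffOn ℝ ∞ h Ω)
    (hpos : ∀ p ∈ Ω, 0 < h p) {p : QHeis n} (hp : p ∈ Ω) (hΓ : Q.IsBiquardConnection Γ)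
    (v : QHeis n) (B : Fin n → ℍ[ℝ]) :
    Γ p v (hor p B) = hor p (conn Γ p v B) - horDeriv B v := by
  rw [Q.hor_conn hs hpos hp hΓ]; abel

theorem conn_metric (Q : QCStructure n Ω (confForm h)) (hs : ContDiffOn ℝ ∞ h Ω)
    (hpos : ∀ p ∈ Ω, 0 < h p) {p : QHeis n} (hp : p ∈ Ω) (hΓ : Q.IsBiquardConnection Γ)
    (v : QHeis n) (A B : Fin n → ℍ[ℝ]) :
    rip (conn Γ p v A) B + rip A (conn Γ p v B) = -2 * (2 * h p)⁻¹ * fderiv ℝ h p v * rip A B := by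
  have h0 := hpos p hp
  have h1 := ((HasDir.of_differentiableAt ((Q.contDiffOn_g.contDiffAt
    (Q.mem_nhds hp)).differentiableAt (by simp)) v).clm_apply (hasDir_hor A p v)).clm_apply
      (hasDir_hor B p v)
  have h2 := (hasDir_inv_two_mul (hpos p hp).ne' (Q.hasDir_h hs hp v)).mul
    (hasDir_const (rip A B) p v)
  have h3 := h1.unique h2 Q.isOpen hp fun x hx => (Q.g_hor hs hpos hx A B).symm
  have h4 := hΓ.metric_parallel p hp v _ (hor_mem p A) _ (hor_mem p B)
  rw [Q.Γ_hor hs hpos hp hΓ, Q.Γ_hor hs hpos hp hΓ] at h4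
  simp only [map_sub, sub_apply, add_apply,
    Q.g_hor hs hpos hp, mul_zero, add_zero] at h3 h4
  have h5 : (2 * h p)⁻¹ * (rip (conn Γ p v A) B + rip A (conn Γ p v B)) =
      (2 * h p)⁻¹ * (-2 * (2 * h p)⁻¹ * fderiv ℝ h p v * rip A B) := by
    linear_combination h3 - h4
  exact mul_left_cancel₀ (by positivity) h5

/-- Horizontal coordinates of the torsion axiom: the Reeb fields of the deformed form contribute
through their horizontal components e_s ∇h. -/
theorem conn_torsion (Q : QCStructure n Ω (confForm h)) (hs : ContDiffOn ℝ ∞ h Ω)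
    (hpos : ∀ p ∈ Ω, 0 < h p) {p : QHeis n} (hp : p ∈ Ω) (hΓ : Q.IsBiquardConnection Γ)
    (A B : Fin n → ℍ[ℝ]) :
    conn Γ p (hor p A) B - conn Γ p (hor p B) A =
      (2 * (2 * h p)⁻¹) • ∑ s, rip (unit s • A) B • unit s • grad h p := by
  have h1 := congrArg qcoord (hΓ.torsion_horizontal p hp _ (hor_mem p A) _ (hor_mem p B))
  rw [torsion, qcoord_map_sub, qcoord_map_sum] at h1
  rw [show conn Γ p (hor p A) B = qcoord (Γ p (hor p A) (hor p B)) from rfl,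
    show conn Γ p (hor p B) A = qcoord (Γ p (hor p B) (hor p A)) from rfl, h1, Finset.smul_sum]
  refine Finset.sum_congr rfl fun s _ => ?_
  rw [qcoord_map_smul, Q.dForm_hor hs hpos hp, Q.reeb_eq hs hpos hp, qcoord_map_add, qcoord_hor,
    qcoord_map_smul, qcoord_vert, smul_zero, add_zero, mul_smul]

/-- The horizontal part of the connection, by the Koszul formula. -/
theorem conn_hor (Q : QCStructure n Ω (confForm h)) (hs : ContDiffOn ℝ ∞ h Ω)
    (hpos : ∀ p ∈ Ω, 0 < h p) {p : QHeis n} (hp : p ∈ Ω) (hΓ : Q.IsBiquardConnection Γ)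
    (A B : Fin n → ℍ[ℝ]) :
    conn Γ p (hor p A) B = (2 * h p)⁻¹ • (hip B A • grad h p - hip B (grad h p) • A -
      hip A (grad h p) • B) := by
  refine rip_ext fun C => ?_
  have m := fun X Y Z => Q.conn_metric hs hpos hp hΓ (hor p X) Y Z
  have t := fun X Y Z => congrArg (fun V => rip V Z) (Q.conn_torsion hs hpos hp hΓ X Y)
  simp only [← rip_grad, rip_sub_left, rip_rsmul_left, rip_sum_left, rip_unit_left] at m t
  have m1 := m A B C
  have m2 := m B A C
  have m3 := m C A B
  have t1 := t A B C
  have t2 := t A C B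
  have t3 := t B C A
  rw [rip_comm B] at m1
  rw [rip_comm A] at m2 m3
  simp only [rip_rsmul_left, rip_sub_left, rip_smul_left]
  rw [hip_swap B A, hip_swap B, hip_swap A (grad h p)]
  simp only [rip, Fin.sum_univ_three, im_zero, im_one, im_two] at m1 m2 m3 t1 t2 t3
  simp only [Quaternion.re_mul, Quaternion.re_star, Quaternion.imI_star, Quaternion.imJ_star,
    Quaternion.imK_star, rip]
  linear_combination (m1 + m2 - m3 + t1 - t2 - t3) / 2

end QCStructure

/-! ### Projection onto `sp(n) ⊕ sp(1)` -/

/-- The bilinear form `⟨K X, L Y⟩`. -/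
def ripBilin (K L : (Fin n → ℍ[ℝ]) →ₗ[ℝ] (Fin n → ℍ[ℝ])) :
    (Fin n → ℍ[ℝ]) →ₗ[ℝ] (Fin n → ℍ[ℝ]) →ₗ[ℝ] ℝ :=
  LinearMap.mk₂ ℝ (fun X Y => rip (K X) (L Y))
    (fun X Y Z => by simp [rip_add_left]) (fun c X Y => by simp [rip_rsmul_left])
    (fun X Y Z => by simp [rip_add_right]) (fun c X Y => by simp [rip_rsmul_right])

/-- Left multiplication by a quaternion as a real linear map. -/
def lmul (a : ℍ[ℝ]) : (Fin n → ℍ[ℝ]) →ₗ[ℝ] (Fin n → ℍ[ℝ]) where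
  toFun X := a • X
  map_add' := smul_add a
  map_smul' c X := smul_comm a c X

theorem rip_qsmul_qsmul (a b : ℍ[ℝ]) (X Y : Fin n → ℍ[ℝ]) :
    rip (a • X) (b • Y) = rip ((star b * a) • X) Y := by
  rw [rip_smul_right, smul_smul]

theorem qbasis_smul_orthonormal (t : Fin 4) (k l : Fin n × Fin 4) :
    rip (qbasis t • stdBasis k) (qbasis t • stdBasis l : Fin n → ℍ[ℝ]) =
      if k = l then 1 else 0 := by
  rw [rip_qsmul_qsmul]
  have : star (qbasis t) * qbasis t = 1 := by
    fin_cases t <;> ext <;>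
      simp [Quaternion.re_mul, Quaternion.imI_mul, Quaternion.imJ_mul, Quaternion.imK_mul]
  rw [this, one_smul, rip_stdBasis]

theorem sum_qbasis_smul (t : Fin 4)
    (β : (Fin n → ℍ[ℝ]) →ₗ[ℝ] (Fin n → ℍ[ℝ]) →ₗ[ℝ] ℝ) :
    ∑ k, β (qbasis t • stdBasis k) (qbasis t • stdBasis k) =
      ∑ k, β (stdBasis k) (stdBasis k) := by
  have := sum_orthogonal (n := n) (ι := Fin n × Fin 4) (by simp [mul_comm]) one_pos
    (fun k => qbasis t • stdBasis k) (qbasis_smul_orthonormal t) β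
  rw [this, one_mul]

/-- `∑ ⟨L b, (b, A) Z⟩ = ∑ₜ ⟨L eₜ A, eₜ Z⟩`. -/
theorem sum_rip_hip_smul (L : (Fin n → ℍ[ℝ]) →ₗ[ℝ] (Fin n → ℍ[ℝ])) (A Z : Fin n → ℍ[ℝ]) :
    ∑ k, rip (L (stdBasis k)) (hip (stdBasis k) A • Z) =
      ∑ t, rip (L (qbasis t • A)) (qbasis t • Z) := by
  have h1 : ∀ k : Fin n × Fin 4, rip (L (stdBasis k)) (hip (stdBasis k) A • Z) =
      ∑ t, rip (qbasis t • A) (stdBasis k) * rip (L (stdBasis k)) (qbasis t • Z) := by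
    intro k
    rw [hip_eq_sum, Finset.sum_smul, rip_comm, rip_sum_left]
    refine Finset.sum_congr rfl fun t _ => ?_
    rw [Quaternion.coe_mul_eq_smul, smul_assoc, rip_rsmul_left, rip_comm (stdBasis k),
      rip_comm (_ • Z)]
  simp only [h1]
  rw [Finset.sum_comm]
  refine Finset.sum_congr rfl fun t _ => ?_
  have := congrArg (fun V => rip V (qbasis t • Z)) (sum_rip_stdBasis_smul L (qbasis t • A))
  simp only [rip_sum_left, rip_rsmul_left] at this
  exact this

/-- The trace of ⟨L ·, e_s ·⟩ is the same in the basis multiplied by e_t. Moving e_t past e_s costs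
a sign, which is + for 1 and e_s and - for the other two units, so the four traces cancel. -/
theorem sum_rip_qbasis_comm (L : (Fin n → ℍ[ℝ]) →ₗ[ℝ] (Fin n → ℍ[ℝ])) (s : Fin 3) :
    ∑ k, ∑ t, rip (L (qbasis t • stdBasis k)) (qbasis t • unit s • stdBasis k) = 0 := by
  rw [Finset.sum_comm]
  have hsign : ∀ t : Fin 4, ∃ ε : ℝ, qbasis t * unit s = ε • (unit s * qbasis t) ∧
      ε = if t = 0 ∨ t = s.succ then 1 else -1 := by
    intro t
    refine ⟨_, ?_, rfl⟩
    fin_cases t <;> fin_cases s <;> ext <;>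
      simp [Quaternion.re_mul, Quaternion.imI_mul, Quaternion.imJ_mul, Quaternion.imK_mul,
        Fin.ext_iff]
  have h1 : ∀ t : Fin 4, ∑ k : Fin n × Fin 4,
      rip (L (qbasis t • stdBasis k)) (qbasis t • unit s • stdBasis k) =
      (if t = 0 ∨ t = s.succ then 1 else -1) *
        ∑ k : Fin n × Fin 4, rip (L (stdBasis k)) (unit s • stdBasis k) := by
    intro t
    obtain ⟨ε, h1, h2⟩ := hsign t
    rw [← h2]
    have h3 := sum_qbasis_smul t (ripBilin L (lmul (unit s)))
    change ∑ k : Fin n × Fin 4, rip (L (qbasis t • stdBasis k)) (unit s • qbasis t • stdBasis k) =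
      ∑ k : Fin n × Fin 4, rip (L (stdBasis k)) (unit s • stdBasis k) at h3
    rw [← h3, Finset.mul_sum]
    refine Finset.sum_congr rfl fun k _ => ?_
    rw [smul_smul, h1, smul_assoc, rip_rsmul_right, smul_smul]
  simp only [h1, ← Finset.sum_mul]
  have h4 : ∑ t : Fin 4, (if t = 0 ∨ t = s.succ then (1 : ℝ) else -1) = 0 := by
    rw [Fin.sum_univ_succ]
    simp only [true_or, if_true, Fin.succ_ne_zero, false_or, Fin.succ_inj]
    fin_cases s <;> simp [Fin.sum_univ_three]
  rw [h4, zero_mul]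

/-- An endomorphism that normalises `sp(1)` is determined on `⟨L A, eₛ A⟩` by its inner products
with `sp(n)` and `sp(1)`. -/
theorem four_rip_of_normalizer (hn : n ≠ 0) (L : (Fin n → ℍ[ℝ]) →ₗ[ℝ] (Fin n → ℍ[ℝ]))
    (a : Fin 3 → Fin 3 → ℝ)
    (hL : ∀ t A, L (unit t • A) - unit t • L A = ∑ r, a t r • unit r • A)
    (s : Fin 3) (A : Fin n → ℍ[ℝ]) :
    4 * rip (L A) (unit s • A) = ∑ k, rip (L (stdBasis k)) (hip (stdBasis k) A • unit s • A) +
      rip A A / n * ∑ k, rip (L (stdBasis k)) (unit s • stdBasis k) := by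
  -- Commuting L past e_t produces elements e_r A of the sp(1)-orbit, whose pairing with e_t e_s A
  -- is a fixed multiple of |A|².
  have h1 : ∃ d : ℝ, ∀ A, ∑ t, rip (L (qbasis t • A)) (qbasis t • unit s • A) =
      4 * rip (L A) (unit s • A) + d * rip A A := by
    refine ⟨∑ t, ∑ r, a t r * (star (unit t * unit s) * unit r).re, fun A => ?_⟩
    have h2 : ∀ t : Fin 3, rip (L (unit t • A)) (unit t • unit s • A) =
        rip (L A) (unit s • A) + (∑ r, a t r * (star (unit t * unit s) * unit r).re) * rip A A := by
      intro t
      rw [sub_eq_iff_eq_add.1 (hL t A), rip_add_left, rip_qsmul_qsmul, rip_sum_left, add_comm]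
      congr 1
      · have : star (unit t) * unit t = 1 := by
          fin_cases t <;> ext <;> simp [Quaternion.re_mul, Quaternion.imI_mul,
            Quaternion.imJ_mul, Quaternion.imK_mul]
        rw [this, one_smul]
      · rw [Finset.sum_mul]
        refine Finset.sum_congr rfl fun r _ => ?_
        rw [rip_rsmul_left, smul_smul, rip_qsmul_qsmul, rip_smul_left, hip_self,
          Quaternion.re_mul]
        simp [mul_assoc]
    rw [Fin.sum_univ_succ]
    simp only [qbasis_succ, h2, Finset.sum_add_distrib, ← Finset.sum_mul, qbasis_zero, one_smul]
    simp
    ring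
  obtain ⟨d, hd⟩ := h1
  -- Summing over an orthonormal basis determines d.
  have h3 := sum_rip_qbasis_comm L s
  simp only [hd, Finset.sum_add_distrib, ← Finset.mul_sum, sum_rip_stdBasis_self] at h3
  rw [sum_rip_hip_smul, hd]
  have hn' : (n : ℝ) ≠ 0 := by exact_mod_cast hn
  field_simp
  linear_combination -(rip A A / 4) * h3

/-! ### The connection in the Reeb directions -/

namespace QCStructure

variable {Ω : Set (QHeis n)} {h : QHeis n → ℝ}
variable {Γ : QHeis n → QHeis n →L[ℝ] QHeis n →L[ℝ] QHeis n}

/-- The I_s have constant coefficients in the left-invariant frame, so parallelism of their span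
says that the connection form normalizes sp(1). -/
theorem conn_quaternionic (Q : QCStructure n Ω (confForm h)) (hs : ContDiffOn ℝ ∞ h Ω)
    (hpos : ∀ p ∈ Ω, 0 < h p) {p : QHeis n} (hp : p ∈ Ω) (hΓ : Q.IsBiquardConnection Γ)
    (v : QHeis n) : ∃ a : Fin 3 → Fin 3 → ℝ, ∀ s A,
    conn Γ p v (unit s • A) - unit s • conn Γ p v A = ∑ t, a s t • unit t • A := by
  obtain ⟨a, ha⟩ := hΓ.quaternionic_parallel p hp v
  refine ⟨a, fun s A => hor_injective p ?_⟩
  have h1 := ha s _ (hor_mem p A)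
  have h2 := (HasDir.of_differentiableAt (((Q.contDiffOn_I s).contDiffAt
    (Q.mem_nhds hp)).differentiableAt (by simp)) v).clm_apply (hasDir_hor A p v)
  have h3 := h2.unique (hasDir_hor (unit s • A) p v) Q.isOpen hp fun x hx =>
    (Q.I_hor hs hpos hx s A).symm
  simp only [Q.I_hor hs hpos hp] at h1
  rw [Q.Γ_hor hs hpos hp hΓ, Q.Γ_hor hs hpos hp hΓ, map_sub, Q.I_hor hs hpos hp, ← h3] at h1
  rw [hor_sub, hor_sum]
  simp only [hor_smul]
  rw [← h1]
  abel

/-- `conn` as a linear map. -/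
def connLin (Γ : QHeis n → QHeis n →L[ℝ] QHeis n →L[ℝ] QHeis n) (p v : QHeis n) :
    (Fin n → ℍ[ℝ]) →ₗ[ℝ] (Fin n → ℍ[ℝ]) :=
  qcoordLin ∘ₗ (Γ p v : QHeis n →ₗ[ℝ] QHeis n) ∘ₗ horLin p

/-- The horizontal Hessian `A ↦ D_A (∇h)`. -/
def hess (h : QHeis n → ℝ) (p : QHeis n) : (Fin n → ℍ[ℝ]) →ₗ[ℝ] (Fin n → ℍ[ℝ]) :=
  (fderiv ℝ (grad h) p : QHeis n →ₗ[ℝ] (Fin n → ℍ[ℝ])) ∘ₗ horLin p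

/-- The horizontal part of the bracket with the Reeb field `ξₛ`. -/
def reebBracket (h : QHeis n → ℝ) (p : QHeis n) (s : Fin 3) (A : Fin n → ℍ[ℝ]) :
    Fin n → ℍ[ℝ] :=
  -(unit s • hess h p A) + (2 * h p)⁻¹ •
    ((hip (grad h p) A * unit s - unit s * hip (grad h p) A) • grad h p)

theorem hasDir_grad (Q : QCStructure n Ω (confForm h)) (hs : ContDiffOn ℝ ∞ h Ω)
    {p : QHeis n} (hp : p ∈ Ω)
    (A : Fin n → ℍ[ℝ]) : HasDir (grad h) (hess h p A) p (hor p A) :=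
  HasDir.of_differentiableAt (((contDiffOn_grad Q.isOpen hs).contDiffAt
    (Q.mem_nhds hp)).differentiableAt (by simp)) _

theorem stdForm_horDeriv (s : Fin 3) (p v : QHeis n) (A : Fin n → ℍ[ℝ]) :
    stdForm n s p (horDeriv A v) = -im s (hip A (qcoord v)) := by
  rw [stdForm_apply, qcoord_horDeriv, hip_zero_left]
  have : im s (0 : ℍ[ℝ]) = 0 := by fin_cases s <;> rfl
  simp [horDeriv, this]

/-- The derivative of ξ_s along A is ∑ c_t ξ_t because V is parallel. The torsion being horizontal
fixes the c_t, and with them the horizontal part ∑ c_t e_t ∇h. -/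
theorem torsion_reeb (Q : QCStructure n Ω (confForm h)) (hs : ContDiffOn ℝ ∞ h Ω)
    (hpos : ∀ p ∈ Ω, 0 < h p) {p : QHeis n} (hp : p ∈ Ω) (hΓ : Q.IsBiquardConnection Γ)
    (s : Fin 3) (A : Fin n → ℍ[ℝ]) :
    torsion Γ p (Q.ξ s p) (hor p A) =
      hor p (conn Γ p (Q.ξ s p) A - reebBracket h p s A) := by
  have h0 := hpos p hp
  have hmem := hΓ.torsion_vertical p hp s _ (hor_mem p A)
  rw [eq_hor_of_mem hpos hp hmem]
  congr 1
  obtain ⟨c, hc⟩ := (Submodule.mem_span_range_iff_exists_fun ℝ).1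
    (hΓ.vertical_parallel p hp (hor p A) s)
  have hξ : HasDir (Q.ξ s) (hor p (unit s • hess h p A) + horDeriv (unit s • grad h p) (hor p A) +
      (2 * rip (grad h p) A) • vert s) p (hor p A) := by
    have e1 := ((hasDir_const (unit s) p (hor p A)).qsmul (Q.hasDir_grad hs hp A)).hor.add
      (((Q.hasDir_h hs hp (hor p A)).const_smul 2).smul
        (hasDir_const (vert s : QHeis n) p (hor p A)))
    refine (e1.congr Q.isOpen hp fun x hx => Q.reeb_eq hs hpos hx s).congr_deriv ?_
    rw [zero_smul, zero_add, smul_zero, add_zero, smul_eq_mul, rip_grad]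
  rw [covDeriv, hξ.eq] at hc
  have hT : torsion Γ p (Q.ξ s p) (hor p A) = hor p (conn Γ p (Q.ξ s p) A) -
      horDeriv A (Q.ξ s p) - ∑ t, c t • Q.ξ t p + (hor p (unit s • hess h p A) +
        horDeriv (unit s • grad h p) (hor p A) + (2 * rip (grad h p) A) • vert s) := by
    rw [torsion, Q.Γ_hor hs hpos hp hΓ, hc]
    abel
  have hqξ : ∀ t, qcoord (Q.ξ t p) = unit t • grad h p := fun t => by
    rw [Q.reeb_eq hs hpos hp, qcoord_map_add, qcoord_map_smul]; simp
  set y := hip (grad h p) A with hy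
  have hct : ∀ t, c t = 2 * (2 * h p)⁻¹ *
      ((if t = s then y.re else 0) - im t (unit s * y)) := by
    intro t
    have e1 : confForm h t p (torsion Γ p (Q.ξ s p) (hor p A)) = 0 := by
      simp only [horizontal, Submodule.mem_iInf] at hmem
      exact hmem t
    have e2 : confForm h t p (∑ r, c r • Q.ξ r p) = c t := by
      rw [map_sum]
      simp [Q.reeb_dual p hp]
    rw [hT, map_add, map_sub, e2] at e1
    simp only [confForm_apply, map_add, map_sub, map_smul, stdForm_hor, stdForm_horDeriv,
      stdForm_vert, hqξ, qcoord_hor, hip_smul_left, hip_smul_right, smul_eq_mul] at e1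
    have e3 : im t (hip A (grad h p) * star (unit s)) = -im t (unit s * y) := by
      rw [hip_swap A, ← star_mul, im_star]
    rw [e3, ← hy, show rip (grad h p) A = y.re from rfl] at e1
    split_ifs at e1 ⊢ <;> linear_combination -e1
  rw [hT]
  simp only [qcoord_map_add, qcoord_map_sub, qcoord_map_sum, qcoord_map_smul, qcoord_hor,
    qcoord_horDeriv, qcoord_vert, hqξ, hct, smul_zero, add_zero, sub_zero]
  rw [reebBracket, ← hy]
  ext1 i
  simp only [Pi.add_apply, Pi.sub_apply, Pi.neg_apply, Pi.smul_apply, Finset.sum_apply, smul_eq_mul]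
  generalize grad h p i = w
  generalize hess h p A i = x
  generalize (2 * h p)⁻¹ = k
  clear_value y
  fin_cases s <;> ext <;> simp [Fin.sum_univ_three, Quaternion.re_mul, Quaternion.imI_mul,
    Quaternion.imJ_mul, Quaternion.imK_mul] <;> ring

/-- The rescaled standard basis, indexed by `Fin (4 * n)`. -/
def stdFrame (h : QHeis n → ℝ) (p : QHeis n) (a : Fin (4 * n)) : QHeis n :=
  Real.sqrt (2 * h p) • hor p (stdBasis
    (Fintype.equivOfCardEq (α := Fin (4 * n)) (β := Fin n × Fin 4) (by simp [mul_comm]) a))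

theorem isFrame_stdFrame (Q : QCStructure n Ω (confForm h)) (hs : ContDiffOn ℝ ∞ h Ω)
    (hpos : ∀ p ∈ Ω, 0 < h p) {p : QHeis n} (hp : p ∈ Ω)
    : Q.IsFrame p (stdFrame h p) := by
  have h0 := hpos p hp
  refine ⟨fun a => Submodule.smul_mem _ _ (hor_mem p _), fun a b => ?_⟩
  simp only [stdFrame, map_smul, smul_apply, Q.g_hor hs hpos hp, rip_stdBasis,
    smul_eq_mul, EmbeddingLike.apply_eq_iff_eq]
  split_ifs
  · have := Real.mul_self_sqrt (show 0 ≤ 2 * h p by positivity)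
    rw [mul_one, ← mul_assoc, this, mul_inv_cancel₀ (by positivity)]
  · simp

theorem sum_stdFrame (Q : QCStructure n Ω (confForm h)) (hs : ContDiffOn ℝ ∞ h Ω)
    (hpos : ∀ p ∈ Ω, 0 < h p) {p : QHeis n} (hp : p ∈ Ω)
    (K L : (Fin n → ℍ[ℝ]) →ₗ[ℝ] (Fin n → ℍ[ℝ])) (T M : QHeis n → QHeis n)
    (hT : ∀ (r : ℝ) A, T (r • hor p A) = r • hor p (K A))
    (hM : ∀ (r : ℝ) A, M (r • hor p A) = r • hor p (L A)) :
    ∑ a, Q.g p (T (stdFrame h p a)) (M (stdFrame h p a)) =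
      ∑ k, rip (K (stdBasis k)) (L (stdBasis k)) := by
  have h0 := hpos p hp
  rw [← Equiv.sum_comp (Fintype.equivOfCardEq (α := Fin (4 * n)) (β := Fin n × Fin 4)
    (by simp [mul_comm]))]
  refine Finset.sum_congr rfl fun a _ => ?_
  simp only [stdFrame, hT, hM, map_smul, smul_apply, Q.g_hor hs hpos hp, smul_eq_mul]
  have := Real.mul_self_sqrt (show 0 ≤ 2 * h p by positivity)
  rw [← mul_assoc, this, mul_inv_cancel_left₀ (by positivity)]

end QCStructure

namespace QCStructure

variable {Ω : Set (QHeis n)} {h : QHeis n → ℝ}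
variable {Γ : QHeis n → QHeis n →L[ℝ] QHeis n →L[ℝ] QHeis n}

/-- `reebBracket` as a linear map. -/
def reebBracketLin (h : QHeis n → ℝ) (p : QHeis n) (s : Fin 3) :
    (Fin n → ℍ[ℝ]) →ₗ[ℝ] (Fin n → ℍ[ℝ]) where
  toFun := reebBracket h p s
  map_add' A B := by
    simp only [reebBracket, map_add, hip_add_right, add_mul, mul_add, smul_add, add_smul, sub_smul,
      smul_sub]
    abel
  map_smul' c A := by
    simp only [reebBracket, map_smul, hip_rsmul_right, smul_mul_assoc, mul_smul_comm, ← smul_sub,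
      RingHom.id_apply, smul_add, smul_neg, smul_assoc]
    rw [smul_comm (unit s) c, smul_comm ((2 * h p)⁻¹) c]

/-- The element `X ↦ (X, A) eₛ A` of `sp(n)`. -/
def spElement (s : Fin 3) (A : Fin n → ℍ[ℝ]) : (Fin n → ℍ[ℝ]) →ₗ[ℝ] (Fin n → ℍ[ℝ]) where
  toFun X := hip X A • unit s • A
  map_add' X Y := by rw [hip_add_left, add_smul]
  map_smul' c X := by rw [hip_rsmul_left, smul_assoc, RingHom.id_apply]

theorem spElement_apply (s : Fin 3) (A X : Fin n → ℍ[ℝ]) :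
    spElement s A X = hip X A • unit s • A := rfl

theorem isSp_spElement (Q : QCStructure n Ω (confForm h)) (hs : ContDiffOn ℝ ∞ h Ω)
    (hpos : ∀ p ∈ Ω, 0 < h p) {p : QHeis n} (hp : p ∈ Ω)
    (s : Fin 3) (A : Fin n → ℍ[ℝ]) :
    Q.IsSp p (horLin p ∘ₗ spElement s A ∘ₗ qcoordLin).toContinuousLinearMap := by
  have hA : ∀ X, (horLin p ∘ₗ spElement s A ∘ₗ qcoordLin).toContinuousLinearMap (hor p X) =
      hor p (spElement s A X) := fun X => by
    change hor p (spElement s A (qcoord (hor p X))) = _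
    rw [qcoord_hor]
  refine ⟨fun X _ => hor_mem p _, fun X hX Y hY => ?_, fun t X hX => ?_⟩
  · rw [eq_hor_of_mem hpos hp hX, eq_hor_of_mem hpos hp hY, hA, hA, Q.g_hor hs hpos hp,
      Q.g_hor hs hpos hp]
    generalize qcoord X = X'
    generalize qcoord Y = Y'
    rw [spElement_apply, spElement_apply, rip_comm X', smul_smul, smul_smul, rip_smul_left,
      rip_smul_left, hip_swap A X', hip_swap A Y']
    fin_cases s <;> simp [Quaternion.re_mul, Quaternion.imI_mul, Quaternion.imJ_mul,
      Quaternion.imK_mul] <;> ring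
  · rw [eq_hor_of_mem hpos hp hX, hA, Q.I_hor hs hpos hp, Q.I_hor hs hpos hp, hA]
    simp only [spElement_apply, hip_smul_left, smul_smul, mul_assoc]

/-- Orthogonality of the torsion to the sp(n) element `spElement s A` and to I_s allows `conn` to be
replaced by `reebBracket`, which depends on h alone, in both traces of `four_rip_of_normalizer`. -/
theorem four_rip_conn_reeb (Q : QCStructure n Ω (confForm h)) (hs : ContDiffOn ℝ ∞ h Ω)
    (hpos : ∀ p ∈ Ω, 0 < h p) {p : QHeis n} (hp : p ∈ Ω) (hΓ : Q.IsBiquardConnection Γ)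
    (hn : n ≠ 0) (s : Fin 3) (A : Fin n → ℍ[ℝ]) :
    4 * rip (conn Γ p (Q.ξ s p) A) (unit s • A) =
      ∑ t, rip (reebBracket h p s (qbasis t • A)) (qbasis t • unit s • A) +
      rip A A / n * ∑ k, rip (reebBracket h p s (stdBasis k)) (unit s • stdBasis k) := by
  obtain ⟨a, ha⟩ := Q.conn_quaternionic hs hpos hp hΓ (Q.ξ s p)
  have hT : ∀ (r : ℝ) X, torsion Γ p (Q.ξ s p) (r • hor p X) =
      r • hor p ((connLin Γ p (Q.ξ s p) - reebBracketLin h p s) X) := by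
    intro r X
    rw [show torsion Γ p (Q.ξ s p) (r • hor p X) = r • torsion Γ p (Q.ξ s p) (hor p X) by
      simp [torsion, smul_sub], Q.torsion_reeb hs hpos hp hΓ]
    rfl
  have h1 := hΓ.torsion_perp_sp p hp s _ (Q.isFrame_stdFrame hs hpos hp) _
    (Q.isSp_spElement hs hpos hp s A)
  rw [Q.sum_stdFrame hs hpos hp (connLin Γ p (Q.ξ s p) - reebBracketLin h p s) (spElement s A)
    _ _ hT (fun r X => by
      change hor p (spElement s A (qcoord (r • hor p X))) = _
      rw [qcoord_map_smul, qcoord_hor, map_smul, hor_smul])] at h1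
  have h2 := hΓ.torsion_perp_sp_one p hp s _ (Q.isFrame_stdFrame hs hpos hp) s
  rw [Q.sum_stdFrame hs hpos hp (connLin Γ p (Q.ξ s p) - reebBracketLin h p s) (lmul (unit s))
    _ _ hT (fun r X => by rw [map_smul, Q.I_hor hs hpos hp]; rfl)] at h2
  simp only [LinearMap.sub_apply, rip_sub_left, Finset.sum_sub_distrib, sub_eq_zero] at h1 h2
  have h3 := four_rip_of_normalizer hn (connLin Γ p (Q.ξ s p)) a ha s A
  simp only [spElement_apply] at h1
  change 4 * rip (connLin Γ p (Q.ξ s p) A) (unit s • A) = _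
  change ∑ k, rip (connLin Γ p (Q.ξ s p) (stdBasis k)) (unit s • stdBasis k) =
    ∑ k, rip (reebBracketLin h p s (stdBasis k)) (unit s • stdBasis k) at h2
  rw [h3, h1, h2, sum_rip_hip_smul]
  rfl

/-- The sub-Laplacian. -/
def lap (h : QHeis n → ℝ) (p : QHeis n) : ℝ := ∑ k, rip (hess h p (stdBasis k)) (stdBasis k)

theorem sum_re_hip_right (a r : ℍ[ℝ]) (Y Z : Fin n → ℍ[ℝ]) :
    ∑ k, (a * (hip Y (stdBasis k) * r * hip Z (stdBasis k))).re =
      -2 * (a * (hip Y Z * star r)).re := by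
  rw [← re_sum, ← Finset.mul_sum, sum_hip_mul_hip_right, mul_smul_comm]
  rfl

theorem sum_re_hip_left (a r : ℍ[ℝ]) (Y Z : Fin n → ℍ[ℝ]) :
    ∑ k, (a * (hip (stdBasis k) Y * r * hip Z (stdBasis k))).re =
      4 * a.re * (r * hip Z Y).re := by
  rw [← re_sum, ← Finset.mul_sum, sum_hip_mul_hip_left, Quaternion.mul_coe_eq_smul]
  simp; ring

theorem sum_rip_reebBracket (s : Fin 3) (p : QHeis n) :
    ∑ k, rip (reebBracket h p s (stdBasis k)) (unit s • stdBasis k) =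
      4 * (2 * h p)⁻¹ * rip (grad h p) (grad h p) - lap h p := by
  have h1 : ∀ k : Fin n × Fin 4, rip (reebBracket h p s (stdBasis k)) (unit s • stdBasis k) =
      -rip (hess h p (stdBasis k)) (stdBasis k) + (2 * h p)⁻¹ *
        ((star (unit s) * (hip (grad h p) (stdBasis k) * unit s * hip (grad h p) (stdBasis k))).re -
        (1 * (hip (grad h p) (stdBasis k) * 1 * hip (grad h p) (stdBasis k))).re) := by
    intro k
    have e : star (unit s) * unit s = 1 := by
      fin_cases s <;> ext <;>
        simp [Quaternion.re_mul, Quaternion.imI_mul, Quaternion.imJ_mul, Quaternion.imK_mul]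
    rw [reebBracket, rip_add_left, rip_neg_left, rip_rsmul_left, rip_qsmul_qsmul, rip_qsmul_qsmul,
      e, one_smul, mul_sub, ← mul_assoc (star (unit s)) (unit s), e, one_mul, one_mul, mul_one,
      rip_smul_left, sub_mul, Quaternion.re_sub]
    simp only [mul_assoc]
  simp only [h1, Finset.sum_add_distrib, Finset.sum_neg_distrib, ← Finset.mul_sum,
    Finset.sum_sub_distrib, sum_re_hip_right, lap, hip_self]
  fin_cases s <;> simp [Quaternion.re_mul, Quaternion.imI_mul, Quaternion.imJ_mul,
    Quaternion.imK_mul] <;> ring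

theorem sum_rip_reebBracket_qbasis (s : Fin 3) (p : QHeis n) (A : Fin n → ℍ[ℝ]) :
    ∑ t, rip (reebBracket h p s (qbasis t • A)) (qbasis t • unit s • A) =
      -(rip (hess h p A) A) + ∑ t, rip (hess h p (unit t • A)) (unit t • A) -
        2 * rip (hess h p (unit s • A)) (unit s • A) +
      4 * (2 * h p)⁻¹ * (Quaternion.normSq (hip (grad h p) A) - 2 * (hip (grad h p) A).re ^ 2 -
        2 * im s (hip (grad h p) A) ^ 2) := by
  have hH : ∀ t, rip (reebBracket h p s (qbasis t • A)) (qbasis t • unit s • A) =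
      -rip (hess h p (qbasis t • A)) ((star (unit s) * qbasis t * unit s) • A) +
      (2 * h p)⁻¹ * ((hip (grad h p) A * star (qbasis t) * unit s -
        unit s * (hip (grad h p) A * star (qbasis t))) * (hip (grad h p) A *
          star (qbasis t * unit s))).re := by
    intro t
    have e : ∀ X Z : Fin n → ℍ[ℝ], rip (unit s • X) Z = rip X (star (unit s) • Z) := fun X Z => by
      rw [rip_smul_right, star_star]
    rw [reebBracket, rip_add_left, rip_neg_left, rip_rsmul_left, e, smul_smul, smul_smul,
      rip_smul_left (grad h p), hip_smul_right, hip_smul_right, hip_smul_right, star_mul,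
      mul_assoc (star (unit s)), mul_assoc (hip (grad h p) A) (star (unit s))]
  simp only [hH, Finset.sum_add_distrib, Finset.sum_neg_distrib, ← Finset.mul_sum]
  congr 1
  -- Conjugation by e_s fixes 1 and e_s and negates the other two units.
  · have hc : ∀ t : Fin 4, star (unit s) * qbasis t * unit s =
        (if t = 0 ∨ t = s.succ then (1 : ℝ) else -1) • qbasis t := by
      intro t
      fin_cases t <;> fin_cases s <;> ext <;>
        simp [Quaternion.re_mul, Quaternion.imI_mul, Quaternion.imJ_mul, Quaternion.imK_mul,
          Fin.ext_iff]
    simp only [hc, smul_assoc, rip_rsmul_right]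
    rw [Fin.sum_univ_succ]
    simp only [true_or, if_true, Fin.succ_ne_zero, false_or, Fin.succ_inj, qbasis_succ]
    fin_cases s <;> simp [Fin.sum_univ_three] <;> ring
  · rw [mul_comm 4, mul_assoc]
    congr 1
    generalize hip (grad h p) A = y
    rw [Quaternion.normSq_def']
    fin_cases s <;> simp [Fin.sum_univ_four, Quaternion.re_mul, Quaternion.imI_mul,
      Quaternion.imJ_mul, Quaternion.imK_mul] <;> ring

theorem sum_rip_conn_reeb (Q : QCStructure n Ω (confForm h)) (hs : ContDiffOn ℝ ∞ h Ω)
    (hpos : ∀ p ∈ Ω, 0 < h p) {p : QHeis n} (hp : p ∈ Ω) (hΓ : Q.IsBiquardConnection Γ)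
    (hn : n ≠ 0) (A : Fin n → ℍ[ℝ]) :
    4 * ∑ s, rip (conn Γ p (Q.ξ s p) A) (unit s • A) =
      -3 * rip (hess h p A) A + ∑ t, rip (hess h p (unit t • A)) (unit t • A) +
      4 * (2 * h p)⁻¹ * (Quaternion.normSq (hip (grad h p) A) - 4 * (hip (grad h p) A).re ^ 2) +
      3 * rip A A / n * (4 * (2 * h p)⁻¹ * rip (grad h p) (grad h p) - lap h p) := by
  rw [Finset.mul_sum]
  simp only [Q.four_rip_conn_reeb hs hpos hp hΓ hn, sum_rip_reebBracket_qbasis,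
    sum_rip_reebBracket]
  rw [Quaternion.normSq_def']
  simp only [Fin.sum_univ_three, im_zero, im_one, im_two]
  ring

end QCStructure

/-! ### Curvature in the left-invariant frame -/

/-- The horizontal part of the Biquard connection form, for `w = ∇h / (2 h)`. -/
def connForm (w A B : Fin n → ℍ[ℝ]) : Fin n → ℍ[ℝ] :=
  hip B A • w - hip B w • A - hip A w • B

/-- `w = ∇h / (2 h)`. -/
def wgrad (h : QHeis n → ℝ) (p : QHeis n) : Fin n → ℍ[ℝ] := (2 * h p)⁻¹ • grad h p

namespace QCStructure

variable {Ω : Set (QHeis n)} {h : QHeis n → ℝ}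
variable {Γ : QHeis n → QHeis n →L[ℝ] QHeis n →L[ℝ] QHeis n}

/-- The derivative of `wgrad h` in the left-invariant frame. -/
def wderiv (h : QHeis n → ℝ) (p : QHeis n) : (Fin n → ℍ[ℝ]) →ₗ[ℝ] (Fin n → ℍ[ℝ]) where
  toFun A := (2 * h p)⁻¹ • hess h p A - (2 * rip (wgrad h p) A) • wgrad h p
  map_add' A B := by simp only [map_add, rip_add_right, smul_add, mul_add, add_smul]; abel
  map_smul' c A := by
    simp only [map_smul, rip_rsmul_right, RingHom.id_apply, smul_sub, smul_smul]
    congr 2 <;> ring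

theorem wderiv_apply (h : QHeis n → ℝ) (p : QHeis n) (A : Fin n → ℍ[ℝ]) :
    wderiv h p A = (2 * h p)⁻¹ • hess h p A - (2 * rip (wgrad h p) A) • wgrad h p := rfl

theorem hasDir_wgrad (Q : QCStructure n Ω (confForm h)) (hs : ContDiffOn ℝ ∞ h Ω)
    (hpos : ∀ p ∈ Ω, 0 < h p) {p : QHeis n} (hp : p ∈ Ω)
    (A : Fin n → ℍ[ℝ]) : HasDir (wgrad h) (wderiv h p A) p (hor p A) := by
  refine ((hasDir_inv_two_mul (hpos p hp).ne' (Q.hasDir_h hs hp (hor p A))).smul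
    (Q.hasDir_grad hs hp A)).congr_deriv ?_
  rw [wderiv_apply, wgrad, rip_rsmul_left, rip_grad, smul_smul, sub_eq_add_neg, ← neg_smul,
    add_comm]
  congr 2
  ring

theorem conn_hor_eq (Q : QCStructure n Ω (confForm h)) (hs : ContDiffOn ℝ ∞ h Ω)
    (hpos : ∀ p ∈ Ω, 0 < h p) {p : QHeis n} (hp : p ∈ Ω) (hΓ : Q.IsBiquardConnection Γ)
    (A B : Fin n → ℍ[ℝ]) :
    conn Γ p (hor p A) B = connForm (wgrad h p) A B := by
  rw [Q.conn_hor hs hpos hp hΓ, connForm, wgrad, hip_rsmul_right, hip_rsmul_right, smul_sub,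
    smul_sub, smul_assoc, smul_assoc, smul_comm (hip B A)]

theorem HasDir.connForm {w : QHeis n → Fin n → ℍ[ℝ]} {w' : Fin n → ℍ[ℝ]} {p v : QHeis n}
    (hw : HasDir w w' p v) (A B : Fin n → ℍ[ℝ]) :
    HasDir (fun x => QC.connForm (w x) A B) (QC.connForm w' A B) p v := by
  have hA := hasDir_const A p v
  have hB := hasDir_const B p v
  refine ((((hB.hip hA).qsmul hw).sub ((hB.hip hw).qsmul hA)).sub
    ((hA.hip hw).qsmul hB)).congr_deriv ?_
  simp [QC.connForm]

/-- The curvature `R(b, A)B` in the left-invariant frame. -/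
def frameCurv (h : QHeis n → ℝ) (Γ : QHeis n → QHeis n →L[ℝ] QHeis n →L[ℝ] QHeis n)
    (p : QHeis n) (b A B : Fin n → ℍ[ℝ]) : Fin n → ℍ[ℝ] :=
  connForm (wderiv h p b) A B - connForm (wderiv h p A) b B +
    connForm (wgrad h p) b (connForm (wgrad h p) A B) -
    connForm (wgrad h p) A (connForm (wgrad h p) b B) +
    ∑ s, (2 * im s (hip A b)) • conn Γ p (vert s) B

theorem hasDir_Γ (Q : QCStructure n Ω (confForm h)) {p : QHeis n} (hp : p ∈ Ω)
    (hΓ : Q.IsBiquardConnection Γ) (v B C : QHeis n) :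
    HasDir (fun x => Γ x B C) (fderiv ℝ Γ p v B C) p v := by
  have := ((HasDir.of_differentiableAt ((hΓ.contDiffOn.contDiffAt
    (Q.mem_nhds hp)).differentiableAt (by simp)) v).clm_apply (hasDir_const B p v)).clm_apply
      (hasDir_const C p v)
  simpa using this

/-- Differentiate the formula for Γ on left-invariant fields along `hor · b`. Its correction term
`horDeriv B (hor x A)` does not depend on x; the product rule for the moving arguments gives the
last two terms. -/
theorem fderiv_Γ_hor (Q : QCStructure n Ω (confForm h)) (hs : ContDiffOn ℝ ∞ h Ω)
    (hpos : ∀ p ∈ Ω, 0 < h p) {p : QHeis n} (hp : p ∈ Ω) (hΓ : Q.IsBiquardConnection Γ)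
    (b A B : Fin n → ℍ[ℝ]) :
    fderiv ℝ Γ p (hor p b) (hor p A) (hor p B) = hor p (connForm (wderiv h p b) A B) +
      horDeriv (connForm (wgrad h p) A B) (hor p b) - Γ p (horDeriv A (hor p b)) (hor p B) -
      Γ p (hor p A) (horDeriv B (hor p b)) := by
  have h1 := ((HasDir.of_differentiableAt ((hΓ.contDiffOn.contDiffAt
    (Q.mem_nhds hp)).differentiableAt (by simp)) (hor p b)).clm_apply
      (hasDir_hor A p (hor p b))).clm_apply (hasDir_hor B p (hor p b))
  have h2 := (HasDir.connForm (Q.hasDir_wgrad hs hpos hp b) A B).hor.sub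
    (hasDir_const (horDeriv B (hor p A)) p (hor p b))
  have h3 := h1.unique h2 Q.isOpen hp fun x hx => by
    rw [Q.Γ_hor hs hpos hx hΓ, Q.conn_hor_eq hs hpos hx hΓ]
    simp only [horDeriv, qcoord_hor]
  rw [sub_zero] at h3
  rw [← h3]
  simp only [add_apply]
  abel

theorem horDeriv_hor_sub (p : QHeis n) (A b : Fin n → ℍ[ℝ]) :
    horDeriv A (hor p b) - horDeriv b (hor p A) = -∑ s, (2 * im s (hip A b)) • vert s := by
  rw [horDeriv_eq_sum, horDeriv_eq_sum, qcoord_hor, qcoord_hor]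
  simp only [im_hip_comm _ b A, neg_smul, Finset.sum_neg_distrib, mul_smul, ← Finset.smul_sum]
  rw [two_smul]
  abel

theorem Γ_vert (Q : QCStructure n Ω (confForm h)) (hs : ContDiffOn ℝ ∞ h Ω)
    (hpos : ∀ p ∈ Ω, 0 < h p) {p : QHeis n} (hp : p ∈ Ω) (hΓ : Q.IsBiquardConnection Γ)
    (s : Fin 3) (B : Fin n → ℍ[ℝ]) :
    Γ p (vert s) (hor p B) = hor p (conn Γ p (vert s) B) := by
  rw [Q.Γ_hor hs hpos hp hΓ, horDeriv_vert, sub_zero]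

/-- Most `horDeriv` corrections, due to computing with constant instead of left-invariant fields,
cancel. What remains is the bracket of `hor · b` and `hor · A`, which is vertical and accounts for
the `vert s` terms of `frameCurv`. -/
theorem curvature_hor (Q : QCStructure n Ω (confForm h)) (hs : ContDiffOn ℝ ∞ h Ω)
    (hpos : ∀ p ∈ Ω, 0 < h p) {p : QHeis n} (hp : p ∈ Ω) (hΓ : Q.IsBiquardConnection Γ)
    (b A B : Fin n → ℍ[ℝ]) :
    curvature Γ p (hor p b) (hor p A) (hor p B) = hor p (frameCurv h Γ p b A B) := by
  have hc : ∀ X Y : Fin n → ℍ[ℝ], Γ p (hor p X) (hor p Y) =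
      hor p (connForm (wgrad h p) X Y) - horDeriv Y (hor p X) := fun X Y => by
    rw [Q.Γ_hor hs hpos hp hΓ, Q.conn_hor_eq hs hpos hp hΓ]
  have hz : Γ p (horDeriv A (hor p b)) (hor p B) - Γ p (horDeriv b (hor p A)) (hor p B) =
      -hor p (∑ s, (2 * im s (hip A b)) • conn Γ p (vert s) B) := by
    rw [← sub_apply, ← map_sub, horDeriv_hor_sub, map_neg, map_sum, hor_sum]
    simp only [neg_apply, sum_apply, map_smul, smul_apply, Q.Γ_vert hs hpos hp hΓ, hor_smul]
  rw [curvature, covDeriv, covDeriv, (Q.hasDir_Γ hp hΓ _ _ _).eq,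
    (Q.hasDir_Γ hp hΓ _ _ _).eq, Q.fderiv_Γ_hor hs hpos hp hΓ,
    Q.fderiv_Γ_hor hs hpos hp hΓ, hc A B, hc b B, map_sub, map_sub, hc, hc, frameCurv]
  simp only [hor_add, hor_sub]
  rw [sub_eq_iff_eq_add] at hz
  rw [hz]
  abel

/-- `frameCurv` is linear in its first argument. -/
def frameCurvLin (h : QHeis n → ℝ) (Γ : QHeis n → QHeis n →L[ℝ] QHeis n →L[ℝ] QHeis n)
    (p : QHeis n) (A B : Fin n → ℍ[ℝ]) : (Fin n → ℍ[ℝ]) →ₗ[ℝ] (Fin n → ℍ[ℝ]) where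
  toFun b := frameCurv h Γ p b A B
  map_add' b c := by
    simp only [frameCurv, connForm, map_add, hip_add_left, hip_add_right, hip_sub_left,
      hip_smul_left, im_add, mul_add, add_smul, smul_add, smul_sub, sub_smul,
      Finset.sum_add_distrib]
    abel
  map_smul' r b := by
    have e : ∀ (a : ℍ[ℝ]) (X : Fin n → ℍ[ℝ]), a • r • X = r • a • X := fun a X => smul_comm a r X
    have e' : ∀ s, 2 * (r * im s (hip A b)) = r * (2 * im s (hip A b)) := fun s => by ring
    simp only [frameCurv, connForm, map_smul, hip_rsmul_left, hip_rsmul_right, hip_sub_left,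
      hip_smul_left, im_smul, smul_assoc, smul_add, smul_sub, sub_smul, e, e',
      RingHom.id_apply, Finset.smul_sum, mul_smul r]

/-- In coordinates a g-orthonormal frame has squared length 2h, and this factor cancels the 1/2h of
the metric. -/
theorem ricci_eq_sum (Q : QCStructure n Ω (confForm h)) (hs : ContDiffOn ℝ ∞ h Ω)
    (hpos : ∀ p ∈ Ω, 0 < h p) {p : QHeis n} (hp : p ∈ Ω) (hΓ : Q.IsBiquardConnection Γ)
    {e : Fin (4 * n) → QHeis n} (he : Q.IsFrame p e) (A B : Fin n → ℍ[ℝ]) :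
    Q.ricci Γ p e (hor p A) (hor p B) =
      ∑ k, rip (frameCurv h Γ p (stdBasis k) A B) (stdBasis k) := by
  have h0 := hpos p hp
  have hε : ∀ a, e a = hor p (qcoord (e a)) := fun a => eq_hor_of_mem hpos hp (he.1 a)
  have hort : ∀ a b, rip (qcoord (e a)) (qcoord (e b)) = if a = b then 2 * h p else 0 := by
    intro a b
    have h1 := he.2 a b
    rw [hε a, hε b, Q.g_hor hs hpos hp] at h1
    rw [← mul_inv_cancel_left₀ (show 2 * h p ≠ 0 by positivity) (rip _ _), h1]
    split_ifs <;> simp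
  have h2 := sum_orthogonal (by simp) (by positivity) (fun a => qcoord (e a)) hort
    (ripBilin (frameCurvLin h Γ p A B) LinearMap.id)
  change ∑ a, rip (frameCurv h Γ p (qcoord (e a)) A B) (qcoord (e a)) = 2 * h p *
    ∑ k, rip (frameCurv h Γ p (stdBasis k) A B) (stdBasis k) at h2
  have h3 : ∀ a, Q.g p (curvature Γ p (e a) (hor p A) (hor p B)) (e a) =
      (2 * h p)⁻¹ * rip (frameCurv h Γ p (qcoord (e a)) A B) (qcoord (e a)) := fun a => by
    conv_lhs => rw [hε a, Q.curvature_hor hs hpos hp hΓ, Q.g_hor hs hpos hp]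
  rw [ricci]
  simp only [h3]
  rw [← Finset.mul_sum, h2, inv_mul_cancel_left₀ (by positivity)]

end QCStructure

namespace QCStructure

variable {Ω : Set (QHeis n)} {h : QHeis n → ℝ}
variable {Γ : QHeis n → QHeis n →L[ℝ] QHeis n →L[ℝ] QHeis n}

/-! ### The trace of the curvature -/

/-- Expanding (A, K b) in the units gives the pairings of K(e_t A) with e_t* A; conjugation produces
the minus sign on the three imaginary units. -/
theorem sum_rip_star_hip_smul (K : (Fin n → ℍ[ℝ]) →ₗ[ℝ] (Fin n → ℍ[ℝ])) (A : Fin n → ℍ[ℝ]) :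
    ∑ k, rip (hip A (K (stdBasis k)) • A) (stdBasis k) =
      rip (K A) A - ∑ s, rip (K (unit s • A)) (unit s • A) := by
  have h1 : ∀ k : Fin n × Fin 4, rip (hip A (K (stdBasis k)) • A) (stdBasis k) =
      ∑ t, rip (qbasis t • A) (stdBasis k) * rip (K (stdBasis k)) (star (qbasis t) • A) := by
    intro k
    rw [rip_smul_left, re_mul_comm, ← rip_smul_left, hip_swap A, hip_eq_sum, star_sum,
      Finset.sum_smul, rip_sum_left]
    refine Finset.sum_congr rfl fun t _ => ?_
    rw [Quaternion.coe_mul_eq_smul, rip_comm (_ • A) (stdBasis k), rip_comm (K _), ← rip_rsmul_left,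
      ← smul_assoc]
    congr 2
    ext <;> simp
  simp only [h1]
  rw [Finset.sum_comm]
  have h2 : ∀ t, ∑ k, rip (qbasis t • A) (stdBasis k) * rip (K (stdBasis k)) (star (qbasis t) • A) =
      rip (K (qbasis t • A)) (star (qbasis t) • A) := fun t => by
    have := congrArg (fun V => rip V (star (qbasis t) • A)) (sum_rip_stdBasis_smul K (qbasis t • A))
    simpa only [rip_sum_left, rip_rsmul_left] using this
  simp only [h2]
  rw [Fin.sum_univ_succ]
  have h3 : ∀ s, star (unit s) = -unit s := fun s => by fin_cases s <;> ext <;> simp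
  simp only [qbasis_succ, h3, neg_smul, rip_neg_right, Finset.sum_neg_distrib, qbasis_zero, star_one,
    one_smul]
  ring

theorem sum_rip_connForm_wderiv_left (K : (Fin n → ℍ[ℝ]) →ₗ[ℝ] (Fin n → ℍ[ℝ]))
    (A : Fin n → ℍ[ℝ]) :
    ∑ k, rip (connForm (K (stdBasis k)) A A) (stdBasis k) =
      rip A A * ∑ k, rip (K (stdBasis k)) (stdBasis k) -
        2 * (rip (K A) A - ∑ s, rip (K (unit s • A)) (unit s • A)) := by
  simp only [connForm, rip_sub_left, Finset.sum_sub_distrib, sum_rip_star_hip_smul]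
  rw [Finset.mul_sum]
  have : ∀ k : Fin n × Fin 4, rip (hip A A • K (stdBasis k)) (stdBasis k) =
      rip A A * rip (K (stdBasis k)) (stdBasis k) := fun k => by
    rw [rip_smul_left, hip_self, Quaternion.coe_mul_eq_smul]
    rfl
  simp only [this]
  ring

/-- The trace of `b ↦ Λ_b Y`. -/
theorem sum_rip_connForm (w Y : Fin n → ℍ[ℝ]) :
    ∑ k, rip (connForm w (stdBasis k) Y) (stdBasis k) = -(4 * n + 6) * rip Y w := by
  simp only [connForm, rip_sub_left, Finset.sum_sub_distrib, rip_smul_left]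
  have h1 := sum_re_hip_right 1 1 Y w
  have h2 := sum_re_hip_left 1 1 w Y
  have h3 : ∑ k : Fin n × Fin 4, (hip Y w * hip (stdBasis k) (stdBasis k)).re =
      rip Y w * (4 * n) := by
    rw [← sum_rip_stdBasis_self, Finset.mul_sum]
    refine Finset.sum_congr rfl fun k _ => ?_
    rw [hip_self, Quaternion.mul_coe_eq_smul]
    simp [rip]
    ring
  simp only [one_mul, mul_one, star_one, Quaternion.re_one] at h1 h2
  rw [h1, h2, h3]
  simp only [rip]
  ring

/-- The trace of `b ↦ Λ_A Λ_b A`. -/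
theorem sum_rip_connForm_connForm (w A : Fin n → ℍ[ℝ]) :
    ∑ k, rip (connForm w A (connForm w (stdBasis k) A)) (stdBasis k) =
      (4 * n + 4) * (hip A w * hip A w).re - 2 * rip A A * rip w w + 4 * rip A w ^ 2 := by
  have h1 := sum_re_hip_right 1 (hip w A) A w
  have h2 := sum_re_hip_left (hip A w) 1 A w
  have h3 := sum_re_hip_left 1 (hip A A) w w
  have h4 := sum_re_hip_right 1 (hip w w) A A
  have h5 := sum_re_hip_left (hip A w) 1 w A
  have h6 := sum_re_hip_left 1 (hip A w) w A
  have h7 := sum_re_hip_right (hip A w) 1 A w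
  have h8 : ∑ k : Fin n × Fin 4, (hip A w * (hip A w * hip (stdBasis k) (stdBasis k))).re =
      (hip A w * hip A w).re * (4 * n) := by
    rw [← sum_rip_stdBasis_self, Finset.mul_sum]
    refine Finset.sum_congr rfl fun k _ => ?_
    rw [hip_self, Quaternion.mul_coe_eq_smul, mul_smul_comm, Quaternion.re_smul, smul_eq_mul,
      mul_comm]
  simp only [one_mul, mul_one, star_one, Quaternion.re_one, mul_assoc] at h1 h2 h3 h4 h5 h6 h7
  simp only [connForm, rip_sub_left, Finset.sum_sub_distrib, rip_smul_left, hip_sub_left,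
    hip_smul_left, sub_mul, mul_sub, Quaternion.re_sub, mul_assoc]
  rw [h1, h2, h3, h4, h5, h6, h7, h8, star_hip, star_hip, hip_self, hip_self,
    ← Quaternion.coe_mul, Quaternion.re_coe, show (hip w A).re = (hip A w).re from rip_comm w A,
    show rip A w = (hip A w).re from rfl]
  ring

theorem sum_im_hip_smul (A : Fin n → ℍ[ℝ]) (c : Fin 3 → Fin n → ℍ[ℝ]) :
    ∑ k, rip (∑ s, (2 * im s (hip A (stdBasis k))) • c s) (stdBasis k) =
      -2 * ∑ s, rip (c s) (unit s • A) := by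
  simp only [rip_sum_left, rip_rsmul_left]
  rw [Finset.sum_comm, Finset.mul_sum]
  refine Finset.sum_congr rfl fun s _ => ?_
  rw [rip_comm, ← sum_rip_mul_rip (unit s • A) (c s), Finset.mul_sum]
  refine Finset.sum_congr rfl fun k _ => ?_
  rw [rip_unit_left]
  ring

/-- `∑ₛ ⟨Λ_{eₛ w} A, eₛ A⟩`. -/
theorem sum_rip_connForm_unit (w A : Fin n → ℍ[ℝ]) :
    ∑ s, rip (connForm w (unit s • w) A) (unit s • A) =
      -8 * rip A w ^ 2 + 2 * Quaternion.normSq (hip A w) - 3 * rip w w * rip A A := by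
  have h1 : ∀ s, rip (connForm w (unit s • w) A) (unit s • A) =
      ((hip A w * star (unit s)) * (star (hip A w) * star (unit s))).re -
      (hip A w * (unit s * (star (hip A w) * star (unit s)))).re - rip w w * rip A A := by
    intro s
    have e : ((unit s * (rip w w : ℍ[ℝ])) * ((rip A A : ℍ[ℝ]) * star (unit s))).re =
        rip w w * rip A A := by
      fin_cases s <;> simp [Quaternion.re_mul, Quaternion.imI_mul, Quaternion.imJ_mul,
        Quaternion.imK_mul]
    rw [connForm, rip_sub_left, rip_sub_left, rip_smul_left, rip_smul_left, rip_smul_left,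
      hip_smul_right, hip_smul_right, hip_smul_left, hip_smul_left, hip_self, hip_smul_right,
      hip_smul_right, hip_self, e, hip_swap w A]
  simp only [h1, rip_comm A w, rip_eq_re w A]
  generalize hip A w = x
  rw [Quaternion.normSq_def']
  simp [Fin.sum_univ_three, Quaternion.re_mul, Quaternion.imI_mul, Quaternion.imJ_mul,
    Quaternion.imK_mul]
  ring

/-- `vert s` is ξ_s/2h minus its horizontal part, along which the connection is already known. -/
theorem conn_vert (Q : QCStructure n Ω (confForm h)) (hs : ContDiffOn ℝ ∞ h Ω)
    (hpos : ∀ p ∈ Ω, 0 < h p) {p : QHeis n} (hp : p ∈ Ω) (hΓ : Q.IsBiquardConnection Γ)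
    (s : Fin 3) (A : Fin n → ℍ[ℝ]) :
    conn Γ p (vert s) A = (2 * h p)⁻¹ • conn Γ p (Q.ξ s p) A -
      connForm (wgrad h p) (unit s • wgrad h p) A := by
  have h0 := hpos p hp
  have hv : (vert s : QHeis n) = (2 * h p)⁻¹ • Q.ξ s p - hor p (unit s • wgrad h p) := by
    rw [Q.reeb_eq hs hpos hp, wgrad, smul_comm (unit s), hor_smul, smul_add,
      inv_smul_smul₀ (by positivity)]
    abel
  rw [← Q.conn_hor_eq hs hpos hp hΓ, conn, hv]
  simp only [map_sub, sub_apply, map_smul, smul_apply, qcoord_map_sub, qcoord_map_smul, conn]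

/-- The trace of the `vert s` term over b pairs the connection with e_s A only, so
`sum_rip_conn_reeb` supplies all that is needed of the vertical connection. The diagonal suffices,
since the Einstein condition is used as an identity of quadratic forms. -/
theorem ricci_hor (Q : QCStructure n Ω (confForm h)) (hs : ContDiffOn ℝ ∞ h Ω)
    (hpos : ∀ p ∈ Ω, 0 < h p) {p : QHeis n} (hp : p ∈ Ω) (hΓ : Q.IsBiquardConnection Γ)
    (hn : n ≠ 0) {e : Fin (4 * n) → QHeis n} (he : Q.IsFrame p e)
    (A : Fin n → ℍ[ℝ]) :
    Q.ricci Γ p e (hor p A) (hor p A) =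
      (2 * h p)⁻¹ * ((4 * n + 11 / 2) * rip (hess h p A) A +
        3 / 2 * ∑ s, rip (hess h p (unit s • A)) (unit s • A)) -
      (4 * n + 10) * (2 * h p)⁻¹ ^ 2 * Quaternion.normSq (hip A (grad h p)) +
      rip A A * ((2 * h p)⁻¹ * (1 + 3 / (2 * n)) * lap h p -
        (4 * n + 12 + 6 / n) * (2 * h p)⁻¹ ^ 2 * rip (grad h p) (grad h p)) := by
  have hn' : (n : ℝ) ≠ 0 := by exact_mod_cast hn
  have hvert := sum_im_hip_smul A (fun s => conn Γ p (vert s) A)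
  have hreeb := Q.sum_rip_conn_reeb hs hpos hp hΓ hn A
  have hunit := sum_rip_connForm_unit (wgrad h p) A
  have hKA : ∑ k, rip (connForm (wderiv h p A) (stdBasis k) A) (stdBasis k) =
      -(4 * n + 6) * rip A (wderiv h p A) := sum_rip_connForm _ _
  rw [Q.ricci_eq_sum hs hpos hp hΓ he]
  simp only [frameCurv, rip_add_left, rip_sub_left, Finset.sum_add_distrib,
    Finset.sum_sub_distrib]
  rw [sum_rip_connForm_wderiv_left, hKA, sum_rip_connForm, sum_rip_connForm_connForm, hvert]
  simp only [Q.conn_vert hs hpos hp hΓ, rip_sub_left, rip_rsmul_left, Finset.sum_sub_distrib,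
    ← Finset.mul_sum]
  rw [hunit]
  have hY : rip (connForm (wgrad h p) A A) (wgrad h p) =
      rip A A * rip (wgrad h p) (wgrad h p) -
        2 * (hip A (wgrad h p) * hip A (wgrad h p)).re := by
    rw [connForm, rip_sub_left, rip_sub_left, rip_smul_left, rip_smul_left, hip_self, hip_self,
      ← Quaternion.coe_mul, Quaternion.re_coe]
    ring
  have htr : ∑ k, rip (wderiv h p (stdBasis k)) (stdBasis k) =
      (2 * h p)⁻¹ * lap h p - 2 * rip (wgrad h p) (wgrad h p) := by
    simp only [wderiv_apply, rip_sub_left, rip_rsmul_left, Finset.sum_sub_distrib, mul_assoc,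
      ← Finset.mul_sum, sum_rip_mul_rip, lap]
  have hκ : ∀ B, rip (wderiv h p B) B = (2 * h p)⁻¹ * rip (hess h p B) B -
      2 * rip (wgrad h p) B ^ 2 := fun B => by
    rw [wderiv_apply, rip_sub_left, rip_rsmul_left, rip_rsmul_left]; ring
  have hκs : ∑ s, rip (wgrad h p) (unit s • A) ^ 2 =
      Quaternion.normSq (hip A (wgrad h p)) - rip A (wgrad h p) ^ 2 := by
    simp only [rip_unit_right, im_hip_comm _ (wgrad h p) A]
    rw [Quaternion.normSq_def', rip]
    simp [Fin.sum_univ_three]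
    ring
  rw [hY, htr, rip_comm A (wderiv h p A)]
  simp only [hκ, Finset.sum_sub_distrib, ← Finset.mul_sum, hκs]
  rw [rip_comm (wgrad h p) A]
  have hre : (hip A (wgrad h p) * hip A (wgrad h p)).re =
      2 * rip A (wgrad h p) ^ 2 - Quaternion.normSq (hip A (wgrad h p)) := by
    rw [Quaternion.normSq_def', rip, Quaternion.re_mul]; ring
  rw [hre]
  have hw : hip A (wgrad h p) = (2 * h p)⁻¹ • hip A (grad h p) := hip_rsmul_right _ _ _
  have hw' : rip A (wgrad h p) = (2 * h p)⁻¹ * rip A (grad h p) := rip_rsmul_right _ _ _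
  have hww : rip (wgrad h p) (wgrad h p) = (2 * h p)⁻¹ ^ 2 * rip (grad h p) (grad h p) := by
    rw [wgrad, rip_rsmul_left, rip_rsmul_right]; ring
  rw [hw, hw', hww, Quaternion.normSq_smul]
  rw [hip_swap (grad h p) A, Quaternion.normSq_star, Quaternion.re_star,
    show (hip A (grad h p)).re = rip A (grad h p) from rfl] at hreeb
  have hreeb' : ∑ s, rip (conn Γ p (Q.ξ s p) A) (unit s • A) =
      (-3 * rip (hess h p A) A + ∑ t, rip (hess h p (unit t • A)) (unit t • A) +
      4 * (2 * h p)⁻¹ * (Quaternion.normSq (hip A (grad h p)) - 4 * rip A (grad h p) ^ 2) +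
      3 * rip A A / n * (4 * (2 * h p)⁻¹ * rip (grad h p) (grad h p) - lap h p)) / 4 := by
    linear_combination hreeb / 4
  rw [hreeb']
  generalize (2 * h p)⁻¹ = k
  field_simp
  ring

end QCStructure

/-! ### The qc-Einstein condition as an equation for the Hessian -/

/-- A quadratic form with `α Q(A) + β ∑ₛ Q(eₛ A)` invariant under `i, j, k` is itself invariant. -/
theorem quadratic_invariant {H N : (Fin n → ℍ[ℝ]) → ℝ} (hneg : ∀ A, H (-A) = H A)
    (hN : ∀ t A, N (unit t • A) = N A) {α β : ℝ} (hα : α ≠ β)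
    (hH : ∀ A, α * H A + β * ∑ s, H (unit s • A) = N A) (t : Fin 3) (A : Fin n → ℍ[ℝ]) :
    H (unit t • A) = H A := by
  have e01 : unit 0 * unit 1 = unit 2 := by
    ext <;> simp [Quaternion.re_mul, Quaternion.imI_mul, Quaternion.imJ_mul, Quaternion.imK_mul]
  have e10 : unit 1 * unit 0 = -unit 2 := by
    ext <;> simp [Quaternion.re_mul, Quaternion.imI_mul, Quaternion.imJ_mul, Quaternion.imK_mul]
  have e12 : unit 1 * unit 2 = unit 0 := by
    ext <;> simp [Quaternion.re_mul, Quaternion.imI_mul, Quaternion.imJ_mul, Quaternion.imK_mul]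
  have e21 : unit 2 * unit 1 = -unit 0 := by
    ext <;> simp [Quaternion.re_mul, Quaternion.imI_mul, Quaternion.imJ_mul, Quaternion.imK_mul]
  have e20 : unit 2 * unit 0 = unit 1 := by
    ext <;> simp [Quaternion.re_mul, Quaternion.imI_mul, Quaternion.imJ_mul, Quaternion.imK_mul]
  have e02 : unit 0 * unit 2 = -unit 1 := by
    ext <;> simp [Quaternion.re_mul, Quaternion.imI_mul, Quaternion.imJ_mul, Quaternion.imK_mul]
  -- Multiplication by e_t permutes A, e_0 A, e_1 A, e_2 A up to signs, which H ignores.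
  have key : ∑ s, H (unit s • unit t • A) + H (unit t • A) = ∑ s, H (unit s • A) + H A := by
    simp only [Fin.sum_univ_three, smul_smul]
    fin_cases t
    · simp [e10, e20, QCStructure.unit_mul_self, neg_smul, hneg]; ring
    · simp [e01, e21, QCStructure.unit_mul_self, neg_smul, hneg]; ring
    · simp [e02, e12, QCStructure.unit_mul_self, neg_smul, hneg]; ring
  have h1 := hH (unit t • A)
  rw [hN, ← hH A] at h1
  have h2 : (α - β) * (H (unit t • A) - H A) = 0 := by linear_combination h1 - β * key
  linarith [(mul_eq_zero.1 h2).resolve_left (sub_ne_zero.2 hα)]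

theorem sum_normSq_hip (u : Fin n → ℍ[ℝ]) :
    ∑ k, Quaternion.normSq (hip (stdBasis k) u) = 4 * rip u u := by
  have := QCStructure.sum_re_hip_left 1 1 u u
  simp only [one_mul, mul_one, Quaternion.re_one] at this
  rw [show rip u u = (hip u u).re from rfl, ← this]
  refine Finset.sum_congr rfl fun k _ => ?_
  rw [normSq_eq_re, star_hip]

namespace QCStructure

variable {Ω : Set (QHeis n)} {h : QHeis n → ℝ}
variable {Γ : QHeis n → QHeis n →L[ℝ] QHeis n →L[ℝ] QHeis n}

/-- The trace part of the horizontal Hessian of `h`. -/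
def hessTrace (h : QHeis n → ℝ) (p : QHeis n) : ℝ :=
  (lap h p - 4 * (2 * h p)⁻¹ * rip (grad h p) (grad h p)) / (4 * n)

theorem sum_hess_unit (p : QHeis n) (s : Fin 3) :
    ∑ k, rip (hess h p (unit s • stdBasis k)) (unit s • stdBasis k) = lap h p := by
  have := sum_qbasis_smul s.succ (ripBilin (hess h p) LinearMap.id)
  rw [qbasis_succ] at this
  exact this

/-- Trace the Einstein identity over the standard basis: the Hessian terms all reduce to the
sub-Laplacian. -/
theorem scal_eq (Q : QCStructure n Ω (confForm h)) (hs : ContDiffOn ℝ ∞ h Ω)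
    (hpos : ∀ p ∈ Ω, 0 < h p) {p : QHeis n} (hp : p ∈ Ω) (hΓ : Q.IsBiquardConnection Γ)
    (hE : Q.IsQCEinstein Γ) (hn : n ≠ 0) {e : Fin (4 * n) → QHeis n}
    (he : Q.IsFrame p e) :
    Q.scal Γ p e = 8 * n * (n + 2) * (4 * hessTrace h p - rip (grad h p) (grad h p) / h p) := by
  have hn' : (n : ℝ) ≠ 0 := by exact_mod_cast hn
  have h0 := hpos p hp
  have h1 : ∀ A, Q.scal Γ p e / (4 * n) * ((2 * h p)⁻¹ * rip A A) = _ := fun A => by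
    rw [← Q.g_hor hs hpos hp, ← hE p hp e he _ (hor_mem p A) _ (hor_mem p A),
      Q.ricci_hor hs hpos hp hΓ hn he A]
  have h2 := Finset.sum_congr (rfl : (Finset.univ : Finset (Fin n × Fin 4)) = _)
    fun k _ => h1 (stdBasis k)
  simp only [Finset.sum_add_distrib, Finset.sum_sub_distrib, ← Finset.mul_sum, ← Finset.sum_mul,
    sum_rip_stdBasis_self, sum_normSq_hip] at h2
  rw [Finset.sum_comm] at h2
  simp only [sum_hess_unit] at h2
  rw [show ∑ k, rip (hess h p (stdBasis k)) (stdBasis k) = lap h p from rfl] at h2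
  simp only [Finset.sum_const, Finset.card_univ, Fintype.card_fin, nsmul_eq_mul] at h2
  rw [hessTrace]
  field_simp at h2 ⊢
  push_cast at h2
  linear_combination h2

/-- The metric term and |(A, ∇h)|² are invariant under the units, so `quadratic_invariant` makes the
Hessian form invariant too, and the Einstein identity can be solved for it. -/
theorem hess_quadratic (Q : QCStructure n Ω (confForm h)) (hs : ContDiffOn ℝ ∞ h Ω)
    (hpos : ∀ p ∈ Ω, 0 < h p) {p : QHeis n} (hp : p ∈ Ω) (hΓ : Q.IsBiquardConnection Γ)
    (hE : Q.IsQCEinstein Γ) (hn : n ≠ 0) (A : Fin n → ℍ[ℝ]) :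
    rip (hess h p A) A = hessTrace h p * rip A A +
      (2 * h p)⁻¹ * Quaternion.normSq (hip A (grad h p)) := by
  have hn' : (n : ℝ) ≠ 0 := by exact_mod_cast hn
  have h0 := hpos p hp
  set k : ℝ := (2 * h p)⁻¹ with hk
  have hkpos : 0 < k := by positivity
  have he := Q.isFrame_stdFrame hs hpos hp
  obtain ⟨ρ, hρ⟩ : ∃ ρ : ℝ, ∀ A, k * (4 * n + 11 / 2) * rip (hess h p A) A +
      k * (3 / 2) * ∑ s, rip (hess h p (unit s • A)) (unit s • A) =
      ρ * rip A A + (4 * n + 10) * k ^ 2 * Quaternion.normSq (hip A (grad h p)) := by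
    refine ⟨Q.scal Γ p (stdFrame h p) / (4 * n) * k - (k * (1 + 3 / (2 * n)) * lap h p -
        (4 * n + 12 + 6 / n) * k ^ 2 * rip (grad h p) (grad h p)), fun A => ?_⟩
    have h1 := hE p hp _ he _ (hor_mem p A) _ (hor_mem p A)
    rw [Q.ricci_hor hs hpos hp hΓ hn he A, Q.g_hor hs hpos hp, ← hk] at h1
    linear_combination h1
  have hinv := quadratic_invariant (H := fun A => rip (hess h p A) A)
    (N := fun A => ρ * rip A A + (4 * n + 10) * k ^ 2 * Quaternion.normSq (hip A (grad h p)))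
    (fun A => by simp [rip_neg_left, rip_neg_right])
    (fun t A => by
      have e1 : Quaternion.normSq (unit t) = 1 := by
        fin_cases t <;> simp [Quaternion.normSq_def']
      have e2 : star (unit t) * unit t = 1 := by
        rw [Quaternion.star_mul_self, e1, Quaternion.coe_one]
      rw [rip_qsmul_qsmul, e2, one_smul, hip_smul_left, map_mul, e1, one_mul])
    (by nlinarith [(Nat.cast_nonneg n : (0 : ℝ) ≤ n)]) hρ
  have hρ' : ∀ A, (4 * n + 10) * k * rip (hess h p A) A =
      ρ * rip A A + (4 * n + 10) * k ^ 2 * Quaternion.normSq (hip A (grad h p)) := fun A => by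
    rw [← hρ A]
    simp only [hinv]
    simp
    ring
  -- The trace of `hρ'` expresses the unknown ρ through the sub-Laplacian.
  have htr := Finset.sum_congr (rfl : (Finset.univ : Finset (Fin n × Fin 4)) = _)
    fun i _ => hρ' (stdBasis i)
  simp only [Finset.sum_add_distrib, ← Finset.mul_sum, sum_rip_stdBasis_self, sum_normSq_hip]
    at htr
  rw [show ∑ k, rip (hess h p (stdBasis k)) (stdBasis k) = lap h p from rfl] at htr
  have hc : (0 : ℝ) < (4 * n + 10) * k := by positivity
  refine mul_left_cancel₀ hc.ne' ?_
  rw [hρ' A, hessTrace, ← hk]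
  field_simp
  linear_combination -rip A A * htr

theorem hess_comm (Q : QCStructure n Ω (confForm h)) (hs : ContDiffOn ℝ ∞ h Ω)
    {p : QHeis n} (hp : p ∈ Ω)
    (A B : Fin n → ℍ[ℝ]) :
    rip (hess h p A) B - rip (hess h p B) A =
      -2 * ∑ s, rip (unit s • A) B * fderiv ℝ h p (vert s) := by
  have h1 : ∀ X Y : Fin n → ℍ[ℝ],
      fderiv ℝ (fun x => fderiv ℝ h x (hor x Y)) p (hor p X) = rip (hess h p X) Y := fun X Y => by
    have := ((Q.hasDir_grad hs hp X).rip (hasDir_const Y p (hor p X))).congr Q.isOpen hp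
      fun x _ => (rip_grad h x Y).symm
    rw [this.eq, rip_zero_right, add_zero]
  have h2 := fderiv_hor_comm (hs.contDiffAt (Q.mem_nhds hp)) A B
  rw [h1, h1] at h2
  simpa using h2

/-- Polarizing `hess_quadratic` gives the symmetric part and `hess_comm` the skew part, which
becomes the imaginary part of `confM`. -/
theorem hess_eq (Q : QCStructure n Ω (confForm h)) (hs : ContDiffOn ℝ ∞ h Ω)
    (hpos : ∀ p ∈ Ω, 0 < h p) {p : QHeis n} (hp : p ∈ Ω) (hΓ : Q.IsBiquardConnection Γ)
    (hE : Q.IsQCEinstein Γ) (hn : n ≠ 0) (A : Fin n → ℍ[ℝ]) :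
    hess h p A = confM h (hessTrace h) p • A + (2 * h p)⁻¹ • (hip A (grad h p) • grad h p) := by
  refine rip_ext fun B => ?_
  have q := Q.hess_quadratic hs hpos hp hΓ hE hn
  have q1 := q (A + B)
  have q2 := q A
  have q3 := q B
  have c := Q.hess_comm hs hp A B
  simp only [map_add, rip_add_left, rip_add_right, hip_add_left, rip_comm B A] at q1
  rw [rip_add_left, rip_rsmul_left, rip_smul_left, rip_smul_left, hip_swap (grad h p) B]
  simp only [rip_unit_left] at c
  simp only [confM, rip, Fin.sum_univ_three, im_zero, im_one, im_two] at *
  simp only [Quaternion.normSq_def'] at q1 q2 q3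
  simp [Quaternion.re_mul, Quaternion.imI_mul, Quaternion.imJ_mul, Quaternion.imK_mul]
    at q1 q2 q3 c ⊢
  linear_combination (q1 - q2 - q3 + c) / 2

theorem contDiffOn_hessTrace (Q : QCStructure n Ω (confForm h)) (hs : ContDiffOn ℝ ∞ h Ω)
    (hpos : ∀ p ∈ Ω, 0 < h p)
    : ContDiffOn ℝ ∞ (hessTrace h) Ω := by
  have hg := contDiffOn_grad Q.isOpen hs
  have hl : ContDiffOn ℝ ∞ (lap h) Ω := ContDiffOn.sum fun k _ => contDiffOn_rip
    ((hg.fderiv_of_isOpen Q.isOpen (by simp)).clm_apply (contDiffOn_hor (stdBasis k)))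
    contDiffOn_const
  have hi : ContDiffOn ℝ ∞ (fun x => (2 * h x)⁻¹) Ω :=
    (contDiffOn_const.mul hs).inv fun x hx => by have := hpos x hx; positivity
  exact (hl.sub ((contDiffOn_const.mul hi).mul (contDiffOn_rip hg hg))).div_const _

theorem hessSystem (Q : QCStructure n Ω (confForm h)) (hs : ContDiffOn ℝ ∞ h Ω)
    (hpos : ∀ p ∈ Ω, 0 < h p) (hΓ : Q.IsBiquardConnection Γ)
    (hE : Q.IsQCEinstein Γ) (hn : n ≠ 0) :
    HessSystem Ω h (grad h) (hessTrace h) where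
  isOpen := Q.isOpen
  smooth_h := hs
  smooth_u := contDiffOn_grad Q.isOpen hs
  smooth_l := Q.contDiffOn_hessTrace hs hpos
  pos := hpos
  deriv_h p hp A := (Q.hasDir_h hs hp (hor p A)).congr_deriv (rip_grad h p A).symm
  deriv_u _ hp A := (Q.hasDir_grad hs hp A).congr_deriv (Q.hess_eq hs hpos hp hΓ hE hn A)

end QCStructure

/-- `|a + c q*|²` vanishes somewhere unless `c = 0`. -/
theorem exists_qcoord_eq (a : ℍ[ℝ]) {c : Fin n → ℍ[ℝ]} (hc : c ≠ 0) :
    ∃ p : QHeis n, a + ∑ i, c i * star (qcoord p i) = 0 := by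
  have hr := rip_self_pos hc
  -- The point q = -a* c / |c|² solves (c, q) = -a.
  refine ⟨hor 0 (-(rip c c)⁻¹ • star a • c), ?_⟩
  change a + hip c (qcoord _) = 0
  rw [qcoord_hor, hip_rsmul_right, hip_smul_right, star_star, hip_self,
    Quaternion.coe_mul_eq_smul, smul_smul, neg_mul, inv_mul_cancel₀ hr.ne', neg_smul, one_smul,
    add_neg_cancel]

end QC

end

/-! ### The classification -/

theorem mainTheorem2 (n : ℕ) (hn : 1 ≤ n)
    (Ω : Set (QC.QHeis n)) (hΩ : IsOpen Ω) (hΩc : IsConnected Ω)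
    (h : QC.QHeis n → ℝ) (hsmooth : ContDiffOn ℝ ∞ h Ω) (hpos : ∀ p ∈ Ω, 0 < h p)
    (Q : QC.QCStructure n Ω (QC.confForm h))
    (Γ : QC.QHeis n → QC.QHeis n →L[ℝ] QC.QHeis n →L[ℝ] QC.QHeis n)
    (hΓ : Q.IsBiquardConnection Γ) (hE : Q.IsQCEinstein Γ)
    (hS : n = 1 → ∃ k : ℝ, Q.HasConstantScal Γ k) :
    (∃ (c₀ σ : ℝ) (q₀ : Fin n → ℍ[ℝ]) (ω₀ : Fin 3 → ℝ), 0 < c₀ ∧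
      (∀ p ∈ Ω, h p = c₀ * ((σ + ∑ i, ‖QC.qcoord p i + q₀ i‖ ^ 2) ^ 2 +
        ∑ s, (p.2 s + ω₀ s + 2 * QC.im s (∑ i, q₀ i * star (QC.qcoord p i))) ^ 2)) ∧
      Q.HasConstantScal Γ (128 * n * (n + 2) * c₀ * σ)) ∨
    (∃ (a : ℍ[ℝ]) (c : Fin n → ℍ[ℝ]), (Ω = Set.univ → c = 0) ∧
      (∀ p ∈ Ω, h p = ‖a + ∑ i, c i * star (QC.qcoord p i)‖ ^ 2) ∧
      Q.HasConstantScal Γ (-(32 * n * (n + 2) * ∑ i, ‖c i‖ ^ 2))) := by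
  have hn0 : n ≠ 0 := by omega
  have : NeZero n := ⟨hn0⟩
  have hscal : ∀ p (hp : p ∈ Ω) e, Q.IsFrame p e → Q.scal Γ p e = 8 * n * (n + 2) *
      (4 * QC.QCStructure.hessTrace h p - QC.rip (QC.grad h p) (QC.grad h p) / h p) :=
    fun p hp e he => Q.scal_eq hsmooth hpos hp hΓ hE hn0 he
  have C := (Q.hessSystem hsmooth hpos hΓ hE hn0).confSystem hΩc.isPreconnected fun h1 => by
    obtain ⟨k, hk⟩ := hS h1
    refine ⟨k / (8 * n * (n + 2)), fun p hp => ?_⟩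
    have he := Q.isFrame_stdFrame hsmooth hpos hp
    have hn' : (n : ℝ) ≠ 0 := by exact_mod_cast hn0
    rw [← hk p hp _ he, hscal p hp _ he]
    field_simp
  obtain ⟨c, hc⟩ := C.normSq_const
  -- The value of the first integral |M|²/2h separates the two families; since h > 0, it is zero
  -- exactly when M vanishes identically.
  by_cases hc0 : c = 0
  · right
    have hM : ∀ p ∈ Ω, QC.confM h (QC.QCStructure.hessTrace h) p = 0 := fun p hp => by
      have h1 := hc p hp
      have h2 := hpos p hp
      rw [hc0, ← QC.normSq_eq_re] at h1
      exact Quaternion.normSq_eq_zero.1 ((mul_eq_zero.1 h1).resolve_left (by positivity))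
    obtain ⟨a, b, hh, hb⟩ := C.solve_of_eq_zero hM hΩc.nonempty
    refine ⟨a, b, fun hΩu => ?_, hh, fun p hp e he => ?_⟩
    -- On the whole group a nonzero coefficient vector would give h a zero.
    · by_contra hb0
      obtain ⟨p, hp⟩ := QC.exists_qcoord_eq a hb0
      have hpΩ : p ∈ Ω := hΩu ▸ Set.mem_univ p
      have h1 := hpos p hpΩ
      rw [hh p hpΩ, hp] at h1
      simp at h1
    · have h1 := hb p hp
      rw [QC.re_confM] at h1
      rw [hscal p hp e he, h1]
      ring
  · left
    obtain ⟨c₀, σ, q₀, ω₀, hc₀, hh, hσ⟩ := C.solve_of_ne_zero hc0 hc hΩc.nonempty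
    refine ⟨c₀, σ, q₀, ω₀, hc₀, hh, fun p hp e he => ?_⟩
    have h1 := hσ p hp
    rw [QC.re_confM] at h1
    rw [hscal p hp e he, h1]
    ring
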